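/- Let $\Omega\subseteq\mathbb{R}^2$ be a simply connected planar domain (a nonempty, open, simply connected subset of the plane; it need not be bounded). Let $$\rho_\Omega=\sup\{r\ge 0:\ \Omega \text{ contains an open disc of radius } r\}\in(0,\infty],\qquad \tilde\rho_\Omega=\frac{\rho_\Omega}{1+\frac{\pi\rho_\Omega^2}{|\Omega|}}$$ be the inradius and the reduced inradius of $\Omega$, where $|\Omega|\in(0,\infty]$ is the area of $\Omega$ and $\tilde\rho_\Omega:=\rho_\Omega$ if $|\Omega|=\infty$. Let $$\lambda_{1,1}(\Omega)=\inf_{D}\frac{|\partial D|}{|D|}$$ be the Cheeger constant of $\Omega$ restricted to smooth simply connected subdomains: $D$ ranges over all bounded simply connected domains $D\subseteq\Omega$ with $C^\infty$ boundary (near each of its boundary points, $D$ is the negativity set of a $C^\infty$ function whose differential does not vanish at that point), $|\partial D|$ is the length (one-dimensional Hausdorff measure) of $\partial D$, and $|D|$ is the area of $D$. Then $$\lambda_{1,1}(\Omega)\ \ge\ \frac{1}{\tilde\rho_\Omega},$$ where $1/\infty=0$. -/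

import Mathlib

open scoped ENNReal NNReal ContDiff MeasureTheory

noncomputable section

/-- The Euclidean plane. -/
abbrev Plane : Type := EuclideanSpace ℝ (Fin 2)

/-- A simply connected planar domain: an open subset of the plane that, as a topological space,
is simply connected (in particular nonempty and path connected). -/
structure IsSimplyConnectedDomain (Ω : Set Plane) : Prop where
  isOpen : IsOpen Ω
  simplyConnected : IsSimplyConnected Ω

/-- `D` has smooth boundary: near each of its boundary points `x`, the set `D` is the negativity
set of a `C^∞` function whose differential at `x` does not vanish. -/
def HasSmoothBoundary (D : Set Plane) : Prop :=
  ∀ x ∈ frontier D, ∃ (U : Set Plane) (φ : Plane → ℝ),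
    IsOpen U ∧ x ∈ U ∧ ContDiffOn ℝ ∞ φ U ∧ fderiv ℝ φ x ≠ 0 ∧ D ∩ U = {y ∈ U | φ y < 0}

/-- The bounded simply connected subdomains of `Ω` with smooth boundary. -/
def smoothSimplyConnectedSubdomains (Ω : Set Plane) : Set (Set Plane) :=
  {D | D ⊆ Ω ∧ Bornology.IsBounded D ∧ IsSimplyConnectedDomain D ∧ HasSmoothBoundary D}

/-- The area `|D|`. -/
def area (D : Set Plane) : ℝ≥0∞ := MeasureTheory.volume D

/-- The length `|∂D|` of the boundary, as one-dimensional Hausdorff measure. -/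
def boundaryLength (D : Set Plane) : ℝ≥0∞ :=
  MeasureTheory.Measure.hausdorffMeasure 1 (frontier D)

/-- `λ_{1,1}(Ω)`: the infimum of `|∂D| / |D|` over the bounded, smooth, simply connected
subdomains `D` of `Ω`. -/
def lambdaOneOne (Ω : Set Plane) : ℝ≥0∞ :=
  ⨅ D ∈ smoothSimplyConnectedSubdomains Ω, boundaryLength D / area D

/-- The inradius `ρ_Ω = sup {r : Ω contains a disc of radius r}`, in `[0, ∞]`. -/
def inradius (Ω : Set Plane) : ℝ≥0∞ :=
  ⨆ (r : ℝ≥0) (_ : ∃ x : Plane, Metric.ball x r ⊆ Ω), (r : ℝ≥0∞)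

/-- The reduced inradius `ρ_Ω / (1 + π ρ_Ω² / |Ω|)`, in `[0, ∞]`. By the conventions for division
in `[0, ∞]` it equals `ρ_Ω` when `|Ω| = ∞` (also when `ρ_Ω = ∞`). -/
def reducedInradius (Ω : Set Plane) : ℝ≥0∞ :=
  inradius Ω / (1 + ENNReal.ofReal Real.pi * inradius Ω ^ 2 / area Ω)

end

/-!
The theorem is a consequence of Bonnesen's inequality `|D| + π r² ≤ r |∂D|` for a bounded simply
connected domain `D` with smooth boundary, where `r` is the inradius of `D`. Dividing by `r |D|`
gives `|∂D| / |D| ≥ 1 / r + π r / |D|`, and `r ≤ ρ_Ω`, `|D| ≤ |Ω|` and `π ρ_Ω² ≤ |Ω|` turn this into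
the bound by `1 / ρ_Ω + π ρ_Ω / |Ω|` (`one_add_div_le_of_bonnesen`).

For Bonnesen's inequality (`IsBoundaryLoop.area_add_le`) let `γ` be the positively oriented
boundary of `D`, parametrized by arc length, `T` its tangent and `κ` its curvature, and compare `γ`
with the parallel curve `γ_r = γ + r i T`, which may have cusps and self-intersections. The integral
over the plane of the winding number of a closed curve `c` is `½ Im ∫ conj c · c'`
(`integral_ball_integral_div_sub`, where the winding number is a Cauchy integral and the
integration is exchanged). Since `∫ κ = 2π`, the difference of these integrals for `γ` and `γ_r` is
`r |∂D| - π r²`. So it suffices that almost everywhere the winding number of `γ` is at least that of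
`γ_r`, and by one larger on `D` (`IsBoundaryLoop.parallel_turn_le`).

This pointwise comparison is proved for one point `x` at a time. Where `γ` is outside of the disc of
radius `r` around `x`, the vectors from `x` to the points of `γ` and of `γ_r` differ in direction by
at most a right angle, so the difference of the two turnings can only arise on the arcs of `γ`
inside of the disc. For such an arc it can be computed exactly, and depends only on the side of the
arc on which `x` lies at the point of the arc nearest to `x` (`IsUnitSpeedLoop.parallel_turn_of_arc`).
That is where the simplicity of `γ` enters, through continuous arguments of the chords of `γ` in the
manner of Hopf's proof of the theorem on turning tangents. That theorem itself is proved here by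
pushing `γ` into `D`, where, as `D` is simply connected, it does not turn around points off `D`
(`IsBoundaryLoop.chordArg_swap`); the same idea shows that `∂D` has only one component
(`IsBoundaryLoop.range_eq_frontier`).

The curve `γ` is obtained as an integral curve: local defining functions of `D` are added up to a
global one, whose rotated and normalized gradient is a complete vector field tangent to `∂D`; an
integral curve in the compact set `∂D` returns, hence is periodic (`exists_isBoundaryLoop`). Its
period is at most the Hausdorff measure of `∂D` (`IsUnitSpeedLoop.ofReal_le_hausdorffMeasure`).

Everything up to the last section takes place in `ℂ`.
-/

open Complex Set Filter Topology MeasureTheory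

/-! ### Continuous arguments -/

/-- `θ` is a continuous choice of the argument of the nonvanishing function `f` on `S`. -/
structure IsArgOn {X : Type*} [TopologicalSpace X] (θ : X → ℝ) (f : X → ℂ) (S : Set X) :
    Prop where
  cont : ContinuousOn θ S
  ne : ∀ p ∈ S, f p ≠ 0
  eq : ∀ p ∈ S, f p = ‖f p‖ * cexp (θ p * I)

section IsArgOn

variable {X Y : Type*} [TopologicalSpace X] [TopologicalSpace Y]

theorem eq_norm_mul_exp_im_of_exp_eq {w z : ℂ} (h : cexp w = z) :
    z = ‖z‖ * cexp ((w.im : ℂ) * I) := by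
  rw [← h, Complex.norm_exp, Complex.ofReal_exp, ← Complex.exp_add, Complex.re_add_im]

theorem IsArgOn.of_exp {ℓ f : X → ℂ} {S : Set X} (hℓ : ContinuousOn ℓ S)
    (h : ∀ p ∈ S, cexp (ℓ p) = f p) : IsArgOn (fun p => (ℓ p).im) f S where
  cont := Complex.continuous_im.comp_continuousOn hℓ
  ne p hp := h p hp ▸ Complex.exp_ne_zero _
  eq p hp := eq_norm_mul_exp_im_of_exp_eq (h p hp)

theorem exists_isArgOn_of_isSimplyConnected [LocallyPathConnectedSpace X] {S : Set X}
    (hS : IsSimplyConnected S) (hSo : IsOpen S) {f : X → ℂ} (hf : ContinuousOn f S)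
    (h0 : ∀ p ∈ S, f p ≠ 0) : ∃ θ, IsArgOn θ f S := by
  obtain ⟨ℓ, hℓ, h⟩ := exists_continuousOn_eqOn_exp_comp hS hSo hf
    (by rintro ⟨p, hp, h⟩; exact h0 p hp h)
  exact ⟨_, .of_exp hℓ h⟩

theorem exists_isArgOn_of_convex {E : Type*} [NormedAddCommGroup E] [NormedSpace ℝ E]
    {S : Set E} (hS : Convex ℝ S) {f : E → ℂ} (hf : ContinuousOn f S)
    (h0 : ∀ p ∈ S, f p ≠ 0) : ∃ θ, IsArgOn θ f S := by
  classical
  rcases S.eq_empty_or_nonempty with rfl | ⟨p₀, hp₀⟩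
  · exact ⟨0, by simp, by simp, by simp⟩
  have := hS.contractibleSpace ⟨p₀, hp₀⟩
  have := hS.locallyPathConnectedSpace
  obtain ⟨F, ⟨-, hF⟩, -⟩ := isCoveringMapOn_exp.existsUnique_continuousMap_lifts
    ⟨S.domRestrict f, continuousOn_iff_continuous_domRestrict.mp hf⟩
    (a₀ := ⟨p₀, hp₀⟩) (exp_log (h0 p₀ hp₀)) (fun x => h0 x.1 x.2)
  refine ⟨_, IsArgOn.of_exp (ℓ := fun p => if hp : p ∈ S then F ⟨p, hp⟩ else 0) ?_ ?_⟩
  · rw [continuousOn_iff_continuous_domRestrict]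
    convert map_continuous F with x
    simp
  · intro p hp
    simpa [hp] using congr_fun hF ⟨p, hp⟩

theorem isArgOn_arg {f : X → ℂ} {S : Set X} (hf : ContinuousOn f S)
    (h : ∀ p ∈ S, f p ∈ slitPlane) : IsArgOn (fun p => (f p).arg) f S where
  cont p hp := (continuousAt_arg (h p hp)).comp_continuousWithinAt (hf p hp)
  ne p hp := slitPlane_ne_zero (h p hp)
  eq _ _ := (norm_mul_exp_arg_mul_I _).symm

namespace IsArgOn

variable {θ θ₁ θ₂ : X → ℝ} {f f₁ f₂ : X → ℂ} {S S' : Set X}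

theorem mono (h : IsArgOn θ f S) (hS : S' ⊆ S) : IsArgOn θ f S' :=
  ⟨h.cont.mono hS, fun p hp => h.ne p (hS hp), fun p hp => h.eq p (hS hp)⟩

theorem comp {R : Set Y} (h : IsArgOn θ f S) {g : Y → X} (hg : ContinuousOn g R)
    (hm : MapsTo g R S) : IsArgOn (fun y => θ (g y)) (fun y => f (g y)) R :=
  ⟨h.cont.comp hg hm, fun _ hp => h.ne _ (hm hp), fun _ hp => h.eq _ (hm hp)⟩

theorem congr (h : IsArgOn θ f₁ S) (he : ∀ p ∈ S, f₁ p = f₂ p) : IsArgOn θ f₂ S :=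
  ⟨h.cont, fun p hp => he p hp ▸ h.ne p hp, fun p hp => by rw [← he p hp]; exact h.eq p hp⟩

theorem mul (h₁ : IsArgOn θ₁ f₁ S) (h₂ : IsArgOn θ₂ f₂ S) :
    IsArgOn (fun p => θ₁ p + θ₂ p) (fun p => f₁ p * f₂ p) S where
  cont := h₁.cont.add h₂.cont
  ne p hp := mul_ne_zero (h₁.ne p hp) (h₂.ne p hp)
  eq p hp := by
    have e1 := h₁.eq p hp
    have e2 := h₂.eq p hp
    rw [norm_mul, ofReal_mul, ofReal_add, add_mul, Complex.exp_add]
    calc f₁ p * f₂ p = (‖f₁ p‖ * cexp (θ₁ p * I)) * (‖f₂ p‖ * cexp (θ₂ p * I)) := by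
          rw [← e1, ← e2]
      _ = _ := by ring

theorem add_const (h : IsArgOn θ f S) {u : ℂ} (hu : u ≠ 0) :
    IsArgOn (fun p => u.arg + θ p) (fun p => u * f p) S :=
  IsArgOn.mul ⟨continuousOn_const, fun _ _ => hu, fun _ _ => (norm_mul_exp_arg_mul_I _).symm⟩ h

/-- Continuous arguments of two functions whose quotient has a constant direction differ by a
constant on a preconnected set. -/
theorem sub_eq_sub (h₁ : IsArgOn θ₁ f₁ S) (h₂ : IsArgOn θ₂ f₂ S) (hS : IsPreconnected S)
    (u : ℂ) (hu : ∀ p ∈ S, ∃ c : ℝ, 0 < c ∧ f₁ p = c * u * f₂ p) {p q : X} (hp : p ∈ S)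
    (hq : q ∈ S) : θ₁ p - θ₁ q = θ₂ p - θ₂ q := by
  have key : ∀ a ∈ S, cexp (((θ₁ a - θ₂ a : ℝ) : ℂ) * I) = u / ‖u‖ := by
    intro a ha
    obtain ⟨c, hc, h⟩ := hu a ha
    have e1 := h₁.eq a ha
    have e2 := h₂.eq a ha
    have n1 : (‖f₁ a‖ : ℂ) ≠ 0 := by simpa using h₁.ne a ha
    have n2 : (‖f₂ a‖ : ℂ) ≠ 0 := by simpa using h₂.ne a ha
    have hn : ‖f₁ a‖ = c * ‖u‖ * ‖f₂ a‖ := by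
      rw [h, norm_mul, norm_mul, Complex.norm_real, Real.norm_of_nonneg hc.le]
    have hu0 : (‖u‖ : ℂ) ≠ 0 := by
      intro h0
      have : ‖u‖ = 0 := by exact_mod_cast h0
      rw [hn, this] at n1
      simp at n1
    have hc0 : (c : ℂ) ≠ 0 := by exact_mod_cast hc.ne'
    have hexp := Complex.exp_ne_zero (θ₂ a * I)
    rw [ofReal_sub, sub_mul, Complex.exp_sub, div_eq_div_iff hexp hu0]
    have hh : (‖f₁ a‖ : ℂ) * cexp (θ₁ a * I) = c * u * (‖f₂ a‖ * cexp (θ₂ a * I)) := by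
      rw [← e1, ← e2, h]
    rw [hn] at hh
    push_cast at hh
    have : (c * ‖f₂ a‖ : ℂ) ≠ 0 := mul_ne_zero hc0 n2
    apply mul_left_cancel₀ this
    linear_combination hh
  have := Circle.isCoveringMap_exp.constOn_of_comp (g := fun a => θ₁ a - θ₂ a) hS
    (h₁.cont.sub h₂.cont)
    (fun a ha b hb => by
      apply Subtype.ext
      rw [Circle.coe_exp, Circle.coe_exp, key a ha, key b hb]) hp hq
  have h' : θ₁ p - θ₂ p = θ₁ q - θ₂ q := this
  linarith

theorem sub_eq_sub_self (h₁ : IsArgOn θ₁ f S) (h₂ : IsArgOn θ₂ f S) (hS : IsPreconnected S)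
    {p q : X} (hp : p ∈ S) (hq : q ∈ S) : θ₁ p - θ₁ q = θ₂ p - θ₂ q :=
  h₁.sub_eq_sub h₂ hS 1 (fun _ _ => ⟨1, one_pos, by simp⟩) hp hq

/-- A function with values in the right half-plane (or more generally in the slit plane, after a
constant rotation) has its argument given by the principal branch. -/
theorem sub_eq_arg_sub_arg (h : IsArgOn θ f S) (hS : IsPreconnected S) {u : ℂ}
    (hf : ContinuousOn f S) (hu : ∀ p ∈ S, f p / u ∈ slitPlane) {p q : X} (hp : p ∈ S)
    (hq : q ∈ S) : θ p - θ q = (f p / u).arg - (f q / u).arg := by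
  have hu0 : u ≠ 0 := by
    rintro rfl
    simpa using hu p hp
  exact h.sub_eq_sub (isArgOn_arg (hf.div_const u) hu) hS u
    (fun a _ => ⟨1, one_pos, by field_simp; simp⟩) hp hq

/-- The argument of a positive multiple of a fixed vector is constant. -/
theorem eq_of_forall_pos_mul (h : IsArgOn θ f S) (hS : IsPreconnected S) {u : ℂ}
    (hu : ∀ p ∈ S, ∃ c : ℝ, 0 < c ∧ f p = c * u) {p q : X} (hp : p ∈ S) (hq : q ∈ S) :
    θ p = θ q := by
  have h2 : IsArgOn (fun _ : X => (0 : ℝ)) (fun _ => (1 : ℂ)) S :=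
    ⟨continuousOn_const, by simp, by simp⟩
  have := h.sub_eq_sub h2 hS u (fun a ha => by simpa using hu a ha) hp hq
  linarith

theorem exists_int (h₁ : IsArgOn θ₁ f S) (h₂ : IsArgOn θ₂ f S) {p : X} (hp : p ∈ S) :
    ∃ n : ℤ, θ₁ p = θ₂ p + n * (2 * Real.pi) := by
  have n1 : (‖f p‖ : ℂ) ≠ 0 := by simpa using h₁.ne p hp
  have e : cexp (θ₁ p * I) = cexp (θ₂ p * I) :=
    mul_left_cancel₀ n1 ((h₁.eq p hp).symm.trans (h₂.eq p hp))
  obtain ⟨n, hn⟩ := Complex.exp_eq_exp_iff_exists_int.1 e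
  refine ⟨n, ?_⟩
  have := congrArg Complex.im hn
  simpa using this

end IsArgOn

/-- The corner lemma. The function `V (t, ε) = t A(t, ε) + ε B(t, ε)` vanishes at the corner `0` of
a rectangle, and `B = μ i A(0, 0)` on the edge `t = 0`. A continuous argument of `V` on the rest of the
rectangle changes by `μ π / 2` when the corner is passed, and along the edge `ε = 0` it changes as
the argument of `A` does. -/
theorem arg_change_at_corner {β d μ : ℝ} (hβ : 0 < β) (hd : 0 < d) (hμ : μ = 1 ∨ μ = -1)
    {A B : ℝ × ℝ → ℂ} {Θ : ℝ × ℝ → ℝ} {eA : ℝ → ℝ}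
    (hA : ContinuousOn A (Icc 0 β ×ˢ Icc 0 d)) (hB : ContinuousOn B (Icc 0 β ×ˢ Icc 0 d))
    (heA : IsArgOn eA (fun t => A (t, 0)) (Icc 0 β))
    (hB0 : ∀ ε ∈ Icc 0 d, B (0, ε) = μ * I * A (0, 0))
    (hΘ : IsArgOn Θ (fun p => p.1 * A p + p.2 * B p) ((Icc 0 β ×ˢ Icc 0 d) \ {0})) :
    Θ (0, d) - Θ (β, 0) = eA 0 - eA β + μ * (Real.pi / 2) := by
  set R := min β d with hR
  have hRpos : 0 < R := lt_min hβ hd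
  have hpi := Real.pi_pos
  set Q : Set (ℝ × ℝ) := Icc 0 R ×ˢ Icc 0 (Real.pi / 2) with hQ
  set g : ℝ × ℝ → ℝ × ℝ := fun p => (p.1 * Real.cos p.2, p.1 * Real.sin p.2) with hg
  have hgc : Continuous g := by fun_prop
  have hcos : ∀ φ ∈ Icc 0 (Real.pi / 2), 0 ≤ Real.cos φ := fun φ hφ =>
    Real.cos_nonneg_of_mem_Icc ⟨by linarith [hφ.1], hφ.2⟩
  have hsin : ∀ φ ∈ Icc 0 (Real.pi / 2), 0 ≤ Real.sin φ := fun φ hφ =>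
    Real.sin_nonneg_of_mem_Icc ⟨hφ.1, by linarith [hφ.2]⟩
  have hgm : MapsTo g Q (Icc 0 β ×ˢ Icc 0 d) := by
    rintro ⟨ρ, φ⟩ ⟨hρ, hφ⟩
    refine ⟨⟨mul_nonneg hρ.1 (hcos φ hφ), ?_⟩, ⟨mul_nonneg hρ.1 (hsin φ hφ), ?_⟩⟩
    · calc ρ * Real.cos φ ≤ ρ * 1 := mul_le_mul_of_nonneg_left (Real.cos_le_one _) hρ.1
        _ ≤ β := by rw [mul_one]; exact hρ.2.trans (min_le_left _ _)
    · calc ρ * Real.sin φ ≤ ρ * 1 := mul_le_mul_of_nonneg_left (Real.sin_le_one _) hρ.1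
        _ ≤ d := by rw [mul_one]; exact hρ.2.trans (min_le_right _ _)
  have hg0 : ∀ p ∈ Q, p.1 ≠ 0 → g p ≠ 0 := by
    rintro ⟨ρ, φ⟩ - hρ h
    have h1 : ρ * Real.cos φ = 0 := congrArg Prod.fst h
    have h2 : ρ * Real.sin φ = 0 := congrArg Prod.snd h
    have := Real.sin_sq_add_cos_sq φ
    rcases mul_eq_zero.1 h1 with h1 | h1
    · exact hρ h1
    rcases mul_eq_zero.1 h2 with h2 | h2
    · exact hρ h2
    rw [h1, h2] at this
    norm_num at this
  -- the blow-up of `V` at the corner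
  set U : ℝ × ℝ → ℂ := fun p => Real.cos p.2 * A (g p) + Real.sin p.2 * B (g p) with hU
  have hUc : ContinuousOn U Q := by
    refine ContinuousOn.add (ContinuousOn.mul ?_ (hA.comp hgc.continuousOn hgm))
      (ContinuousOn.mul ?_ (hB.comp hgc.continuousOn hgm)) <;>
    exact (Complex.continuous_ofReal.comp (by fun_prop)).continuousOn
  have hUV : ∀ p : ℝ × ℝ, ((g p).1 : ℂ) * A (g p) + ((g p).2 : ℂ) * B (g p) = p.1 * U p := by
    intro p
    simp only [hg, hU]
    push_cast
    ring
  have hA0 : A (0, 0) ≠ 0 := heA.ne 0 ⟨le_rfl, hβ.le⟩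
  have hU0 : ∀ φ : ℝ, U (0, φ) = A (0, 0) * cexp ((μ * φ : ℝ) * I) := by
    intro φ
    have h1 : g (0, φ) = (0, 0) := by simp [hg]
    simp only [hU, h1, hB0 0 ⟨le_rfl, hd.le⟩]
    rw [Complex.exp_mul_I, ← Complex.ofReal_cos, ← Complex.ofReal_sin]
    rcases hμ with rfl | rfl
    · simp; ring
    · simp; ring
  have hUne : ∀ p ∈ Q, U p ≠ 0 := by
    rintro ⟨ρ, φ⟩ hp
    by_cases hρ : ρ = 0
    · subst hρ
      rw [hU0]
      exact mul_ne_zero hA0 (Complex.exp_ne_zero _)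
    · intro h
      refine hΘ.ne (g (ρ, φ)) ⟨hgm hp, hg0 _ hp hρ⟩ ?_
      rw [hUV, h, mul_zero]
  have hQc : Convex ℝ Q := (convex_Icc _ _).prod (convex_Icc _ _)
  obtain ⟨Ψ, hΨ⟩ := exists_isArgOn_of_convex hQc hUc hUne
  have h0R : (0 : ℝ) ∈ Icc 0 R := ⟨le_rfl, hRpos.le⟩
  have hRR : R ∈ Icc 0 R := ⟨hRpos.le, le_rfl⟩
  have h0π : (0 : ℝ) ∈ Icc 0 (Real.pi / 2) := ⟨le_rfl, by positivity⟩
  have hππ : Real.pi / 2 ∈ Icc 0 (Real.pi / 2) := ⟨by positivity, le_rfl⟩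
  have hRβ : R ≤ β := min_le_left _ _
  have hRd : R ≤ d := min_le_right _ _
  -- the side `ρ = 0` of the blow-up
  have s1 : Ψ (0, Real.pi / 2) - Ψ (0, 0) = μ * (Real.pi / 2) := by
    have a1 : IsArgOn (fun φ : ℝ => Ψ (0, φ)) (fun φ => U (0, φ)) (Icc 0 (Real.pi / 2)) :=
      hΨ.comp (by fun_prop) (fun φ hφ => ⟨h0R, hφ⟩)
    have a2 : IsArgOn (fun φ : ℝ => μ * φ) (fun φ : ℝ => cexp ((μ * φ : ℝ) * I))
        (Icc 0 (Real.pi / 2)) :=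
      ⟨by fun_prop, fun _ _ => Complex.exp_ne_zero _, fun φ _ => by
        rw [Complex.norm_exp_ofReal_mul_I]; simp⟩
    have := a1.sub_eq_sub a2 isPreconnected_Icc (A (0, 0))
      (fun φ _ => ⟨1, one_pos, by rw [hU0]; simp⟩) hππ h0π
    linarith
  -- the side `φ = 0`
  have s2 : Ψ (R, 0) - Ψ (0, 0) = eA R - eA 0 := by
    have a1 : IsArgOn (fun ρ : ℝ => Ψ (ρ, 0)) (fun ρ => A (ρ, 0)) (Icc 0 R) :=
      (hΨ.comp (g := fun ρ : ℝ => (ρ, (0 : ℝ))) (by fun_prop) (fun φ hφ => ⟨hφ, h0π⟩)).congr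
        (fun ρ _ => by simp [hU, hg])
    exact a1.sub_eq_sub_self (heA.mono (Icc_subset_Icc_right hRβ)) isPreconnected_Icc hRR h0R
  -- the side `φ = π / 2`
  have s3 : Ψ (R, Real.pi / 2) = Ψ (0, Real.pi / 2) := by
    have a1 : IsArgOn (fun ρ : ℝ => Ψ (ρ, Real.pi / 2)) (fun ρ => B (0, ρ)) (Icc 0 R) :=
      (hΨ.comp (g := fun ρ : ℝ => (ρ, Real.pi / 2)) (by fun_prop) (fun φ hφ => ⟨hφ, hππ⟩)).congr
        (fun ρ _ => by simp [hU, hg])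
    exact a1.eq_of_forall_pos_mul isPreconnected_Icc (u := μ * I * A (0, 0))
      (fun ρ hρ => ⟨1, one_pos, by rw [hB0 ρ ⟨hρ.1, hρ.2.trans hRd⟩]; simp⟩) hRR h0R
  -- the side `ρ = R`
  have s4 : Θ (0, R) - Θ (R, 0) = Ψ (R, Real.pi / 2) - Ψ (R, 0) := by
    have hm : MapsTo (fun φ : ℝ => g (R, φ)) (Icc 0 (Real.pi / 2))
        ((Icc 0 β ×ˢ Icc 0 d) \ {0}) := fun φ hφ =>
      ⟨hgm ⟨hRR, hφ⟩, hg0 (R, φ) ⟨hRR, hφ⟩ hRpos.ne'⟩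
    have a1 := hΘ.comp (g := fun φ : ℝ => g (R, φ)) (by fun_prop) hm
    have a2 : IsArgOn (fun φ : ℝ => Ψ (R, φ)) (fun φ => U (R, φ)) (Icc 0 (Real.pi / 2)) :=
      hΨ.comp (by fun_prop) (fun φ hφ => ⟨hRR, hφ⟩)
    have := a1.sub_eq_sub a2 isPreconnected_Icc 1
      (fun φ _ => ⟨R, hRpos, by rw [hUV]; simp⟩) hππ h0π
    simpa [hg] using this
  -- the rest of the two edges at the corner
  have s5 : Θ (β, 0) - Θ (R, 0) = eA β - eA R := by
    have a1 := hΘ.comp (g := fun t : ℝ => (t, (0 : ℝ))) (R := Icc R β) (by fun_prop)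
      (fun t ht => ⟨⟨⟨hRpos.le.trans ht.1, ht.2⟩, ⟨le_rfl, hd.le⟩⟩, fun h => by
        have : t = 0 := congrArg Prod.fst h
        linarith [ht.1]⟩)
    exact a1.sub_eq_sub (heA.mono (Icc_subset_Icc_left hRpos.le)) isPreconnected_Icc 1
      (fun t ht => ⟨t, hRpos.trans_le ht.1, by simp⟩) ⟨hRβ, le_rfl⟩ ⟨le_rfl, hRβ⟩
  have s6 : Θ (0, d) = Θ (0, R) := by
    have a1 := hΘ.comp (g := fun t : ℝ => ((0 : ℝ), t)) (R := Icc R d) (by fun_prop)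
      (fun t ht => ⟨⟨⟨le_rfl, hβ.le⟩, ⟨hRpos.le.trans ht.1, ht.2⟩⟩, fun h => by
        have : t = 0 := congrArg Prod.snd h
        linarith [ht.1]⟩)
    exact a1.eq_of_forall_pos_mul isPreconnected_Icc (u := μ * I * A (0, 0))
      (fun t ht => ⟨t, hRpos.trans_le ht.1, by
        simp [hB0 t ⟨hRpos.le.trans ht.1, ht.2⟩]⟩) ⟨hRd, le_rfl⟩ ⟨le_rfl, hRd⟩
  linarith

end IsArgOn

/-! ### Turning of curves -/

/-- Along the path `f` on `[a, b]`, the argument changes by `δ` in total. -/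
def HasTurn (f : ℝ → ℂ) (a b δ : ℝ) : Prop :=
  ∃ θ, IsArgOn θ f (Icc a b) ∧ θ b - θ a = δ

theorem HasTurn.sub_eq {θ : ℝ → ℝ} {f : ℝ → ℂ} {a b δ : ℝ} (hab : a ≤ b)
    (h : HasTurn f a b δ) (hθ : IsArgOn θ f (Icc a b)) : θ b - θ a = δ := by
  obtain ⟨θ', h', rfl⟩ := h
  exact hθ.sub_eq_sub_self h' isPreconnected_Icc ⟨hab, le_rfl⟩ ⟨le_rfl, hab⟩

theorem HasTurn.unique {f : ℝ → ℂ} {a b δ δ' : ℝ} (hab : a ≤ b)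
    (h : HasTurn f a b δ) (h' : HasTurn f a b δ') : δ = δ' := by
  obtain ⟨θ, hθ, rfl⟩ := h
  exact h'.sub_eq hab hθ

/-- Homotopic loops in the punctured plane turn equally. -/
theorem HasTurn.homotopy {V : ℝ × ℝ → ℂ} {a b c d δ : ℝ} (hab : a ≤ b) (hcd : c ≤ d)
    (hV : ContinuousOn V (Icc a b ×ˢ Icc c d)) (h0 : ∀ p ∈ Icc a b ×ˢ Icc c d, V p ≠ 0)
    (hper : ∀ l ∈ Icc c d, V (a, l) = V (b, l)) (h : HasTurn (fun t => V (t, c)) a b δ) :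
    HasTurn (fun t => V (t, d)) a b δ := by
  obtain ⟨Θ, hΘ⟩ := exists_isArgOn_of_convex ((convex_Icc a b).prod (convex_Icc c d)) hV h0
  have hline : ∀ l ∈ Icc c d, IsArgOn (fun t => Θ (t, l)) (fun t => V (t, l)) (Icc a b) :=
    fun l hl => hΘ.comp (by fun_prop) (fun t ht => ⟨ht, hl⟩)
  have hside : ∀ t ∈ Icc a b, IsArgOn (fun l => Θ (t, l)) (fun l => V (t, l)) (Icc c d) :=
    fun t ht => hΘ.comp (by fun_prop) (fun l hl => ⟨ht, hl⟩)
  have e := h.sub_eq hab (hline c ⟨le_rfl, hcd⟩)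
  refine ⟨_, hline d ⟨hcd, le_rfl⟩, ?_⟩
  have := (hside a ⟨le_rfl, hab⟩).sub_eq_sub (hside b ⟨hab, le_rfl⟩) isPreconnected_Icc 1
    (fun l hl => ⟨1, one_pos, by simp [hper l hl]⟩) (p := c) (q := d) ⟨le_rfl, hcd⟩ ⟨hcd, le_rfl⟩
  linarith

/-- A loop in a simply connected domain does not turn around points off the domain. -/
theorem hasTurn_zero_of_isSimplyConnected {D : Set ℂ} (hD : IsSimplyConnected D) (hDo : IsOpen D)
    {Q : ℂ} (hQ : Q ∉ D) {c : ℝ → ℂ} {a b : ℝ} (hc : ContinuousOn c (Icc a b))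
    (hcD : ∀ t ∈ Icc a b, c t ∈ D) (hper : c a = c b) : HasTurn (fun t => c t - Q) a b 0 := by
  obtain ⟨θ, hθ⟩ := exists_isArgOn_of_isSimplyConnected hD hDo (f := fun y => y - Q)
    (by fun_prop) (fun y hy h => hQ (by rwa [← sub_eq_zero.1 h]))
  exact ⟨_, hθ.comp hc hcD, by simp [hper]⟩

/-! ### Unit speed loops and their chords -/

/-- `γ` is a simple closed `C²` curve of length `L`, parametrized by arc length on the line, with
unit tangent `T` and signed curvature `κ`. -/
structure IsUnitSpeedLoop (γ T : ℝ → ℂ) (κ : ℝ → ℝ) (L : ℝ) : Prop where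
  pos : 0 < L
  hasDerivAt : ∀ s, HasDerivAt γ (T s) s
  hasDerivAt_tangent : ∀ s, HasDerivAt T (κ s * I * T s) s
  continuous_curvature : Continuous κ
  norm_tangent : ∀ s, ‖T s‖ = 1
  periodic : Function.Periodic γ L
  injective : ∀ s t, s < t → t < s + L → γ s ≠ γ t

/-- The mean of `T` over the segment from `p.1` to `p.2`. When `T` is the derivative of `γ`, this
is the slope of the chord of `γ`, extended to the diagonal by `T`. -/
noncomputable def chordSlope (T : ℝ → ℂ) (p : ℝ × ℝ) : ℂ :=
  ∫ u in (0 : ℝ)..1, T (p.1 + (p.2 - p.1) * u)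

/-- The pairs of parameters whose chords sweep out all chords of a loop of length `L`, with the
tangents as degenerate chords. -/
def chordStrip (L : ℝ) : Set (ℝ × ℝ) := {p | p.1 ≤ p.2 ∧ p.2 < p.1 + L}

theorem convex_chordStrip (L : ℝ) : Convex ℝ (chordStrip L) := by
  rintro ⟨a, b⟩ ⟨h1, h2⟩ ⟨c, d⟩ ⟨h3, h4⟩ x y hx hy hxy
  simp only at h1 h2 h3 h4
  refine ⟨?_, ?_⟩ <;> simp only [Prod.smul_mk, Prod.mk_add_mk, smul_eq_mul]
  · nlinarith
  · rcases hx.eq_or_lt with rfl | hx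
    · have : y = 1 := by linarith
      subst this
      linarith
    · nlinarith [mul_lt_mul_of_pos_left h2 hx, mul_le_mul_of_nonneg_left h4.le hy]

namespace IsUnitSpeedLoop

variable {γ T : ℝ → ℂ} {κ : ℝ → ℝ} {L : ℝ} (h : IsUnitSpeedLoop γ T κ L)
include h

theorem continuous : Continuous γ :=
  continuous_iff_continuousAt.2 fun s => (h.hasDerivAt s).continuousAt

theorem continuous_tangent : Continuous T :=
  continuous_iff_continuousAt.2 fun s => (h.hasDerivAt_tangent s).continuousAt

theorem tangent_ne_zero (s : ℝ) : T s ≠ 0 := by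
  intro h0
  simpa [h0] using h.norm_tangent s

theorem periodic_tangent : Function.Periodic T L := by
  intro s
  have h1 : HasDerivAt (fun s => γ (s + L)) (T (s + L)) s :=
    (h.hasDerivAt (s + L)).comp_add_const s L
  rw [funext h.periodic] at h1
  exact h1.unique (h.hasDerivAt s)

theorem periodic_curvature : Function.Periodic κ L := by
  intro s
  have h1 : HasDerivAt (fun s => T (s + L)) _ s :=
    (h.hasDerivAt_tangent (s + L)).comp_add_const s L
  rw [funext h.periodic_tangent] at h1
  have h2 := h1.unique (h.hasDerivAt_tangent s)
  rw [h.periodic_tangent s] at h2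
  have h3 := mul_right_cancel₀ I_ne_zero (mul_right_cancel₀ (h.tangent_ne_zero s) h2)
  exact_mod_cast h3

theorem continuous_chordSlope : Continuous (chordSlope T) := by
  unfold chordSlope
  have := h.continuous_tangent
  exact intervalIntegral.continuous_parametric_intervalIntegral_of_continuous' (by fun_prop) 0 1

theorem chordSlope_mul (s t : ℝ) : ((t - s : ℝ) : ℂ) * chordSlope T (s, t) = γ t - γ s := by
  have h1 := intervalIntegral.smul_integral_comp_add_mul (f := T) (t - s) s (a := 0) (b := 1)
  simp only [mul_zero, add_zero, mul_one, add_sub_cancel] at h1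
  rw [intervalIntegral.integral_eq_sub_of_hasDerivAt (fun x _ => h.hasDerivAt x)
    (h.continuous_tangent.intervalIntegrable _ _)] at h1
  rw [← h1, Complex.real_smul]
  rfl

omit h in
theorem chordSlope_diag (T : ℝ → ℂ) (s : ℝ) : chordSlope T (s, s) = T s := by
  simp [chordSlope]

theorem chordSlope_ne_zero {p : ℝ × ℝ} (hp : p ∈ chordStrip L) : chordSlope T p ≠ 0 := by
  obtain ⟨s, t⟩ := p
  obtain ⟨h1, h2⟩ := hp
  rcases (show s ≤ t from h1).eq_or_lt with rfl | h1
  · rw [chordSlope_diag]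
    exact h.tangent_ne_zero _
  · intro h0
    have := h.chordSlope_mul s t
    rw [h0, mul_zero] at this
    exact h.injective s t h1 h2 (sub_eq_zero.1 this.symm).symm

theorem exists_chordArg : ∃ E, IsArgOn E (chordSlope T) (chordStrip L) :=
  exists_isArgOn_of_convex (convex_chordStrip L) h.continuous_chordSlope.continuousOn
    fun _ hp => h.chordSlope_ne_zero hp

variable {E : ℝ × ℝ → ℝ} (hE : IsArgOn E (chordSlope T) (chordStrip L))
include hE

/-- The argument `E` of the chords, on the diagonal, is an argument of the tangent. -/
theorem isArgOn_tangent (S : Set ℝ) : IsArgOn (fun s => E (s, s)) T S :=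
  (hE.comp (g := fun s : ℝ => (s, s)) (by fun_prop)
    (fun s _ => ⟨le_rfl, by simpa using h.pos⟩)).congr fun s _ => chordSlope_diag T s

/-- When the end points of a chord are exchanged by passing once around the loop, the argument of
the chord changes by half of the total turning of the tangent. -/
theorem exists_chordArg_swap : ∃ c : ℝ,
    (∀ s t, s < t → t < s + L → E (t, s + L) = E (s, t) + c) ∧
    ∀ s, E (s + L, s + L) = E (s, s) + 2 * c := by
  have hL := h.pos
  set S : Set (ℝ × ℝ) := {p | p.1 < p.2 ∧ p.2 < p.1 + L} with hS
  have hSc : Convex ℝ S := by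
    have : S = (chordStrip L) ∩ {p | p.1 < p.2} := by
      ext p
      exact ⟨fun hp => ⟨⟨hp.1.le, hp.2⟩, hp.1⟩, fun hp => ⟨hp.2, hp.1.2⟩⟩
    rw [this]
    refine (convex_chordStrip L).inter ?_
    have := convex_halfSpace_lt (𝕜 := ℝ) (f := fun p : ℝ × ℝ => p.1 - p.2)
      ⟨fun _ _ => by simp; ring, fun _ _ => by simp; ring⟩ 0
    simpa [sub_lt_zero] using this
  have hsub : S ⊆ chordStrip L := fun p hp => ⟨hp.1.le, hp.2⟩
  have a1 : IsArgOn (fun p : ℝ × ℝ => E (p.2, p.1 + L)) (fun p => chordSlope T (p.2, p.1 + L)) S :=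
    hE.comp (g := fun p : ℝ × ℝ => (p.2, p.1 + L)) (by fun_prop)
      (fun p hp => ⟨hp.2.le, by simpa using hp.1⟩)
  have hq : ((0 : ℝ), L / 2) ∈ S := ⟨by simpa using hL, by simp; linarith⟩
  have e1 : ∀ s t, s < t → t < s + L →
      E (t, s + L) = E (s, t) + (E (L / 2, 0 + L) - E (0, L / 2)) := by
    intro s t h1 h2
    have := a1.sub_eq_sub (hE.mono hsub) hSc.isPreconnected (-1)
      (fun p hp => ⟨(p.2 - p.1) / (p.1 + L - p.2), div_pos (sub_pos.2 hp.1) (sub_pos.2 hp.2), by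
        have c1 := h.chordSlope_mul p.2 (p.1 + L)
        have c2 := h.chordSlope_mul p.1 p.2
        rw [h.periodic] at c1
        have : ((p.1 + L - p.2 : ℝ) : ℂ) ≠ 0 := by exact_mod_cast (sub_pos.2 hp.2).ne'
        apply mul_left_cancel₀ this
        rw [c1]
        push_cast at this c2 ⊢
        field_simp
        linear_combination c2⟩) (p := (s, t)) (q := (0, L / 2)) ⟨h1, h2⟩ hq
    linarith
  refine ⟨_, e1, fun s => ?_⟩
  have a2 : IsArgOn (fun p : ℝ × ℝ => E (p.1 + L, p.2 + L)) (chordSlope T) (chordStrip L) :=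
    (hE.comp (g := fun p : ℝ × ℝ => (p.1 + L, p.2 + L)) (by fun_prop)
      (fun p hp => ⟨by simpa using hp.1, by
        have : p.2 < p.1 + L := hp.2
        show p.2 + L < p.1 + L + L
        linarith⟩)).congr fun p hp => by
          simp only [chordSlope]
          congr 1
          ext u
          rw [← h.periodic_tangent (p.1 + _)]
          congr 1
          ring
  have := a2.sub_eq_sub_self hE (convex_chordStrip L).isPreconnected (p := (s, s))
    (q := (s, s + L / 2)) ⟨le_rfl, by simpa using hL⟩ ⟨by simp; linarith, by simp; linarith⟩
  have e2 := e1 s (s + L / 2) (by linarith) (by linarith)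
  have e3 := e1 (s + L / 2) (s + L) (by linarith) (by linarith)
  rw [show s + L / 2 + L = s + L + L / 2 by ring] at e3
  simp only at this
  rw [show s + L / 2 + L = s + L + L / 2 by ring] at this
  linarith

/-- The corner lemma for the vectors from `γ s₀` to the points of `γ` after `s₀`, displaced in a
direction `B` that at `s₀` is normal to `γ`, on the left for `μ = 1` and on the right for
`μ = -1`. -/
theorem corner_right {s₀ β d μ : ℝ} (hβ : 0 < β) (hβL : β < L) (hd : 0 < d)
    (hμ : μ = 1 ∨ μ = -1) {B : ℝ → ℂ} (hB : Continuous B) (hB0 : B s₀ = μ * I * T s₀)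
    {Θ : ℝ × ℝ → ℝ} (hΘ : IsArgOn Θ (fun p => γ p.1 - γ s₀ + p.2 * B p.1)
      ((Icc s₀ (s₀ + β) ×ˢ Icc 0 d) \ {(s₀, 0)})) :
    Θ (s₀, d) - Θ (s₀ + β, 0) = E (s₀, s₀) - E (s₀, s₀ + β) + μ * (Real.pi / 2) := by
  have hc := h.continuous_chordSlope
  have := arg_change_at_corner (β := β) (d := d) (μ := μ) hβ hd hμ
    (A := fun p => chordSlope T (s₀, s₀ + p.1)) (B := fun p => B (s₀ + p.1))
    (Θ := fun p => Θ (s₀ + p.1, p.2)) (eA := fun u => E (s₀, s₀ + u))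
    (by fun_prop) (by fun_prop)
    (hE.comp (g := fun u : ℝ => (s₀, s₀ + u)) (by fun_prop) (fun u hu =>
      ⟨by simpa using hu.1, by simpa using hu.2.trans_lt hβL⟩))
    (fun ε _ => by simp [chordSlope_diag, hB0])
    ((hΘ.comp (g := fun p : ℝ × ℝ => (s₀ + p.1, p.2)) (by fun_prop) (by
      rintro ⟨u, ε⟩ ⟨⟨⟨h1, h2⟩, h3⟩, h4⟩
      refine ⟨⟨⟨by simpa using h1, by simpa using h2⟩, h3⟩, fun h5 => h4 ?_⟩
      have h6 : s₀ + u = s₀ := congrArg Prod.fst h5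
      have h7 : ε = 0 := congrArg Prod.snd h5
      have h8 : u = 0 := by linarith
      rw [h7, h8]
      rfl)).congr fun p _ => by
        have := h.chordSlope_mul s₀ (s₀ + p.1)
        rw [add_sub_cancel_left] at this
        simp only
        rw [this])
  simpa using this

/-- The corner lemma for the vectors from `γ s₀` to the points of `γ` before `s₀`. These vectors
point backwards, which reverses the sign of the right angle. -/
theorem corner_left {s₀ β d μ : ℝ} (hβ : 0 < β) (hβL : β < L) (hd : 0 < d)
    (hμ : μ = 1 ∨ μ = -1) {B : ℝ → ℂ} (hB : Continuous B) (hB0 : B s₀ = μ * I * T s₀)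
    {Θ : ℝ × ℝ → ℝ} (hΘ : IsArgOn Θ (fun p => γ p.1 - γ s₀ + p.2 * B p.1)
      ((Icc (s₀ - β) s₀ ×ˢ Icc 0 d) \ {(s₀, 0)})) :
    Θ (s₀, d) - Θ (s₀ - β, 0) = E (s₀, s₀) - E (s₀ - β, s₀) - μ * (Real.pi / 2) := by
  have hc := h.continuous_chordSlope
  have := arg_change_at_corner (β := β) (d := d) (μ := -μ) hβ hd (by
      rcases hμ with rfl | rfl <;> simp)
    (A := fun p => -1 * chordSlope T (s₀ - p.1, s₀)) (B := fun p => B (s₀ - p.1))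
    (Θ := fun p => Θ (s₀ - p.1, p.2)) (eA := fun u => (-1 : ℂ).arg + E (s₀ - u, s₀))
    (by fun_prop) (by fun_prop)
    ((hE.comp (g := fun u : ℝ => (s₀ - u, s₀)) (by fun_prop) (fun u hu =>
      ⟨by simpa using hu.1, by
        have := hu.2.trans_lt hβL
        show s₀ < s₀ - u + L
        linarith⟩)).add_const (by norm_num))
    (fun ε _ => by simp [chordSlope_diag, hB0])
    ((hΘ.comp (g := fun p : ℝ × ℝ => (s₀ - p.1, p.2)) (by fun_prop) (by
      rintro ⟨u, ε⟩ ⟨⟨⟨h1, h2⟩, h3⟩, h4⟩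
      refine ⟨⟨⟨sub_le_sub_left h2 s₀, by simpa using h1⟩, h3⟩, fun h5 => h4 ?_⟩
      have h6 : s₀ - u = s₀ := congrArg Prod.fst h5
      have h7 : ε = 0 := congrArg Prod.snd h5
      have h8 : u = 0 := by linarith
      rw [h7, h8]
      rfl)).congr fun p _ => by
        have := h.chordSlope_mul (s₀ - p.1) s₀
        rw [sub_sub_cancel] at this
        simp only
        linear_combination this)
  simp only [sub_zero, neg_mul] at this
  linarith

end IsUnitSpeedLoop

theorem convex_rectangle_diff_corner {a b c d x : ℝ} (hx : x = a ∨ x = b) :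
    Convex ℝ ((Icc a b ×ˢ Icc c d) \ {(x, c)}) := by
  rintro ⟨t, u⟩ ⟨⟨⟨h1, h2⟩, ⟨h3, h4⟩⟩, h5⟩ ⟨t', u'⟩ ⟨⟨⟨h1', h2'⟩, ⟨h3', h4'⟩⟩, h5'⟩ y z hy hz hyz
  refine ⟨(convex_Icc a b).prod (convex_Icc c d) ⟨⟨h1, h2⟩, ⟨h3, h4⟩⟩
    ⟨⟨h1', h2'⟩, ⟨h3', h4'⟩⟩ hy hz hyz, ?_⟩
  simp only [mem_singleton_iff, Prod.mk.injEq, not_and, Prod.smul_mk, Prod.mk_add_mk,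
    smul_eq_mul] at h1 h2 h3 h1' h2' h3' h5 h5' ⊢
  intro e1 e2
  rcases hy.eq_or_lt with rfl | hy
  · have : z = 1 := by linarith
    subst this
    exact h5' (by linarith) (by linarith)
  rcases hz.eq_or_lt with rfl | hz
  · have : y = 1 := by linarith
    subst this
    exact h5 (by linarith) (by linarith)
  have hu : u = c := by
    have : y * (u - c) + z * (u' - c) = 0 := by linear_combination e2 - c * hyz
    have := mul_nonneg hz.le (sub_nonneg.2 h3')
    nlinarith
  have e3 : y * (t - x) + z * (t' - x) = 0 := by linear_combination e1 - x * hyz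
  refine h5 ?_ hu
  rcases hx with rfl | rfl
  · have := mul_nonneg hz.le (sub_nonneg.2 h1')
    nlinarith
  · have := mul_nonneg hz.le (sub_nonneg.2 h2')
    nlinarith

namespace IsUnitSpeedLoop

variable {γ T : ℝ → ℂ} {κ : ℝ → ℝ} {L : ℝ}

/-- Pushing the loop `γ - γ s₀` off the origin, to one side or the other according to the sign of
`μ`, produces a loop that turns by `c - μ π`, where `2 c` is the turning of the tangent. -/
theorem hasTurn_push (h : IsUnitSpeedLoop γ T κ L)
    {E : ℝ × ℝ → ℝ} (hE : IsArgOn E (chordSlope T) (chordStrip L)) {c : ℝ}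
    (hc : ∀ s t, s < t → t < s + L → E (t, s + L) = E (s, t) + c)
    (hc2 : ∀ s, E (s + L, s + L) = E (s, s) + 2 * c)
    {s₀ d μ : ℝ} (hd : 0 < d) (hμ : μ = 1 ∨ μ = -1) {B : ℝ → ℂ} (hB : Continuous B)
    (hBp : Function.Periodic B L) (hB0 : B s₀ = μ * I * T s₀)
    (hV : ∀ t ∈ Icc s₀ (s₀ + L), ∀ ε ∈ Ioc 0 d, γ t - γ s₀ + ε * B t ≠ 0) :
    HasTurn (fun t => γ t - γ s₀ + d * B t) s₀ (s₀ + L) (c - μ * Real.pi) := by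
  have hL := h.pos
  set V : ℝ × ℝ → ℂ := fun p => γ p.1 - γ s₀ + p.2 * B p.1 with hVdef
  have hγ := h.continuous
  have hVc : Continuous V := by fun_prop
  have hTne := h.tangent_ne_zero s₀
  -- the rectangle without two of its corners is convex
  set S : Set (ℝ × ℝ) := (Icc s₀ (s₀ + L) ×ˢ Icc 0 d) \ {(s₀, 0), (s₀ + L, 0)} with hS
  have hSc : Convex ℝ S := by
    have : S = ((Icc s₀ (s₀ + L) ×ˢ Icc 0 d) \ {(s₀, 0)}) ∩
        ((Icc s₀ (s₀ + L) ×ˢ Icc 0 d) \ {(s₀ + L, 0)}) := by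
      rw [hS, sdiff_inter_sdiff, singleton_union]
    rw [this]
    exact (convex_rectangle_diff_corner (Or.inl rfl)).inter
      (convex_rectangle_diff_corner (Or.inr rfl))
  have hVne : ∀ p ∈ S, V p ≠ 0 := by
    rintro ⟨t, ε⟩ ⟨⟨ht, hε⟩, h5⟩
    simp only [mem_insert_iff, mem_singleton_iff, Prod.mk.injEq, not_or, not_and] at h5
    rcases hε.1.eq_or_lt with e | hε0
    · have e' : ε = 0 := e.symm
      subst e'
      have h1 : s₀ < t := lt_of_le_of_ne ht.1 fun e => h5.1 e.symm rfl
      have h2 : t < s₀ + L := lt_of_le_of_ne ht.2 fun e => h5.2 e rfl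
      simp only [hVdef, ofReal_zero, zero_mul, add_zero]
      exact fun e => h.injective s₀ t h1 h2 (sub_eq_zero.1 e).symm
    · exact hV t ht ε ⟨hε0, hε.2⟩
  obtain ⟨Θ, hΘ⟩ := exists_isArgOn_of_convex hSc hVc.continuousOn hVne
  have r := h.corner_right hE (s₀ := s₀) (β := L / 2) (d := d) (μ := μ) (by positivity)
    (by linarith) hd hμ hB hB0 (Θ := Θ) (hΘ.mono (by
      rintro ⟨t, ε⟩ ⟨⟨ht, hε⟩, h5⟩
      refine ⟨⟨⟨ht.1, ht.2.trans (by linarith)⟩, hε⟩, ?_⟩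
      rintro (h6 | h6)
      · exact h5 h6
      · have h7 : t = s₀ + L := congrArg Prod.fst h6
        have h8 : t ≤ s₀ + L / 2 := ht.2
        linarith))
  have hp : γ (s₀ + L) = γ s₀ := h.periodic s₀
  have l := h.corner_left hE (s₀ := s₀ + L) (β := L / 2) (d := d) (μ := μ) (by positivity)
    (by linarith) hd hμ hB (by rw [hBp, hB0, h.periodic_tangent]) (Θ := Θ) (by
      rw [hp]
      refine hΘ.mono ?_
      rintro ⟨t, ε⟩ ⟨⟨ht, hε⟩, h5⟩
      have h8 : s₀ + L - L / 2 ≤ t := ht.1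
      refine ⟨⟨⟨by show s₀ ≤ t; linarith, ht.2⟩, hε⟩, ?_⟩
      rintro (h6 | h6)
      · have h7 : t = s₀ := congrArg Prod.fst h6
        linarith
      · exact h5 h6)
  refine ⟨fun t => Θ (t, d), hΘ.comp (by fun_prop) ?_, ?_⟩
  · intro t ht
    refine ⟨⟨ht, ⟨hd.le, le_rfl⟩⟩, ?_⟩
    rintro (h6 | h6) <;>
    exact hd.ne' (congrArg Prod.snd h6)
  · have e1 := hc s₀ (s₀ + L / 2) (by linarith) (by linarith)
    have e2 := hc2 s₀
    rw [show s₀ + L - L / 2 = s₀ + L / 2 by ring] at l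
    linarith

end IsUnitSpeedLoop

/-- The loop `γ` runs in the boundary of `D` with `D` on its left: normals of a uniform length are
contained in `D` on the left of `γ` and disjoint from `D` on its right. -/
structure IsBoundaryLoop (D : Set ℂ) (γ T : ℝ → ℂ) (κ : ℝ → ℝ) (L : ℝ) : Prop
    extends IsUnitSpeedLoop γ T κ L where
  mem_frontier : ∀ s, γ s ∈ frontier D
  exists_collar : ∃ δ > 0, ∀ s, ∀ ε ∈ Ioc (0 : ℝ) δ,
    γ s + ε * (I * T s) ∈ D ∧ γ s - ε * (I * T s) ∉ D

namespace IsBoundaryLoop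

variable {D : Set ℂ} {γ T : ℝ → ℂ} {κ : ℝ → ℝ} {L : ℝ}

theorem notMem (h : IsBoundaryLoop D γ T κ L) (hDo : IsOpen D) (s : ℝ) : γ s ∉ D := by
  have := h.mem_frontier s
  rw [hDo.frontier_eq] at this
  exact this.2

/-- **Rotation number of the boundary of a simply connected domain.** The loop `γ`, pushed into
`D`, does not turn around the points of `γ`; hence the tangent of `γ` turns by `2 π`. -/
theorem chordArg_swap (h : IsBoundaryLoop D γ T κ L) (hDo : IsOpen D) (hD : IsSimplyConnected D)
    {E : ℝ × ℝ → ℝ} (hE : IsArgOn E (chordSlope T) (chordStrip L)) :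
    (∀ s t, s < t → t < s + L → E (t, s + L) = E (s, t) + Real.pi) ∧
    ∀ s, E (s + L, s + L) = E (s, s) + 2 * Real.pi := by
  obtain ⟨c, hc, hc2⟩ := h.exists_chordArg_swap hE
  obtain ⟨δ, hδ, hcol⟩ := h.exists_collar
  have hT := h.continuous_tangent
  have hγ := h.continuous
  have hL := h.pos
  have hNp : Function.Periodic (fun t => I * T t) L := fun t => by
    simp only [h.periodic_tangent t]
  have t1 := h.hasTurn_push hE hc hc2 (s₀ := 0) (μ := 1) hδ (Or.inl rfl)
    (B := fun t => I * T t) (by fun_prop) hNp (by simp) (by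
      intro t _ ε hε h0
      refine h.notMem hDo 0 ?_
      have := (hcol t ε hε).1
      rwa [show γ t + ε * (I * T t) = γ 0 by linear_combination h0] at this)
  have t2 := hasTurn_zero_of_isSimplyConnected hD hDo (h.notMem hDo 0)
    (c := fun t => γ t + δ * (I * T t)) (a := 0) (b := 0 + L) (by fun_prop)
    (fun t _ => (hcol t δ ⟨hδ, le_rfl⟩).1) (by
      rw [h.periodic 0, h.periodic_tangent 0])
  have e : (fun t => γ t - γ 0 + δ * (I * T t)) = fun t => γ t + δ * (I * T t) - γ 0 := by
    ext t; ring
  rw [e] at t1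
  have := t1.unique (by linarith) t2
  have hcπ : c = Real.pi := by linarith
  subst hcπ
  exact ⟨hc, hc2⟩

/-- The loop `γ` turns once around every point of `D`. -/
theorem hasTurn_of_mem (h : IsBoundaryLoop D γ T κ L) (hDo : IsOpen D) (hD : IsSimplyConnected D)
    {y : ℂ} (hy : y ∈ D) (s₀ : ℝ) :
    HasTurn (fun t => γ t - y) s₀ (s₀ + L) (2 * Real.pi) := by
  obtain ⟨E, hE⟩ := h.exists_chordArg
  obtain ⟨hc, hc2⟩ := h.chordArg_swap hDo hD hE
  obtain ⟨δ, hδ, hcol⟩ := h.exists_collar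
  have hγ := h.continuous
  have hL := h.pos
  have t1 := h.hasTurn_push hE hc hc2 (s₀ := s₀) (μ := -1) hδ (Or.inr rfl)
    (B := fun _ => -(I * T s₀)) (by fun_prop) (fun _ => rfl) (by push_cast; ring) (by
      intro t _ ε hε h0
      refine h.notMem hDo t ?_
      have := (hcol s₀ ε hε).1
      rwa [show γ s₀ + ε * (I * T s₀) = γ t by linear_combination -h0] at this)
  set y₀ := γ s₀ + δ * (I * T s₀) with hy₀
  have hy₀D : y₀ ∈ D := (hcol s₀ δ ⟨hδ, le_rfl⟩).1
  obtain ⟨p, hp⟩ := hD.isPathConnected.joinedIn y₀ hy₀D y hy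
  have t2 := HasTurn.homotopy (V := fun q : ℝ × ℝ => γ q.1 - p.extend q.2) (a := s₀)
    (b := s₀ + L) (c := 0) (d := 1) (δ := 2 * Real.pi) (by linarith) zero_le_one
    (by
      have := p.continuous_extend
      fun_prop)
    (by
      rintro ⟨t, l⟩ ⟨_, hl⟩ h0
      refine h.notMem hDo t ?_
      rw [sub_eq_zero.1 h0]
      simp only
      rw [p.extend_apply hl]
      exact hp _)
    (fun l _ => by simp only [h.periodic s₀]) (by
      convert t1 using 1
      · ext t
        simp only [Path.extend_zero, hy₀]
        ring
      · ring)
  simpa using t2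

/-- The boundary of a simply connected domain consists of one loop: such a loop turns once around
the points of `D`, hence around all points of the boundary off the loop; but, pushed into `D`, it
does not turn around points off `D`. -/
theorem range_eq_frontier (h : IsBoundaryLoop D γ T κ L) (hDo : IsOpen D)
    (hD : IsSimplyConnected D) : range γ = frontier D := by
  refine Subset.antisymm (range_subset_iff.2 h.mem_frontier) fun Q hQ => ?_
  by_contra hQγ
  obtain ⟨δ, hδ, hcol⟩ := h.exists_collar
  have hγ := h.continuous
  have hT := h.continuous_tangent
  have hL := h.pos
  have hQ' := hQ
  rw [hDo.frontier_eq] at hQ'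
  have hne : ∀ t, γ t - Q ≠ 0 := fun t h0 => hQγ ⟨t, sub_eq_zero.1 h0⟩
  -- pushing `γ` into `D`
  have t1 : HasTurn (fun t => γ t - Q) 0 (0 + L) 0 := by
    have a1 := hasTurn_zero_of_isSimplyConnected hD hDo hQ'.2
      (c := fun t => γ t + δ * (I * T t)) (a := 0) (b := 0 + L) (by fun_prop)
      (fun t _ => (hcol t δ ⟨hδ, le_rfl⟩).1) (by
        rw [h.periodic 0, h.periodic_tangent 0])
    have := HasTurn.homotopy
      (V := fun q : ℝ × ℝ => γ q.1 + ((δ - q.2 : ℝ) : ℂ) * (I * T q.1) - Q) (a := 0)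
      (b := 0 + L) (c := 0) (d := δ) (δ := 0) (by linarith) hδ.le (by fun_prop)
      (by
        rintro ⟨t, l⟩ ⟨_, hl⟩ h0
        simp only at h0
        rcases hl.2.eq_or_lt with e | hl'
        · have e : l = δ := e
          subst e
          exact hne t (by simpa using h0)
        · have h1 := (hcol t (δ - l) ⟨sub_pos.2 hl', by linarith [hl.1]⟩).1
          exact hQ'.2 (by rwa [sub_eq_zero.1 h0] at h1))
      (fun l _ => by simp only [h.periodic 0, h.periodic_tangent 0])
      (by simpa using a1)
    simpa using this
  -- moving from a point of `D` near `Q` to `Q`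
  have hrange : IsCompact (γ '' Icc 0 (0 + L)) := isCompact_Icc.image hγ
  obtain ⟨η, hη, hball⟩ := Metric.isOpen_iff.1 hrange.isClosed.isOpen_compl Q
    (fun ⟨t, _, ht⟩ => hQγ ⟨t, ht⟩)
  obtain ⟨y, hyD, hy⟩ := Metric.mem_closure_iff.1 hQ'.1 η hη
  have t2 : HasTurn (fun t => γ t - Q) 0 (0 + L) (2 * Real.pi) := by
    have := HasTurn.homotopy
      (V := fun q : ℝ × ℝ => γ q.1 - (y + q.2 * (Q - y))) (a := 0)
      (b := 0 + L) (c := 0) (d := 1) (δ := 2 * Real.pi) (by linarith) zero_le_one (by fun_prop)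
      (by
        rintro ⟨t, l⟩ ⟨ht, hl⟩ h0
        refine hball (a := γ t) ?_ ⟨t, ht, rfl⟩
        rw [sub_eq_zero.1 h0, Metric.mem_ball, dist_eq_norm]
        have : y + l * (Q - y) - Q = ((1 - l : ℝ) : ℂ) * (y - Q) := by push_cast; ring
        rw [this, norm_mul, Complex.norm_real, Real.norm_of_nonneg (sub_nonneg.2 hl.2)]
        rw [dist_comm, dist_eq_norm] at hy
        have hl0 : 0 ≤ l := hl.1
        nlinarith [norm_nonneg (y - Q)])
      (fun l _ => by simp only [h.periodic 0])
      (by simpa using h.hasTurn_of_mem hDo hD hyD 0)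
    simpa using this
  have := t1.unique (by linarith) t2
  linarith [Real.pi_pos]

end IsBoundaryLoop

/-! ### Arguments at the ends of an arc inside a disc -/

theorem arg_pos_mul_exp {ρ θ : ℝ} (hρ : 0 < ρ) (hθ : θ ∈ Ioc (-Real.pi) Real.pi) :
    ((ρ : ℂ) * cexp (θ * I)).arg = θ := by
  rw [Complex.exp_mul_I, arg_mul_cos_add_sin_mul_I hρ hθ]

/-- The identity of arguments at a point where an arc leaves the disc of radius `r`. In the frame
in which the left normal of the arc is `1`, the centre of the disc is at `z`, seen from that point;
the arc leaves the disc if `0 ≤ z.im`. -/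
theorem arg_add_arg_sub_arg_of_im_nonneg {r : ℝ} {z : ℂ} (hr : 0 < r) (hz : ‖z‖ = r)
    (him : 0 ≤ z.im) (hne : z ≠ r) :
    (I / z).arg + (r - z).arg - (1 - r / z).arg = -(Real.pi / 2) := by
  set φ := z.arg with hφ
  have hφ0 : 0 ≤ φ := Complex.arg_nonneg_iff.2 him
  have hφπ : φ ≤ Real.pi := Complex.arg_le_pi z
  have hzφ : z = r * cexp (φ * I) := by rw [← hz, hφ, norm_mul_exp_arg_mul_I]
  have hφne : φ ≠ 0 := by
    intro h0
    rw [h0] at hzφ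
    exact hne (by simpa using hzφ)
  have hφpos : 0 < φ := lt_of_le_of_ne hφ0 hφne.symm
  have hsin : 0 < 2 * Real.sin (φ / 2) :=
    mul_pos two_pos (Real.sin_pos_of_pos_of_lt_pi (by linarith) (by linarith [Real.pi_pos]))
  set A := cexp ((φ / 2 : ℝ) * I) with hA
  set B := cexp (-((φ / 2 : ℝ) * I)) with hB
  have hAB : A * B = 1 := by rw [hA, hB, ← Complex.exp_add, add_neg_cancel, Complex.exp_zero]
  have hπ : cexp ((Real.pi / 2 : ℝ) * I) = I := by
    rw [Complex.exp_mul_I, ← Complex.ofReal_cos, ← Complex.ofReal_sin]; simp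
  have hπ' : cexp (-((Real.pi / 2 : ℝ) * I)) = -I := by
    rw [Complex.exp_neg, hπ, Complex.inv_I]
  have e0 : cexp (φ * I) = A * A := by
    rw [hA, ← Complex.exp_add]; congr 1; push_cast; ring
  have hsinc : ((2 * Real.sin (φ / 2) : ℝ) : ℂ) = (B - A) * I := by
    rw [hA, hB]
    push_cast
    rw [Complex.sin]
    simp only [neg_mul]
    ring
  have hr0 : (r : ℂ) ≠ 0 := by exact_mod_cast hr.ne'
  have hA0 : A ≠ 0 := Complex.exp_ne_zero _
  have hBA : B = A⁻¹ := eq_inv_of_mul_eq_one_right hAB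
  have e1 : I / z = (r⁻¹ : ℝ) * cexp ((Real.pi / 2 - φ : ℝ) * I) := by
    have : cexp ((Real.pi / 2 - φ : ℝ) * I) = I * (B * B) := by
      rw [show ((Real.pi / 2 - φ : ℝ) : ℂ) * I = (Real.pi / 2 : ℝ) * I +
        (-((φ / 2 : ℝ) * I) + -((φ / 2 : ℝ) * I)) by push_cast; ring, Complex.exp_add,
        Complex.exp_add, hπ]
    rw [this, hzφ, e0, hBA]
    push_cast
    field_simp
  have e2 : r - z = ((r * (2 * Real.sin (φ / 2)) : ℝ) : ℂ) * cexp (((φ - Real.pi) / 2 : ℝ) * I) := by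
    have : cexp (((φ - Real.pi) / 2 : ℝ) * I) = A * -I := by
      rw [← hπ', hA, ← Complex.exp_add]; congr 1; push_cast; ring
    rw [this, hzφ, e0, ofReal_mul, hsinc]
    linear_combination (A * r * (B - A)) * I_sq - r * hAB
  have e3 : 1 - r / z = ((2 * Real.sin (φ / 2) : ℝ) : ℂ) * cexp (((Real.pi - φ) / 2 : ℝ) * I) := by
    have : cexp (((Real.pi - φ) / 2 : ℝ) * I) = B * I := by
      rw [show (((Real.pi - φ) / 2 : ℝ) : ℂ) * I = -((φ / 2 : ℝ) * I) + (Real.pi / 2 : ℝ) * I by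
        push_cast; ring, Complex.exp_add, hπ]
    rw [this, hsinc, hzφ, e0, show (B - A) * I * (B * I) = (B - A) * B * (I * I) by ring, I_mul_I,
      hBA]
    field_simp
    ring
  have hpi := Real.pi_pos
  rw [e1, e2, e3, arg_pos_mul_exp (inv_pos.2 hr) ⟨by linarith, by linarith⟩,
    arg_pos_mul_exp (mul_pos hr hsin) ⟨by linarith, by linarith⟩,
    arg_pos_mul_exp hsin ⟨by linarith, by linarith⟩]
  ring

theorem re_sub_pos_of_norm_le {r : ℝ} {z : ℂ} (hz : ‖z‖ ≤ r) (hne : z ≠ r) : 0 < r - z.re := by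
  rcases ((Complex.re_le_norm z).trans hz).lt_or_eq with h | h
  · linarith
  · exfalso
    apply hne
    have h1 : z.re = ‖z‖ := le_antisymm (Complex.re_le_norm z) (hz.trans h.ge)
    have h2 := Complex.sq_norm z
    rw [Complex.normSq_apply, ← h1] at h2
    have h3 : z.im = 0 := by nlinarith
    apply Complex.ext <;> simp [h, h3]

/-- The identity of arguments at a point where an arc enters the disc of radius `r`, in the frame of
the left normal as for the point where it leaves. -/
theorem arg_add_arg_sub_arg_of_im_nonpos {r : ℝ} {z : ℂ} (hr : 0 < r) (hz : ‖z‖ = r)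
    (him : z.im ≤ 0) (hne : z ≠ r) :
    (-I / z).arg + (r - z).arg - (1 - r / z).arg = Real.pi / 2 := by
  have hz0 : z ≠ 0 := by rintro rfl; simp at hz; exact hr.ne hz
  have := arg_add_arg_sub_arg_of_im_nonneg (z := (starRingEnd ℂ) z) hr (by simpa using hz)
    (by simpa using him) (by
      intro h
      apply hne
      rw [← Complex.conj_conj z, h, Complex.conj_ofReal])
  have hsq : 0 < normSq z := Complex.normSq_pos.2 hz0
  have hconj : ∀ w : ℂ, 0 ≤ w.re → ((starRingEnd ℂ) w).arg = -w.arg := by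
    intro w hw
    rw [Complex.arg_conj, if_neg]
    intro h
    rw [Complex.arg_eq_pi_iff] at h
    linarith [h.1]
  have hre := re_sub_pos_of_norm_le hz.le hne
  have e1 : I / (starRingEnd ℂ) z = (starRingEnd ℂ) (-I / z) := by simp
  have e2 : (r : ℂ) - (starRingEnd ℂ) z = (starRingEnd ℂ) (r - z) := by simp
  have e3 : (1 : ℂ) - r / (starRingEnd ℂ) z = (starRingEnd ℂ) (1 - r / z) := by simp
  have hns : normSq z = r * r := by rw [Complex.normSq_eq_norm_sq, hz]; ring
  rw [e1, e2, e3, hconj, hconj, hconj] at this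
  · linarith
  · rw [Complex.sub_re, Complex.one_re, Complex.div_re, hns]
    simp only [ofReal_re, ofReal_im, zero_mul, zero_div, add_zero]
    have : r * z.re / (r * r) = z.re / r := by field_simp
    rw [this, sub_nonneg, div_le_one hr]
    linarith
  · simpa using hre.le
  · rw [Complex.div_re]
    simp only [neg_re, I_re, neg_zero, zero_mul, zero_div, neg_im, I_im, zero_add]
    exact div_nonneg (by linarith) hsq.le

theorem re_div_pos_of_mem_ball {x y q : ℂ} {r : ℝ} (hq : ‖q - x‖ = r) (hy : ‖y - x‖ < r) :
    0 < ((q - y) / (q - x)).re := by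
  have hr : 0 < r := (norm_nonneg _).trans_lt hy
  have hne : q - x ≠ 0 := norm_pos_iff.1 (hq ▸ hr)
  have e : (q - y) / (q - x) = 1 - (y - x) / (q - x) := by field_simp; ring
  rw [e, Complex.sub_re, Complex.one_re]
  have h1 : ‖(y - x) / (q - x)‖ < 1 := by rwa [norm_div, hq, div_lt_one hr]
  linarith [(Complex.re_le_norm ((y - x) / (q - x)))]

theorem mem_slitPlane_of_re_nonneg {w : ℂ} (h : 0 ≤ w.re) (h0 : w ≠ 0) : w ∈ slitPlane := by
  rw [mem_slitPlane_iff]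
  rcases h.lt_or_eq with h | h
  · exact Or.inl h
  · right
    intro h2
    exact h0 (Complex.ext h.symm h2)

theorem arg_eq_of_eq_pos_mul {w w' : ℂ} {c : ℝ} (hc : 0 < c) (h : w = c * w') : w.arg = w'.arg := by
  rw [h, Complex.arg_real_mul _ hc]

namespace IsUnitSpeedLoop

variable {γ T : ℝ → ℂ} {κ : ℝ → ℝ} {L : ℝ}

/-- Consider an arc of `γ` inside the disc of radius `r` around `x`, with end points on the circle,
and let `γ s₀` be a point of the arc nearest to `x`, at distance `d`. The turning around `x` of the
parallel arc at distance `r` to the left, less the turning of the arc itself, is determined by the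
directions at the end points and by the side `σ` of the arc on which `x` lies: this holds because
the arc is simple, so that all of the chords to its end points and to `γ s₀` have a direction, and
because the chords to the end points remain in half-planes. -/
theorem parallel_turn_of_arc (h : IsUnitSpeedLoop γ T κ L) {x : ℂ} {r a b s₀ d σ : ℝ}
    (hbL : b ≤ a + L) (ha : ‖γ a - x‖ = r) (hb : ‖γ b - x‖ = r)
    (hlt : ∀ s ∈ Ioo a b, ‖γ s - x‖ < r) (hs₀ : s₀ ∈ Ioo a b) (hd : 0 < d)
    (hσ : σ = 1 ∨ σ = -1) (hx : x = γ s₀ + σ * d * (I * T s₀))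
    (hmin : ∀ s ∈ Icc a b, d ≤ ‖γ s - x‖) (hr0 : ∀ s, γ s - x + r * (I * T s) ≠ 0)
    {v ζ : ℝ → ℝ} (hv : IsArgOn v (fun s => γ s - x + r * (I * T s)) (Icc a b))
    (hζ : IsArgOn ζ (fun s => γ s - x) (Icc a b)) :
    (v b - ζ b - ((γ b - x + r * (I * T b)) / (γ b - x)).arg) -
      (v a - ζ a - ((γ a - x + r * (I * T a)) / (γ a - x)).arg) = -(Real.pi * (1 + σ)) := by
  obtain ⟨E, hE⟩ := h.exists_chordArg
  have hT := h.continuous_tangent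
  have hγ := h.continuous
  have hq := h.continuous_chordSlope
  have hab : a < b := hs₀.1.trans hs₀.2
  have hσabs : |σ| = 1 := by rcases hσ with rfl | rfl <;> simp
  have hT0 := h.tangent_ne_zero
  have hd0 : ‖γ s₀ - x‖ = d := by
    rw [hx, show γ s₀ - (γ s₀ + σ * d * (I * T s₀)) = -((σ * d : ℝ) * (I * T s₀)) by push_cast; ring,
      norm_neg, norm_mul, norm_mul, h.norm_tangent, Complex.norm_I, Complex.norm_real,
      Real.norm_eq_abs, abs_mul, hσabs, abs_of_pos hd]
    ring
  have hdr : d < r := hd0 ▸ hlt s₀ hs₀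
  have hr : 0 < r := hd.trans hdr
  have hle : ∀ s ∈ Icc a b, ‖γ s - x‖ ≤ r := by
    intro s hs
    rcases hs.1.eq_or_lt with rfl | h1
    · exact ha.le
    rcases hs.2.eq_or_lt with rfl | h2
    · exact hb.le
    exact (hlt s ⟨h1, h2⟩).le
  have hane : γ a - x ≠ 0 := norm_pos_iff.1 (ha ▸ hr)
  have hbne : γ b - x ≠ 0 := norm_pos_iff.1 (hb ▸ hr)
  -- the position of `x` relative to the left normal
  set z : ℝ → ℂ := fun s => (x - γ s) / (I * T s) with hz
  have hzc : Continuous z :=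
    (continuous_const.sub hγ).div (by fun_prop) fun s => mul_ne_zero I_ne_zero (hT0 s)
  have hIT : ∀ s, I * T s ≠ 0 := fun s => mul_ne_zero I_ne_zero (hT0 s)
  have hznorm : ∀ s, ‖z s‖ = ‖γ s - x‖ := by
    intro s
    rw [hz]
    simp only [norm_div, norm_mul, Complex.norm_I, h.norm_tangent, one_mul, div_one]
    exact norm_sub_rev _ _
  have hzr : ∀ s, γ s - x + r * (I * T s) = I * (T s * (r - z s)) := by
    intro s
    have := hIT s
    have := hT0 s
    simp only [hz]
    field_simp
    ring
  have hzne : ∀ s, z s ≠ r := by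
    intro s h0
    apply hr0 s
    rw [hzr, h0]
    simp
  -- the turning of the parallel arc
  -- (it is the turning of the tangent and the change of the argument of `r - z`, a vector in the
  -- right half-plane as `‖z‖ ≤ r`)
  have hvturn : v b - v a = E (b, b) - E (a, a) + ((r - z b).arg - (r - z a).arg) := by
    have a1 := ((h.isArgOn_tangent hE (Icc a b)).mul
      (isArgOn_arg (f := fun s => (r : ℂ) - z s) (S := Icc a b) (by fun_prop) (fun s hs => by
        rw [mem_slitPlane_iff]
        left
        simpa using re_sub_pos_of_norm_le ((hznorm s).trans_le (hle s hs)) (hzne s)))).add_const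
      I_ne_zero
    have := hv.sub_eq_sub_self (a1.congr fun s _ => (hzr s).symm) isPreconnected_Icc
      (p := b) (q := a) ⟨hab.le, le_rfl⟩ ⟨le_rfl, hab.le⟩
    rw [this]
    ring
  -- the vectors to the points of `γ`, from a point that moves on the normal from `γ s₀` to `x`
  set B : ℝ → ℂ := fun _ => -(σ * (I * T s₀)) with hB
  have hμ : -σ = 1 ∨ -σ = -1 := by rcases hσ with rfl | rfl <;> simp
  set V : ℝ × ℝ → ℂ := fun p => γ p.1 - γ s₀ + p.2 * B p.1 with hV
  have hVc : Continuous V := by fun_prop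
  have hVx : ∀ p : ℝ × ℝ, V p = (γ p.1 - x) - ((p.2 - d : ℝ) * (σ * (I * T s₀))) := by
    intro p
    simp only [hV, hB]
    push_cast
    linear_combination hx
  have hVd : ∀ t, V (t, d) = γ t - x := fun t => by rw [hVx]; simp
  have hnorm1 : ∀ ε ∈ Icc 0 d, ‖((ε - d : ℝ) * (σ * (I * T s₀)) : ℂ)‖ = d - ε := by
    intro ε hε
    rw [norm_mul, norm_mul, norm_mul, h.norm_tangent, Complex.norm_I, Complex.norm_real,
      Complex.norm_real, Real.norm_eq_abs, Real.norm_eq_abs, hσabs,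
      abs_of_nonpos (sub_nonpos.2 hε.2)]
    ring
  -- no other point of the arc is met, as the disc of radius `d` around `x` has none inside
  have hVne : ∀ t ∈ Icc a b, ∀ ε ∈ Icc 0 d, (t ≠ s₀ ∨ ε ≠ 0) → V (t, ε) ≠ 0 := by
    intro t ht ε hε hne h0
    rcases hε.1.eq_or_lt with e | hε0
    · subst e
      have ht' : t ≠ s₀ := by simpa using hne
      simp only [hV, ofReal_zero, zero_mul, add_zero] at h0
      rcases lt_or_gt_of_ne ht' with h1 | h1
      · exact h.injective t s₀ h1 (by linarith [ht.1, hs₀.2]) (sub_eq_zero.1 h0)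
      · exact h.injective s₀ t h1 (by linarith [ht.2, hs₀.1]) (sub_eq_zero.1 h0).symm
    · rw [hVx, sub_eq_zero] at h0
      have := hmin t ht
      rw [h0, hnorm1 ε hε] at this
      linarith
  have hVball : ∀ ε ∈ Icc 0 d, ‖(x + (ε - d : ℝ) * (σ * (I * T s₀))) - x‖ < r := by
    intro ε hε
    rw [add_sub_cancel_left, hnorm1 ε hε]
    linarith [hε.1]
  -- the right part of the arc
  have right : 0 ≤ (T b / (γ b - x)).re ∧
      ζ b - ζ s₀ = E (b, b) - E (s₀, s₀) - (T b / (γ b - x)).arg + σ * (Real.pi / 2) := by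
    have hsub : (Icc s₀ b ×ˢ Icc 0 d) \ {(s₀, 0)} ⊆ {p | V p ≠ 0} := by
      rintro ⟨t, ε⟩ ⟨⟨ht, hε⟩, hne⟩
      refine hVne t ⟨hs₀.1.le.trans ht.1, ht.2⟩ ε hε ?_
      by_contra! hcon
      exact hne (Prod.ext hcon.1 hcon.2)
    obtain ⟨Θ, hΘ⟩ := exists_isArgOn_of_convex
      (convex_rectangle_diff_corner (a := s₀) (b := b) (c := 0) (d := d) (Or.inl rfl))
      hVc.continuousOn hsub
    have c1 := h.corner_right hE (s₀ := s₀) (β := b - s₀) (d := d) (μ := -σ)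
      (sub_pos.2 hs₀.2) (by linarith [hs₀.1]) hd hμ (B := B) (by fun_prop)
      (by simp only [hB]; push_cast; ring) (Θ := Θ) (by rw [add_sub_cancel]; exact hΘ)
    rw [add_sub_cancel] at c1
    -- the vectors to `γ b` from points inside of the disc are in the half-plane of `γ b - x`
    have c2 : Θ (b, d) - Θ (b, 0) = -((γ b - γ s₀) / (γ b - x)).arg := by
      have a1 := hΘ.comp (g := fun ε : ℝ => (b, ε)) (R := Icc 0 d) (by fun_prop)
        (fun ε hε => ⟨⟨⟨hs₀.2.le, le_rfl⟩, hε⟩, fun h0 => hs₀.2.ne' (congrArg Prod.fst h0)⟩)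
      have := a1.sub_eq_arg_sub_arg isPreconnected_Icc (u := γ b - x) (by fun_prop)
        (fun ε hε => by
          have := re_div_pos_of_mem_ball hb (hVball ε hε)
          rw [mem_slitPlane_iff]
          left
          convert this using 2
          rw [hVx]
          ring) (p := d) (q := 0) ⟨hd.le, le_rfl⟩ ⟨le_rfl, hd.le⟩
      rw [this, hVd, div_self hbne]
      simp [hV]
    have c3 : ζ b - ζ s₀ = Θ (b, d) - Θ (s₀, d) := by
      have a1 := hΘ.comp (g := fun t : ℝ => (t, d)) (R := Icc s₀ b) (by fun_prop)
        (fun t ht => ⟨⟨ht, ⟨hd.le, le_rfl⟩⟩, fun h0 => hd.ne' (congrArg Prod.snd h0)⟩)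
      exact (hζ.mono (Icc_subset_Icc_left hs₀.1.le)).sub_eq_sub_self
        (a1.congr fun t _ => hVd t) isPreconnected_Icc ⟨hs₀.2.le, le_rfl⟩ ⟨le_rfl, hs₀.2.le⟩
    have hbs : (0 : ℝ) < b - s₀ := sub_pos.2 hs₀.2
    have hpos : ∀ s ∈ Ico s₀ b, 0 < (chordSlope T (s, b) / (γ b - x)).re := by
      intro s hs
      have h1 := re_div_pos_of_mem_ball hb (hlt s ⟨hs₀.1.trans_le hs.1, hs.2⟩)
      rw [← h.chordSlope_mul s b, mul_div_assoc, re_ofReal_mul] at h1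
      exact pos_of_mul_pos_right h1 (sub_nonneg.2 hs.2.le)
    have hnn : ∀ s ∈ Icc s₀ b, 0 ≤ (chordSlope T (s, b) / (γ b - x)).re := by
      have hcl : IsClosed {s : ℝ | 0 ≤ (chordSlope T (s, b) / (γ b - x)).re} :=
        isClosed_le continuous_const (Complex.continuous_re.comp
          ((hq.comp (by fun_prop)).div_const _))
      have := hcl.closure_subset_iff.2 (fun s hs => (hpos s hs).le)
      rwa [closure_Ico hs₀.2.ne] at this
    -- so are the chords to `γ b`, and in the limit the tangent
    have c4 : E (b, b) - E (s₀, b) =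
        (T b / (γ b - x)).arg - ((γ b - γ s₀) / (γ b - x)).arg := by
      have hm : ∀ s ∈ Icc s₀ b, (s, b) ∈ chordStrip L := fun s hs =>
        ⟨hs.2, by
          show b < s + L
          linarith [hs.1, hs₀.1]⟩
      have a1 := hE.comp (g := fun s : ℝ => (s, b)) (R := Icc s₀ b) (by fun_prop) hm
      have := a1.sub_eq_arg_sub_arg isPreconnected_Icc (u := γ b - x) (by fun_prop)
        (fun s hs => mem_slitPlane_of_re_nonneg (hnn s hs)
          (div_ne_zero (h.chordSlope_ne_zero (hm s hs)) hbne))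
        (p := b) (q := s₀) ⟨hs₀.2.le, le_rfl⟩ ⟨le_rfl, hs₀.2.le⟩
      rw [this, chordSlope_diag]
      congr 1
      symm
      refine arg_eq_of_eq_pos_mul hbs ?_
      rw [← h.chordSlope_mul s₀ b, mul_div_assoc]
    refine ⟨?_, by linarith⟩
    simpa [chordSlope_diag] using hnn b ⟨hs₀.2.le, le_rfl⟩
  -- the left part of the arc
  have left : 0 ≤ (T a / (x - γ a)).re ∧
      ζ s₀ - ζ a = E (s₀, s₀) - E (a, a) + (T a / (x - γ a)).arg + σ * (Real.pi / 2) := by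
    have hsub : (Icc a s₀ ×ˢ Icc 0 d) \ {(s₀, 0)} ⊆ {p | V p ≠ 0} := by
      rintro ⟨t, ε⟩ ⟨⟨ht, hε⟩, hne⟩
      refine hVne t ⟨ht.1, ht.2.trans hs₀.2.le⟩ ε hε ?_
      by_contra! hcon
      exact hne (Prod.ext hcon.1 hcon.2)
    obtain ⟨Θ, hΘ⟩ := exists_isArgOn_of_convex
      (convex_rectangle_diff_corner (a := a) (b := s₀) (c := 0) (d := d) (Or.inr rfl))
      hVc.continuousOn hsub
    have c1 := h.corner_left hE (s₀ := s₀) (β := s₀ - a) (d := d) (μ := -σ)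
      (sub_pos.2 hs₀.1) (by linarith [hs₀.2]) hd hμ (B := B) (by fun_prop)
      (by simp only [hB]; push_cast; ring) (Θ := Θ) (by rw [sub_sub_cancel]; exact hΘ)
    rw [sub_sub_cancel] at c1
    -- the vectors from `γ a` to points inside of the disc are in the half-plane of `x - γ a`
    have c2 : Θ (a, d) - Θ (a, 0) = -((γ s₀ - γ a) / (x - γ a)).arg := by
      have a1 := hΘ.comp (g := fun ε : ℝ => (a, ε)) (R := Icc 0 d) (by fun_prop)
        (fun ε hε => ⟨⟨⟨le_rfl, hs₀.1.le⟩, hε⟩, fun h0 => hs₀.1.ne (congrArg Prod.fst h0)⟩)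
      have := a1.sub_eq_arg_sub_arg isPreconnected_Icc (u := γ a - x) (by fun_prop)
        (fun ε hε => by
          have := re_div_pos_of_mem_ball ha (hVball ε hε)
          rw [mem_slitPlane_iff]
          left
          convert this using 2
          rw [hVx]
          ring) (p := d) (q := 0) ⟨hd.le, le_rfl⟩ ⟨le_rfl, hd.le⟩
      rw [this, hVd, div_self hane, ← neg_div_neg_eq (γ s₀ - γ a), neg_sub, neg_sub]
      simp [hV]
    have c3 : ζ s₀ - ζ a = Θ (s₀, d) - Θ (a, d) := by
      have a1 := hΘ.comp (g := fun t : ℝ => (t, d)) (R := Icc a s₀) (by fun_prop)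
        (fun t ht => ⟨⟨ht, ⟨hd.le, le_rfl⟩⟩, fun h0 => hd.ne' (congrArg Prod.snd h0)⟩)
      exact (hζ.mono (Icc_subset_Icc_right hs₀.2.le)).sub_eq_sub_self
        (a1.congr fun t _ => hVd t) isPreconnected_Icc ⟨hs₀.1.le, le_rfl⟩ ⟨le_rfl, hs₀.1.le⟩
    have hbs : (0 : ℝ) < s₀ - a := sub_pos.2 hs₀.1
    have hane' : x - γ a ≠ 0 := by rw [← neg_sub]; exact neg_ne_zero.2 hane
    have hpos : ∀ s ∈ Ioc a s₀, 0 < (chordSlope T (a, s) / (x - γ a)).re := by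
      intro s hs
      have h1 := re_div_pos_of_mem_ball ha (hlt s ⟨hs.1, hs.2.trans_lt hs₀.2⟩)
      rw [← neg_div_neg_eq, neg_sub, neg_sub, ← h.chordSlope_mul a s, mul_div_assoc,
        re_ofReal_mul] at h1
      exact pos_of_mul_pos_right h1 (sub_nonneg.2 hs.1.le)
    have hnn : ∀ s ∈ Icc a s₀, 0 ≤ (chordSlope T (a, s) / (x - γ a)).re := by
      have hcl : IsClosed {s : ℝ | 0 ≤ (chordSlope T (a, s) / (x - γ a)).re} :=
        isClosed_le continuous_const (Complex.continuous_re.comp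
          ((hq.comp (by fun_prop)).div_const _))
      have := hcl.closure_subset_iff.2 (fun s hs => (hpos s hs).le)
      rwa [closure_Ioc hs₀.1.ne] at this
    -- so are the chords from `γ a`, and in the limit the tangent
    have c4 : E (a, s₀) - E (a, a) =
        ((γ s₀ - γ a) / (x - γ a)).arg - (T a / (x - γ a)).arg := by
      have hm : ∀ s ∈ Icc a s₀, (a, s) ∈ chordStrip L := fun s hs =>
        ⟨hs.1, by
          show s < a + L
          linarith [hs.2, hs₀.2]⟩
      have a1 := hE.comp (g := fun s : ℝ => (a, s)) (R := Icc a s₀) (by fun_prop) hm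
      have := a1.sub_eq_arg_sub_arg isPreconnected_Icc (u := x - γ a) (by fun_prop)
        (fun s hs => mem_slitPlane_of_re_nonneg (hnn s hs)
          (div_ne_zero (h.chordSlope_ne_zero (hm s hs)) hane'))
        (p := s₀) (q := a) ⟨hs₀.1.le, le_rfl⟩ ⟨le_rfl, hs₀.1.le⟩
      rw [this, chordSlope_diag]
      congr 1
      symm
      refine arg_eq_of_eq_pos_mul hbs ?_
      rw [← h.chordSlope_mul a s₀, mul_div_assoc]
    refine ⟨?_, by linarith⟩
    simpa [chordSlope_diag] using hnn a ⟨le_rfl, hs₀.1.le⟩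
  obtain ⟨hreb, right⟩ := right
  obtain ⟨hrea, left⟩ := left
  have hz0 : ∀ s ∈ Icc a b, z s ≠ 0 := fun s hs h0 => by
    have h1 := hznorm s
    rw [h0, norm_zero] at h1
    linarith [hmin s hs]
  have hquot : ∀ s ∈ Icc a b, (γ s - x + r * (I * T s)) / (γ s - x) = 1 - r / z s := by
    intro s hs
    have h1 := hz0 s hs
    have h2 : γ s - x = -(I * T s * z s) := by
      have := hT0 s
      simp only [hz]
      field_simp
      ring
    have h3 : I * T s * z s ≠ 0 := mul_ne_zero (hIT s) h1
    rw [h2]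
    have h4 := hT0 s
    field_simp
    ring
  have haI : a ∈ Icc a b := ⟨le_rfl, hab.le⟩
  have hbI : b ∈ Icc a b := ⟨hab.le, le_rfl⟩
  have hzb : I / z b = T b / (γ b - x) := by
    have h1 := hIT b
    have h2 : x - γ b ≠ 0 := by rw [← neg_sub]; exact neg_ne_zero.2 hbne
    simp only [hz]
    field_simp
    linear_combination (T b * (γ b - x)) * I_sq
  have hza : -I / z a = T a / (x - γ a) := by
    have h1 := hIT a
    have h2 : x - γ a ≠ 0 := by rw [← neg_sub]; exact neg_ne_zero.2 hane
    simp only [hz]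
    field_simp
    linear_combination -(T a) * I_sq
  have him : ∀ w : ℂ, w ≠ 0 → (I / w).re = w.im / normSq w := by
    intro w _
    rw [Complex.div_re]
    simp
  -- the tangent at the end points of the arc points out of the disc at `b` and into it at `a`
  have himb : 0 ≤ (z b).im := by
    rw [← hzb, him _ (hz0 b hbI)] at hreb
    have := Complex.normSq_pos.2 (hz0 b hbI)
    by_contra! hneg
    exact absurd hreb (not_le.2 (div_neg_of_neg_of_pos hneg this))
  have hima : (z a).im ≤ 0 := by
    rw [← hza, neg_div, Complex.neg_re, him _ (hz0 a haI)] at hrea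
    have := Complex.normSq_pos.2 (hz0 a haI)
    by_contra! hneg
    have := div_pos hneg this
    linarith
  have fb := arg_add_arg_sub_arg_of_im_nonneg hr ((hznorm b).trans hb) himb (hzne b)
  have fa := arg_add_arg_sub_arg_of_im_nonpos hr ((hznorm a).trans ha) hima (hzne a)
  rw [hzb] at fb
  rw [hza] at fa
  rw [hquot a haI, hquot b hbI]
  linear_combination hvturn - right - left + fb - fa

end IsUnitSpeedLoop

/-! ### Comparing a loop with its parallel loop -/

/-- A function that is locally constant on a closed set and does not increase across the gaps of
the set does not increase on the set. -/
theorem le_of_forall_gap_le {k : ℝ → ℝ} {G : Set ℝ} (hG : IsClosed G) {α β : ℝ} (hαβ : α ≤ β)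
    (hα : α ∈ G) (hβ : β ∈ G)
    (hloc : ∀ s ∈ G, ∀ᶠ t in 𝓝 s, t ∈ G → k t = k s)
    (hgap : ∀ a b, α ≤ a → a < b → b ≤ β → a ∈ G → b ∈ G → Disjoint (Ioo a b) G → k b ≤ k a) :
    k β ≤ k α := by
  by_contra! hlt
  set B : Set ℝ := {t | t ∈ G ∧ t ∈ Icc α β ∧ k α < k t} with hB
  have hBne : B.Nonempty := ⟨β, hβ, ⟨hαβ, le_rfl⟩, hlt⟩
  have hBbdd : BddBelow B := ⟨α, fun t ht => ht.2.1.1⟩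
  set m := sInf B with hm
  have hmcl : m ∈ closure B := csInf_mem_closure hBne hBbdd
  have hmG : m ∈ G := hG.closure_subset_iff.2 (fun t ht => ht.1) hmcl
  have hmI : m ∈ Icc α β := isClosed_Icc.closure_subset_iff.2 (fun t ht => ht.2.1) hmcl
  have hmB : m ∈ B := by
    refine ⟨hmG, hmI, ?_⟩
    obtain ⟨t, ht, htB⟩ := (mem_closure_iff_frequently.1 hmcl).and_eventually (hloc m hmG) |>.exists
    rw [← htB ht.1]
    exact ht.2.2
  have hmα : α < m := by
    refine lt_of_le_of_ne hmI.1 fun h => ?_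
    have := hmB.2.2
    rw [← h] at this
    exact lt_irrefl _ this
  have hmin : ∀ t ∈ B, m ≤ t := fun t ht => csInf_le hBbdd ht
  set C : Set ℝ := G ∩ Ico α m with hC
  have hCne : C.Nonempty := ⟨α, hα, le_rfl, hmα⟩
  have hCbdd : BddAbove C := ⟨m, fun t ht => ht.2.2.le⟩
  set a := sSup C with ha
  have hacl : a ∈ closure C := csSup_mem_closure hCne hCbdd
  have haG : a ∈ G := hG.closure_subset_iff.2 (fun t ht => ht.1) hacl
  have haI : a ∈ Icc α m := by
    have := closure_mono (inter_subset_right : C ⊆ Ico α m) hacl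
    rwa [closure_Ico hmα.ne] at this
  rcases haI.2.eq_or_lt with e | ham
  · rw [e] at hacl
    obtain ⟨t, ht, htC⟩ := (mem_closure_iff_frequently.1 hacl).and_eventually (hloc m hmG) |>.exists
    have : t ∈ B := ⟨ht.1, ⟨ht.2.1, ht.2.2.le.trans hmI.2⟩, by rw [htC ht.1]; exact hmB.2.2⟩
    exact absurd (hmin t this) (not_le.2 ht.2.2)
  · have := hgap a m haI.1 ham hmI.2 haG hmG (by
      rw [Set.disjoint_left]
      intro t ht htG
      have : t ≤ a := le_csSup hCbdd ⟨htG, haI.1.trans ht.1.le, ht.2⟩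
      exact absurd this (not_le.2 ht.1))
    exact absurd (hmin a ⟨haG, ⟨haI.1, haI.2.trans hmI.2⟩, hmB.2.2.trans_le this⟩) (not_le.2 ham)

namespace IsUnitSpeedLoop

variable {γ T : ℝ → ℂ} {κ : ℝ → ℝ} {L : ℝ}

/-- A nearest point is the foot of a normal. -/
theorem exists_eq_add_normal (h : IsUnitSpeedLoop γ T κ L) {x : ℂ} {s₀ : ℝ}
    (hmin : IsLocalMin (fun s => ‖γ s - x‖) s₀) :
    ∃ σ : ℝ, (σ = 1 ∨ σ = -1) ∧ x = γ s₀ + σ * ‖γ s₀ - x‖ * (I * T s₀) := by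
  have h1 : HasDerivAt (fun s => ‖γ s - x‖ ^ 2) _ s₀ := ((h.hasDerivAt s₀).sub_const x).norm_sq
  have h2 : IsLocalMin (fun s => ‖γ s - x‖ ^ 2) s₀ := by
    filter_upwards [hmin] with s hs
    exact pow_le_pow_left₀ (norm_nonneg _) hs 2
  have h3 := h2.hasDerivAt_eq_zero h1
  rw [Complex.inner] at h3
  have hT := h.norm_tangent s₀
  have hT0 := h.tangent_ne_zero s₀
  set w := (x - γ s₀) / (I * T s₀) with hw
  have hIT : I * T s₀ ≠ 0 := mul_ne_zero I_ne_zero hT0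
  have hxw : x - γ s₀ = w * (I * T s₀) := by rw [hw]; field_simp
  have hTT : T s₀ * (starRingEnd ℂ) (T s₀) = 1 := by
    rw [Complex.mul_conj, Complex.normSq_eq_norm_sq, hT]; simp
  have him : w.im = 0 := by
    have e : T s₀ * (starRingEnd ℂ) (γ s₀ - x) = I * (starRingEnd ℂ) w := by
      rw [← neg_sub, hxw, map_neg, map_mul, map_mul, Complex.conj_I]
      linear_combination (I * (starRingEnd ℂ) w) * hTT
    rw [e] at h3
    simpa using h3
  have hwre : w = (w.re : ℂ) := Complex.ext rfl (by simpa using him)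
  have hnorm : ‖γ s₀ - x‖ = |w.re| := by
    rw [norm_sub_rev, hxw, norm_mul, norm_mul, hT, Complex.norm_I, hwre, Complex.norm_real,
      Real.norm_eq_abs]
    simp
  rcases le_total 0 w.re with h0 | h0
  · refine ⟨1, Or.inl rfl, ?_⟩
    rw [hnorm, abs_of_nonneg h0, ofReal_one, one_mul, ← hwre, ← hxw]
    ring
  · refine ⟨-1, Or.inr rfl, ?_⟩
    rw [hnorm, abs_of_nonpos h0]
    push_cast
    rw [show (-1 : ℂ) * -(w.re : ℂ) = w.re by ring, ← hwre, ← hxw]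
    ring

/-- **Comparison of the turning of a loop and of its left parallel loop** around a point `x`. If
the loop is not contained in the open disc of radius `r` around `x`, then the parallel loop at
distance `r` turns around `x` at most as much as the loop does, and less by a full turn if the point
of the loop nearest to `x` is at a distance less than `r` and has `x` on its left. The difference is
collected on the arcs of the loop in the disc, since elsewhere the directions of the vectors from
`x` to the points of the two loops stay close to each other. -/
theorem parallel_turn_le (h : IsUnitSpeedLoop γ T κ L) {x : ℂ} {r α : ℝ} (hr : 0 < r)
    (hx : ∀ s, γ s ≠ x) (hr0 : ∀ s, γ s - x + r * (I * T s) ≠ 0) (hα : r ≤ ‖γ α - x‖)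
    {v ζ : ℝ → ℝ} (hv : IsArgOn v (fun s => γ s - x + r * (I * T s)) univ)
    (hζ : IsArgOn ζ (fun s => γ s - x) univ) :
    v (α + L) - v α ≤ ζ (α + L) - ζ α ∧
    ∀ s₁ ∈ Icc α (α + L), ‖γ s₁ - x‖ < r → (∀ s, ‖γ s₁ - x‖ ≤ ‖γ s - x‖) →
      x = γ s₁ + ‖γ s₁ - x‖ * (I * T s₁) →
      v (α + L) - v α ≤ ζ (α + L) - ζ α - 2 * Real.pi := by
  have hT := h.continuous_tangent
  have hγ := h.continuous
  have hL := h.pos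
  have hpi := Real.pi_pos
  have hne : ∀ s, γ s - x ≠ 0 := fun s => sub_ne_zero.2 (hx s)
  set q : ℝ → ℂ := fun s => (γ s - x + r * (I * T s)) / (γ s - x) with hq
  have hqc : Continuous q := by
    refine Continuous.div (by fun_prop) (by fun_prop) hne
  -- a multiple of `2 * π`, continuous off the points where `q` is in the cut of the argument
  set k : ℝ → ℝ := fun s => v s - ζ s - (q s).arg with hk
  set G : Set ℝ := {s | r ≤ ‖γ s - x‖} with hG
  have hGc : IsClosed G := isClosed_le continuous_const (by fun_prop)
  have hqG : ∀ s ∈ G, q s ∈ slitPlane := by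
    intro s hs
    refine mem_slitPlane_of_re_nonneg ?_ (div_ne_zero (hr0 s) (hne s))
    have e : q s = 1 + r * (I * T s) / (γ s - x) := by
      have := hne s
      simp only [hq]
      field_simp
    have hle : ‖r * (I * T s) / (γ s - x)‖ ≤ 1 := by
      rw [norm_div, norm_mul, norm_mul, h.norm_tangent, Complex.norm_I, Complex.norm_real,
        Real.norm_of_nonneg hr.le, mul_one, mul_one]
      exact div_le_one_of_le₀ hs (norm_nonneg _)
    rw [e, Complex.add_re, Complex.one_re]
    linarith [neg_le_of_abs_le ((Complex.abs_re_le_norm _).trans hle)]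
  have hkint : ∀ s, ∃ n : ℤ, k s = n * (2 * Real.pi) := by
    intro s
    have a1 : IsArgOn (fun s => ζ s + (q s).arg) (fun s => γ s - x + r * (I * T s)) {s} :=
      ((hζ.mono (subset_univ {s})).mul (f₂ := q) (θ₂ := fun s => (q s).arg)
        ⟨continuousOn_singleton _ _, fun p _ => div_ne_zero (hr0 p) (hne p),
          fun p _ => (norm_mul_exp_arg_mul_I _).symm⟩).congr fun p _ => by
            simp only [hq]
            rw [mul_div_cancel₀ _ (hne p)]
    obtain ⟨n, hn⟩ := (hv.mono (subset_univ {s})).exists_int a1 (mem_singleton s)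
    exact ⟨n, by simp only [hk]; linarith⟩
  have hloc : ∀ s ∈ G, ∀ᶠ t in 𝓝 s, t ∈ G → k t = k s := by
    intro s hs
    have hkc : ContinuousAt k s := by
      refine ContinuousAt.sub (ContinuousAt.sub ?_ ?_) ?_
      · exact (continuousOn_univ.1 hv.cont).continuousAt
      · exact (continuousOn_univ.1 hζ.cont).continuousAt
      · exact (continuousAt_arg (hqG s hs)).comp hqc.continuousAt
    filter_upwards [Metric.continuousAt_iff'.1 hkc (2 * Real.pi) (by positivity)] with t ht _
    obtain ⟨n, hn⟩ := hkint t
    obtain ⟨m, hm⟩ := hkint s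
    rw [Real.dist_eq, hn, hm, ← sub_mul, abs_mul, abs_of_pos (by positivity : 0 < 2 * Real.pi),
      mul_lt_iff_lt_one_left (by positivity)] at ht
    have : |n - m| < 1 := by exact_mod_cast ht
    have : n = m := by rw [Int.abs_lt_one_iff] at this; linarith
    rw [hn, hm, this]
  have hgap : ∀ a b s₀ : ℝ, b ≤ a + L → a ∈ G → b ∈ G → Disjoint (Ioo a b) G →
      s₀ ∈ Ioo a b → (∀ s ∈ Icc a b, ‖γ s₀ - x‖ ≤ ‖γ s - x‖) → ∀ σ : ℝ, (σ = 1 ∨ σ = -1) →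
      x = γ s₀ + σ * ‖γ s₀ - x‖ * (I * T s₀) → k b - k a = -(Real.pi * (1 + σ)) := by
    intro a b s₀ hbL ha hb hdis hs₀ hmin σ hσ hxs
    have hlt : ∀ s ∈ Ioo a b, ‖γ s - x‖ < r := fun s hs => by
      by_contra! hcon
      exact Set.disjoint_left.1 hdis hs hcon
    have hab : a < b := hs₀.1.trans hs₀.2
    have hend : ∀ s ∈ Icc a b, ‖γ s - x‖ ≤ r := by
      have hcl : IsClosed {s | ‖γ s - x‖ ≤ r} := isClosed_le (by fun_prop) continuous_const
      have := hcl.closure_subset_iff.2 (fun s hs => (hlt s hs).le)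
      rwa [closure_Ioo hab.ne] at this
    exact h.parallel_turn_of_arc hbL ((hend a ⟨le_rfl, hab.le⟩).antisymm ha)
      ((hend b ⟨hab.le, le_rfl⟩).antisymm hb) hlt hs₀ (norm_pos_iff.2 (hne s₀)) hσ hxs hmin hr0
      (hv.mono (subset_univ _)) (hζ.mono (subset_univ _))
  have hgap' : ∀ a b, α ≤ a → a < b → b ≤ α + L → a ∈ G → b ∈ G → Disjoint (Ioo a b) G →
      k b ≤ k a := by
    intro a b haα hab hbα ha hb hdis
    obtain ⟨s₀, hs₀, hmin⟩ := isCompact_Icc.exists_isMinOn (nonempty_Icc.2 hab.le)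
      (f := fun s => ‖γ s - x‖) (by fun_prop)
    have hmid : ‖γ ((a + b) / 2) - x‖ < r := by
      by_contra! hcon
      exact Set.disjoint_left.1 hdis ⟨by linarith, by linarith⟩ hcon
    have hs₀r : ‖γ s₀ - x‖ < r := (hmin (a := (a + b) / 2) ⟨by linarith, by linarith⟩).trans_lt hmid
    have hs₀' : s₀ ∈ Ioo a b := by
      refine ⟨lt_of_le_of_ne hs₀.1 ?_, lt_of_le_of_ne hs₀.2 ?_⟩
      · rintro rfl
        exact absurd ha (not_le.2 hs₀r)
      · rintro rfl
        exact absurd hb (not_le.2 hs₀r)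
    obtain ⟨σ, hσ, hxs⟩ := h.exists_eq_add_normal (x := x) (s₀ := s₀)
      (hmin.isLocalMin (Icc_mem_nhds hs₀'.1 hs₀'.2))
    have := hgap a b s₀ (by linarith) ha hb hdis hs₀' hmin σ hσ hxs
    rcases hσ with rfl | rfl <;> linarith
  have hβG : α + L ∈ G := by
    show r ≤ ‖γ (α + L) - x‖
    rw [h.periodic]
    exact hα
  have hqp : q (α + L) = q α := by simp only [hq, h.periodic α, h.periodic_tangent α]
  have hkv : k (α + L) - k α = (v (α + L) - v α) - (ζ (α + L) - ζ α) := by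
    simp only [hk, hqp]
    ring
  constructor
  · have := le_of_forall_gap_le hGc (by linarith) hα hβG hloc hgap'
    linarith
  · intro s₁ hs₁ hs₁r hmin hxs
    have hs₁G : s₁ ∉ G := not_le.2 hs₁r
    -- the gap that contains `s₁`
    obtain ⟨a, ⟨haG, haI⟩, hamax⟩ := (isCompact_Icc.inter_left hGc).exists_isGreatest
      (s := G ∩ Icc α s₁) ⟨α, hα, le_rfl, hs₁.1⟩
    obtain ⟨b, ⟨hbG, hbI⟩, hbmin⟩ := (isCompact_Icc.inter_left hGc).exists_isLeast
      (s := G ∩ Icc s₁ (α + L)) ⟨α + L, hβG, hs₁.2, le_rfl⟩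
    have has : a < s₁ := lt_of_le_of_ne haI.2 fun e => hs₁G (e ▸ haG)
    have hsb : s₁ < b := lt_of_le_of_ne hbI.1 fun e => hs₁G (e ▸ hbG)
    have hdis : Disjoint (Ioo a b) G := by
      rw [Set.disjoint_left]
      intro t ht htG
      rcases le_total t s₁ with h1 | h1
      · exact absurd (hamax ⟨htG, haI.1.trans ht.1.le, h1⟩) (not_le.2 ht.1)
      · exact absurd (hbmin ⟨htG, h1, ht.2.le.trans hbI.2⟩) (not_le.2 ht.2)
    have e1 := hgap a b s₁ (by linarith [haI.1, hbI.2]) haG hbG hdis ⟨has, hsb⟩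
      (fun s _ => hmin s) 1 (Or.inl rfl) (by simpa using hxs)
    have e2 := le_of_forall_gap_le hGc haI.1 hα haG hloc
      (fun a' b' h1 h2 h3 => hgap' a' b' h1 h2 (by linarith [hsb, hbI.2]))
    have e3 := le_of_forall_gap_le hGc hbI.2 hbG hβG hloc
      (fun a' b' h1 h2 h3 => hgap' a' b' (by linarith [haI.1]) h2 h3)
    linarith

end IsUnitSpeedLoop

/-- A connected set that meets an open set `D` but not its boundary lies in `D`. -/
theorem IsPreconnected.subset_of_disjoint_frontier {X : Type*} [TopologicalSpace X] {D t : Set X}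
    (ht : IsPreconnected t) (hDo : IsOpen D) (hne : (t ∩ D).Nonempty)
    (h : Disjoint t (frontier D)) : t ⊆ D := by
  refine ht.subset_left_of_subset_union hDo isClosed_closure.isOpen_compl
    (disjoint_compl_right.mono_left subset_closure) (fun y hy => ?_) hne
  by_contra hcon
  simp only [mem_union, mem_compl_iff, not_or, not_not] at hcon
  exact Set.disjoint_left.1 h hy (by rw [hDo.frontier_eq]; exact ⟨hcon.2, hcon.1⟩)

/-- **The pointwise form of the inequality.** Let `γ` be the boundary of `D`, and let no disc in `D`
have radius greater than `r`. Unless `γ` lies in the disc of radius `r` around `x`, the turning of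
`γ` around `x` exceeds that of the parallel loop at distance `r` by at least a full turn for `x` in
`D`, and is at least as large for the other `x`. -/
theorem IsBoundaryLoop.parallel_turn_le {D : Set ℂ} {γ T : ℝ → ℂ} {κ : ℝ → ℝ} {L : ℝ}
    (h : IsBoundaryLoop D γ T κ L) (hDo : IsOpen D) (hrange : range γ = frontier D)
    {x : ℂ} {r α : ℝ} (hr : 0 < r) (hrD : ∀ ρ, Metric.ball x ρ ⊆ D → ρ ≤ r)
    (hx : ∀ s, γ s ≠ x) (hr0 : ∀ s, γ s - x + r * (I * T s) ≠ 0) (hα : r ≤ ‖γ α - x‖)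
    {v ζ : ℝ → ℝ} (hv : IsArgOn v (fun s => γ s - x + r * (I * T s)) univ)
    (hζ : IsArgOn ζ (fun s => γ s - x) univ) :
    v (α + L) - v α + D.indicator (fun _ => 2 * Real.pi) x ≤ ζ (α + L) - ζ α := by
  obtain ⟨h1, h2⟩ := h.toIsUnitSpeedLoop.parallel_turn_le hr hx hr0 hα hv hζ
  by_cases hxD : x ∈ D
  swap
  · simpa [hxD] using h1
  have hγ := h.continuous
  have hL := h.pos
  rw [indicator_of_mem hxD]
  obtain ⟨s₁, hs₁, hmin⟩ := isCompact_Icc.exists_isMinOn (s := Icc α (α + L))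
    (nonempty_Icc.2 (by linarith)) (f := fun s => ‖γ s - x‖) (by fun_prop)
  have hmin' : ∀ s, ‖γ s₁ - x‖ ≤ ‖γ s - x‖ := by
    intro s
    obtain ⟨t, ht, hst⟩ := h.periodic.exists_mem_Ico hL s α
    rw [hst]
    exact hmin (Ico_subset_Icc_self ht)
  set d := ‖γ s₁ - x‖ with hd
  have hdpos : 0 < d := norm_pos_iff.2 (sub_ne_zero.2 (hx s₁))
  have hball : Metric.ball x d ⊆ D := by
    refine Metric.isPreconnected_ball.subset_of_disjoint_frontier hDo
      ⟨x, Metric.mem_ball_self hdpos, hxD⟩ ?_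
    rw [← hrange, Set.disjoint_right]
    rintro _ ⟨s, rfl⟩ hs
    rw [Metric.mem_ball, dist_eq_norm] at hs
    exact absurd (hmin' s) (not_le.2 hs)
  obtain ⟨σ, hσ, hxs⟩ := h.exists_eq_add_normal (x := x) (s₀ := s₁)
    (Filter.Eventually.of_forall hmin')
  rw [← hd] at hxs
  -- the disc around `x` touches `γ` at `γ s₁` from inside `D`, hence from the left
  have hσ1 : σ = 1 := by
    refine hσ.resolve_right ?_
    rintro rfl
    obtain ⟨δ, hδ, hcol⟩ := h.exists_collar
    set ε := min δ d with hε
    have hεpos : 0 < ε := lt_min hδ hdpos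
    refine (hcol s₁ ε ⟨hεpos, min_le_left _ _⟩).2 (hball ?_)
    rw [Metric.mem_ball, dist_eq_norm]
    have e : γ s₁ - ε * (I * T s₁) - x = ((d - ε : ℝ) : ℂ) * (I * T s₁) := by
      rw [hxs]
      push_cast
      ring
    rw [e, norm_mul, norm_mul, h.norm_tangent, Complex.norm_I, Complex.norm_real,
      Real.norm_of_nonneg (sub_nonneg.2 (min_le_right _ _))]
    linarith
  subst hσ1
  rw [ofReal_one, one_mul] at hxs
  -- for `d = r` the parallel loop would pass through `x`
  have hdr : d < r := by
    refine lt_of_le_of_ne (hrD d hball) fun e => hr0 s₁ ?_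
    rw [← e]
    linear_combination -hxs
  have := h2 s₁ hs₁ hdr hmin' hxs
  linarith

/-! ### The area enclosed by a loop, counted with multiplicity -/

theorem integrableOn_inv_norm_ball (R : ℝ) :
    IntegrableOn (fun x : ℂ => x⁻¹) (Metric.ball 0 R) := by
  refine integrableOn_ball_of_norm_le_rpow (C := 1) (α := 1) (by simp) (by simp)
    (Eventually.of_forall fun x => ?_) (by fun_prop)
  rw [norm_inv, one_mul, Real.rpow_neg_one]

theorem integrableOn_inv_sub_ball (ζ : ℂ) (R : ℝ) :
    IntegrableOn (fun x : ℂ => (ζ - x)⁻¹) (Metric.ball 0 R) := by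
  have h1 : IntegrableOn (fun x : ℂ => (ζ - x)⁻¹) ((fun x => ζ - x) ⁻¹' Metric.ball 0 (R + ‖ζ‖)) :=
    ((Measure.measurePreserving_sub_left (volume : Measure ℂ) ζ).integrableOn_comp_preimage
      (MeasurableEquiv.subLeft ζ).measurableEmbedding).2 (integrableOn_inv_norm_ball (R + ‖ζ‖))
  refine h1.mono_set fun x hx => ?_
  rw [mem_ball_zero_iff] at hx
  rw [mem_preimage, mem_ball_zero_iff]
  linarith [norm_sub_le ζ x]

/-- The integral of `1 / (ζ - z)` over a circle around the origin, with respect to the angle. -/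
theorem integral_inv_sub_circle {ζ : ℂ} {r : ℝ} (hr : 0 < r) (hrζ : r ≠ ‖ζ‖) :
    ∫ θ in Ioo (-Real.pi) Real.pi, (ζ - r * cexp (θ * I))⁻¹ =
      if r < ‖ζ‖ then 2 * Real.pi * ζ⁻¹ else 0 := by
  have h1 : ∫ θ in Ioo (-Real.pi) Real.pi, (ζ - r * cexp (θ * I))⁻¹ =
      2 * Real.pi * Real.circleAverage (fun z => (ζ - z)⁻¹) 0 r := by
    have hper : Function.Periodic (fun θ : ℝ => (ζ - r * cexp (θ * I))⁻¹) (2 * Real.pi) := by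
      intro θ
      simp only
      congr 3
      push_cast
      rw [add_mul, Complex.exp_periodic]
    have := hper.intervalIntegral_add_eq (-Real.pi) 0
    rw [show -Real.pi + 2 * Real.pi = Real.pi by ring, zero_add] at this
    rw [← integral_Ioc_eq_integral_Ioo, ← intervalIntegral.integral_of_le (by linarith [Real.pi_pos]),
      Real.circleAverage_def, this, Complex.real_smul]
    have : (Real.pi : ℂ) ≠ 0 := by exact_mod_cast Real.pi_ne_zero
    simp only [circleMap, zero_add]
    push_cast
    rw [← mul_assoc, mul_inv_cancel₀ (mul_ne_zero two_ne_zero this), one_mul]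
  rw [h1]
  split_ifs with h
  · have hd : DiffContOnCl ℂ (fun z : ℂ => (ζ - z)⁻¹) (Metric.ball 0 |r|) := by
      refine DifferentiableOn.diffContOnCl fun z hz => ?_
      have hz : z ∈ Metric.closedBall 0 |r| := Metric.closure_ball_subset_closedBall hz
      rw [mem_closedBall_zero_iff, abs_of_pos hr] at hz
      have : ζ - z ≠ 0 := fun h0 => by
        rw [sub_eq_zero.1 h0] at h
        linarith
      fun_prop (disch := assumption)
    rw [hd.circleAverage]
    simp
  · have h := lt_of_le_of_ne (not_lt.1 h) hrζ.symm
    -- on the circle, the conjugate of `1 / (ζ - z)` agrees with a function that is holomorphic in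
    -- the disc and vanishes at the centre
    have hden : ∀ z ∈ Metric.closedBall (0 : ℂ) |r|, (starRingEnd ℂ) ζ * z - r ^ 2 ≠ 0 := by
      intro z hz h0
      rw [mem_closedBall_zero_iff, abs_of_pos hr] at hz
      have h2 := congrArg norm (sub_eq_zero.1 h0)
      rw [norm_mul, Complex.norm_conj, norm_pow, Complex.norm_real, Real.norm_of_nonneg hr.le] at h2
      have : ‖ζ‖ * ‖z‖ ≤ ‖ζ‖ * r := mul_le_mul_of_nonneg_left hz (norm_nonneg _)
      nlinarith
    have hd : DiffContOnCl ℂ (fun z : ℂ => z / ((starRingEnd ℂ) ζ * z - r ^ 2))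
        (Metric.ball 0 |r|) := by
      refine DifferentiableOn.diffContOnCl fun z hz => ?_
      have := hden z (Metric.closure_ball_subset_closedBall hz)
      fun_prop (disch := assumption)
    have h2 : Real.circleAverage (fun z => (starRingEnd ℂ) (ζ - z)⁻¹) 0 r = 0 := by
      refine Eq.trans (Real.circleAverage_congr_sphere fun z hz => ?_)
        (hd.circleAverage.trans (zero_div _))
      have hz' : z ∈ Metric.closedBall (0 : ℂ) |r| := Metric.sphere_subset_closedBall hz
      rw [mem_sphere_zero_iff_norm, abs_of_pos hr] at hz
      have hz0 : z ≠ 0 := norm_pos_iff.1 (hz ▸ hr)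
      have hzz : z * (starRingEnd ℂ) z = r ^ 2 := by
        rw [Complex.mul_conj, Complex.normSq_eq_norm_sq, hz]
        push_cast
        rfl
      have hdz := hden z hz'
      simp only [map_inv₀, map_sub]
      have : (starRingEnd ℂ) ζ - (starRingEnd ℂ) z ≠ 0 := fun h0 => hdz (by
        rw [← hzz, sub_eq_zero.1 h0]; ring)
      rw [← hzz] at hdz ⊢
      field_simp
    have h3 : Real.circleAverage (fun z => (starRingEnd ℂ) (ζ - z)⁻¹) 0 r =
        (starRingEnd ℂ) (Real.circleAverage (fun z => (ζ - z)⁻¹) 0 r) := by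
      rw [Real.circleAverage_def, Real.circleAverage_def, Complex.real_smul, Complex.real_smul,
        map_mul, Complex.conj_ofReal, intervalIntegral.integral_of_le (by positivity),
        intervalIntegral.integral_of_le (by positivity), integral_conj]
    rw [h3, map_eq_zero] at h2
    rw [h2, mul_zero]

/-- The Cauchy transform of a disc, on the disc. -/
theorem integral_inv_sub_ball {ζ : ℂ} {R : ℝ} (hζ : ‖ζ‖ < R) :
    ∫ x in Metric.ball 0 R, (ζ - x)⁻¹ = Real.pi * (starRingEnd ℂ) ζ := by
  have hR : 0 < R := (norm_nonneg _).trans_lt hζ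
  rw [← integral_indicator Metric.isOpen_ball.measurableSet, ← Complex.integral_comp_polarCoord_symm]
  set f : ℂ → ℂ := (Metric.ball (0 : ℂ) R).indicator (fun x => (ζ - x)⁻¹) with hf
  have hfi : Integrable f :=
    (integrableOn_inv_sub_ball ζ R).integrable_indicator Metric.isOpen_ball.measurableSet
  have hfm : Measurable f := by
    refine Measurable.indicator (by fun_prop) Metric.isOpen_ball.measurableSet
  have hint : IntegrableOn (fun p : ℝ × ℝ => p.1 • f (Complex.polarCoord.symm p))
      polarCoord.target := by
    refine ⟨?_, ?_⟩
    · refine Measurable.aestronglyMeasurable ?_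
      refine measurable_fst.smul (hfm.comp ?_)
      have : Continuous fun p : ℝ × ℝ => Complex.polarCoord.symm p := by
        simp only [Complex.polarCoord_symm_apply]
        fun_prop
      exact this.measurable
    · have := Complex.lintegral_comp_polarCoord_symm (fun x => ‖f x‖ₑ)
      have h2 := hfi.2
      rw [hasFiniteIntegral_iff_enorm, ← this] at h2
      rw [hasFiniteIntegral_iff_enorm]
      refine lt_of_le_of_lt (le_of_eq (setLIntegral_congr_fun polarCoord.open_target.measurableSet
        fun p hp => ?_)) h2
      rw [enorm_smul, smul_eq_mul, Real.enorm_eq_ofReal (le_of_lt hp.1)]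
  rw [polarCoord_target] at hint ⊢
  rw [Measure.volume_eq_prod] at hint ⊢
  rw [setIntegral_prod _ hint]
  have inner : ∀ r ∈ Ioi (0 : ℝ), r ≠ ‖ζ‖ →
      ∫ θ in Ioo (-Real.pi) Real.pi, r • f (Complex.polarCoord.symm (r, θ)) =
        (Ioo 0 ‖ζ‖).indicator (fun r => (r : ℂ) * (2 * Real.pi * ζ⁻¹)) r := by
    intro r hr hrζ
    have hr : 0 < r := hr
    rw [integral_smul, Complex.real_smul]
    have e : ∀ θ : ℝ, f (Complex.polarCoord.symm (r, θ)) =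
        if r < R then (ζ - r * cexp (θ * I))⁻¹ else 0 := by
      intro θ
      have e1 : Complex.polarCoord.symm (r, θ) = r * cexp (θ * I) := by
        rw [Complex.polarCoord_symm_apply, Complex.exp_mul_I, ofReal_cos, ofReal_sin]
      rw [e1]
      have e2 : (r * cexp (θ * I) ∈ Metric.ball (0 : ℂ) R) ↔ r < R := by
        rw [mem_ball_zero_iff, norm_mul, Complex.norm_exp_ofReal_mul_I, Complex.norm_real,
          Real.norm_of_nonneg hr.le, mul_one]
      simp only [hf, indicator, e2]
    simp only [e]
    by_cases h1 : r < ‖ζ‖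
    · have h2 : r < R := h1.trans hζ
      simp only [h2, if_true]
      rw [integral_inv_sub_circle hr hrζ, if_pos h1, indicator_of_mem (show r ∈ Ioo 0 ‖ζ‖ from ⟨hr, h1⟩)]
    · rw [indicator_of_notMem (fun h => h1 h.2)]
      by_cases h2 : r < R
      · simp only [h2, if_true]
        rw [integral_inv_sub_circle hr hrζ, if_neg h1, mul_zero]
      · simp [h2]
  have hae : ∀ᵐ r ∂(volume.restrict (Ioi (0 : ℝ))),
      ∫ θ in Ioo (-Real.pi) Real.pi, r • f (Complex.polarCoord.symm (r, θ)) =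
        (Ioo 0 ‖ζ‖).indicator (fun r => (r : ℂ) * (2 * Real.pi * ζ⁻¹)) r := by
    have h1 : ∀ᵐ r : ℝ ∂(volume.restrict (Ioi (0 : ℝ))), r ≠ ‖ζ‖ :=
      ae_restrict_of_ae (Measure.ae_ne volume _)
    filter_upwards [h1, ae_restrict_mem measurableSet_Ioi] with r h2 h3
    exact inner r h3 h2
  rw [integral_congr_ae hae, setIntegral_indicator measurableSet_Ioo,
    inter_eq_right.2 (fun r hr => hr.1), ← integral_Ioc_eq_integral_Ioo,
    ← intervalIntegral.integral_of_le (norm_nonneg _), intervalIntegral.integral_mul_const,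
    intervalIntegral.integral_ofReal, integral_id]
  rcases eq_or_ne ζ 0 with rfl | h0
  · simp
  · field_simp
    have := Complex.mul_conj ζ
    rw [Complex.normSq_eq_norm_sq] at this
    push_cast at this ⊢
    linear_combination -this

/-- A bound that does not depend on `ζ`, for the use of Fubini's theorem. -/
theorem integral_norm_inv_sub_ball_le {ζ : ℂ} {R : ℝ} (hζ : ‖ζ‖ < R) :
    ∫ x in Metric.ball 0 R, ‖(ζ - x)⁻¹‖ ≤ ∫ y in Metric.ball (0 : ℂ) (2 * R), ‖y⁻¹‖ := by
  have hmp := Measure.measurePreserving_sub_left (volume : Measure ℂ) ζ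
  have hemb := (MeasurableEquiv.subLeft ζ).measurableEmbedding
  rw [← hmp.setIntegral_preimage_emb hemb (fun y => ‖y⁻¹‖) (Metric.ball 0 (2 * R))]
  refine setIntegral_mono_set (f := fun x => ‖(ζ - x)⁻¹‖) ?_
    (Eventually.of_forall fun x => norm_nonneg (ζ - x)⁻¹) ?_
  · exact (hmp.integrableOn_comp_preimage hemb).2 (integrableOn_inv_norm_ball (2 * R)).norm
  · refine Eventually.of_forall fun x hx => ?_
    have hx : ‖x‖ < R := mem_ball_zero_iff.1 hx
    refine mem_ball_zero_iff.2 (?_ : ‖ζ - x‖ < 2 * R)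
    linarith [norm_sub_le ζ x]

/-- Integrating the Cauchy integrals of the winding numbers of a curve over the plane gives the
area that it encloses. -/
theorem integral_ball_integral_div_sub {c c' : ℝ → ℂ} (hc : Continuous c) (hc' : Continuous c')
    {a b R : ℝ} (hab : a ≤ b) (hR : ∀ s ∈ Icc a b, ‖c s‖ < R) :
    IntegrableOn (fun x => ∫ s in a..b, c' s / (c s - x)) (Metric.ball 0 R) ∧
    ∫ x in Metric.ball 0 R, ∫ s in a..b, c' s / (c s - x) =
      Real.pi * ∫ s in a..b, c' s * (starRingEnd ℂ) (c s) := by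
  set K := ∫ y in Metric.ball (0 : ℂ) (2 * R), ‖y⁻¹‖ with hK
  obtain ⟨M, hM⟩ := (isCompact_Icc (a := a) (b := b)).exists_bound_of_continuousOn hc'.continuousOn
  have hmeas : Measurable fun p : ℝ × ℂ => c' p.1 / (c p.1 - p.2) := by
    refine Measurable.div ?_ ?_
    · exact hc'.measurable.comp measurable_fst
    · exact (hc.measurable.comp measurable_fst).sub measurable_snd
  have hint : Integrable (fun p : ℝ × ℂ => c' p.1 / (c p.1 - p.2))
      ((volume.restrict (Ioc a b)).prod (volume.restrict (Metric.ball 0 R))) := by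
    rw [integrable_prod_iff hmeas.aestronglyMeasurable]
    refine ⟨Eventually.of_forall fun s => ?_, ?_⟩
    · simp only [div_eq_mul_inv]
      exact (integrableOn_inv_sub_ball (c s) R).const_mul _
    · refine Integrable.mono' (g := fun _ => M * K) (integrable_const _)
        hmeas.aestronglyMeasurable.norm.integral_prod_right' ?_
      filter_upwards [ae_restrict_mem measurableSet_Ioc] with s hs
      have hs' : s ∈ Icc a b := Ioc_subset_Icc_self hs
      rw [Real.norm_of_nonneg (integral_nonneg fun x => norm_nonneg _)]
      simp only [div_eq_mul_inv, norm_mul]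
      rw [integral_const_mul]
      exact mul_le_mul (hM s hs') (integral_norm_inv_sub_ball_le (hR s hs'))
        (integral_nonneg fun x => norm_nonneg _) ((norm_nonneg _).trans (hM s hs'))
  simp only [intervalIntegral.integral_of_le hab]
  refine ⟨hint.integral_prod_right, ?_⟩
  rw [← integral_integral_swap hint, ← integral_const_mul]
  refine setIntegral_congr_fun measurableSet_Ioc fun s hs => ?_
  simp only [div_eq_mul_inv]
  rw [integral_const_mul, integral_inv_sub_ball (hR s (Ioc_subset_Icc_self hs))]
  ring

/-- The turning of a differentiable curve around a point off the curve, as an integral. -/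
theorem IsArgOn.sub_eq_im_integral {c c' : ℝ → ℂ} (hc : ∀ s, HasDerivAt c (c' s) s)
    (hc' : Continuous c') {x : ℂ} {θ : ℝ → ℝ} (hθ : IsArgOn θ (fun s => c s - x) univ) (a b : ℝ) :
    θ b - θ a = (∫ s in a..b, c' s / (c s - x)).im := by
  have hcc : Continuous c := continuous_iff_continuousAt.2 fun s => (hc s).continuousAt
  have hne : ∀ s, c s - x ≠ 0 := fun s => hθ.ne s (mem_univ s)
  set F : ℝ → ℂ := fun t => ∫ s in a..t, c' s / (c s - x) with hF
  have hcont : Continuous fun s => c' s / (c s - x) := hc'.div (by fun_prop) hne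
  have hFd : ∀ t, HasDerivAt F (c' t / (c t - x)) t := fun t =>
    intervalIntegral.integral_hasDerivAt_right (hcont.intervalIntegrable _ _)
      (hcont.stronglyMeasurableAtFilter _ _) hcont.continuousAt
  have hFc : Continuous F := continuous_iff_continuousAt.2 fun s => (hFd s).continuousAt
  -- `F` is a logarithm of `c - x`, up to a constant
  have hGd : ∀ t, HasDerivAt (fun t => (c t - x) * cexp (-F t)) 0 t := by
    intro t
    have h1 := ((hc t).sub_const x).mul (hFd t).neg.cexp
    refine h1.congr_deriv ?_
    have e := div_mul_cancel₀ (c' t) (hne t)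
    linear_combination -cexp (-F t) * e
  have hconst : ∀ t, (c t - x) * cexp (-F t) = c a - x := by
    intro t
    have := is_const_of_deriv_eq_zero (fun t => (hGd t).differentiableAt)
      (fun t => (hGd t).deriv) t a
    simpa [hF] using this
  have h2 : IsArgOn (fun t => (c a - x).arg + (F t).im) (fun s => c s - x) univ := by
    refine ((IsArgOn.of_exp hFc.continuousOn fun _ _ => rfl).add_const (hne a)).congr ?_
    intro t _
    rw [← hconst t, mul_assoc, ← Complex.exp_add]
    simp
  rw [hθ.sub_eq_sub_self h2 isPreconnected_univ (mem_univ b) (mem_univ a)]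
  simp [hF]

/-! ### Bonnesen's inequality for a boundary loop -/

/-- A differentiable curve in the plane has area zero. -/
theorem volume_range_eq_zero_of_hasDerivAt {c c' : ℝ → ℂ} (hc : ∀ s, HasDerivAt c (c' s) s) :
    volume (range c) = 0 := by
  have h1 : range c = (fun z : ℂ => c z.re) '' {z : ℂ | z.im = 0} := by
    ext w
    constructor
    · rintro ⟨s, rfl⟩
      exact ⟨s, by simp, by simp⟩
    · rintro ⟨z, -, rfl⟩
      exact ⟨z.re, rfl⟩
  -- the image of a line under a differentiable map of the plane
  rw [h1]
  refine addHaar_image_eq_zero_of_differentiableOn_of_addHaar_eq_zero volume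
    (fun z _ => ?_) ?_
  · have h2 : DifferentiableAt ℝ c z.re := (hc z.re).differentiableAt
    exact (h2.comp z (Complex.reCLM.differentiableAt (x := z))).differentiableWithinAt
  · have := Measure.addHaar_submodule (volume : Measure ℂ) (LinearMap.ker Complex.imLm) (by
      intro h
      have : (I : ℂ) ∈ LinearMap.ker Complex.imLm := h ▸ Submodule.mem_top
      simp at this)
    exact this

/-- A bounded open set lies in every closed disc that contains its frontier. -/
theorem subset_closedBall_of_frontier_subset {D : Set ℂ} (hDo : IsOpen D)
    (hb : Bornology.IsBounded D) {x : ℂ} {r : ℝ} (h : frontier D ⊆ Metric.closedBall x r) :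
    D ⊆ Metric.closedBall x r := by
  rcases D.eq_empty_or_nonempty with rfl | hne
  · exact empty_subset _
  obtain ⟨z, hz, hmax⟩ := hb.isCompact_closure.exists_isMaxOn hne.closure
    (f := fun z => dist z x) (by fun_prop)
  have h1 : D ⊆ Metric.closedBall x (dist z x) := fun y hy => hmax (subset_closure hy)
  have h2 : D ⊆ Metric.ball x (dist z x) := by
    rw [← interior_closedBall']
    exact hDo.subset_interior_iff.2 h1
  have h3 : z ∈ frontier D := by
    rw [hDo.frontier_eq]
    exact ⟨hz, fun hz => lt_irrefl _ (Metric.mem_ball.1 (h2 hz))⟩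
  exact h1.trans (Metric.closedBall_subset_closedBall (h h3))

namespace IsUnitSpeedLoop

variable {γ T : ℝ → ℂ} {κ : ℝ → ℝ} {L : ℝ} (h : IsUnitSpeedLoop γ T κ L)
include h

theorem hasDerivAt_parallel (r : ℝ) (s : ℝ) :
    HasDerivAt (fun s => γ s + r * (I * T s)) ((1 - r * κ s) * T s) s := by
  refine ((h.hasDerivAt s).add (((h.hasDerivAt_tangent s).const_mul I).const_mul (r : ℂ))).congr_deriv
    ?_
  linear_combination (r * κ s * T s : ℂ) * Complex.I_mul_I

theorem isCompact_range : IsCompact (range γ) := by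
  rw [← h.periodic.image_Icc h.pos 0]
  exact isCompact_Icc.image h.continuous

/-- Integration by parts: `T' = κ i T` and `‖T‖ = 1`, so `s - Re (T conj γ)` is a primitive. -/
theorem integral_curvature_mul_im :
    ∫ s in (0)..L, κ s * (T s * (starRingEnd ℂ) (γ s)).im = L := by
  have hd : ∀ s, HasDerivAt (fun s => s - (T s * (starRingEnd ℂ) (γ s)).re)
      (κ s * (T s * (starRingEnd ℂ) (γ s)).im) s := by
    intro s
    have h1 := (h.hasDerivAt_tangent s).mul (h.hasDerivAt s).star
    have h2 := (Complex.reCLM.hasFDerivAt (x := T s * (starRingEnd ℂ) (γ s))).comp_hasDerivAt s h1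
    refine ((hasDerivAt_id s).sub h2).congr_deriv ?_
    have h3 : (T s).re * (T s).re + (T s).im * (T s).im = 1 := by
      rw [← Complex.normSq_apply, Complex.normSq_eq_norm_sq, h.norm_tangent, one_pow]
    simp
    linear_combination -h3
  have hc : Continuous fun s => κ s * (T s * (starRingEnd ℂ) (γ s)).im := by
    have h1 := h.continuous
    have h2 := h.continuous_tangent
    have h3 := h.continuous_curvature
    have h4 : Continuous fun s => (starRingEnd ℂ) (γ s) := Complex.continuous_conj.comp h1
    exact h3.mul (Complex.continuous_im.comp (h2.mul h4))
  rw [intervalIntegral.integral_eq_sub_of_hasDerivAt (fun s _ => hd s) (hc.intervalIntegrable _ _)]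
  have h1 := h.periodic 0
  have h2 := h.periodic_tangent 0
  rw [zero_add] at h1 h2
  rw [h1, h2]
  ring

end IsUnitSpeedLoop

namespace IsBoundaryLoop

variable {D : Set ℂ} {γ T : ℝ → ℂ} {κ : ℝ → ℝ} {L : ℝ}

/-- The total curvature of the boundary of a simply connected domain is `2 * π`. -/
theorem integral_curvature (h : IsBoundaryLoop D γ T κ L) (hDo : IsOpen D)
    (hD : IsSimplyConnected D) : ∫ s in (0)..L, κ s = 2 * Real.pi := by
  obtain ⟨E, hE⟩ := h.exists_chordArg
  have h1 := (h.chordArg_swap hDo hD hE).2 0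
  have h2 : IsArgOn (fun s => E (s, s)) (fun s => T s - 0) univ := by
    simpa using h.isArgOn_tangent hE univ
  have h3 := h2.sub_eq_im_integral h.hasDerivAt_tangent
    (by have := h.continuous_curvature; have := h.continuous_tangent; fun_prop) 0 L
  rw [zero_add] at h1
  rw [h1] at h3
  have h4 : ∀ s, κ s * I * T s / (T s - 0) = (κ s : ℂ) * I := fun s => by
    rw [sub_zero, mul_div_cancel_right₀ _ (h.tangent_ne_zero s)]
  simp only [h4] at h3
  rw [intervalIntegral.integral_mul_const, intervalIntegral.integral_ofReal] at h3
  simp at h3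
  linarith

/-- A boundary loop is not contained in an open disc of the radius of a largest inscribed disc. -/
theorem exists_le_norm_sub (h : IsBoundaryLoop D γ T κ L) (hDo : IsOpen D)
    (hD : IsSimplyConnected D) (hb : Bornology.IsBounded D) {r : ℝ}
    (hr : ∀ ρ < r, ∃ x, Metric.ball x ρ ⊆ D) (x : ℂ) : ∃ α, r ≤ ‖γ α - x‖ := by
  by_contra! hlt
  obtain ⟨_, ⟨s, rfl⟩, hmax⟩ := h.isCompact_range.exists_isMaxOn (range_nonempty γ)
    (f := fun z => ‖z - x‖) (by fun_prop)
  have h1 : D ⊆ Metric.closedBall x ‖γ s - x‖ := by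
    refine subset_closedBall_of_frontier_subset hDo hb ?_
    rw [← h.range_eq_frontier hDo hD]
    intro z hz
    rw [mem_closedBall_iff_norm]
    exact hmax hz
  obtain ⟨ρ, hρ1, hρ2⟩ := exists_between (hlt s)
  obtain ⟨y, hy⟩ := hr ρ hρ2
  have h2 := measure_mono (μ := volume) (hy.trans h1)
  rw [Complex.volume_ball, Complex.volume_closedBall,
    ENNReal.mul_le_mul_iff_left (by simp [NNReal.pi_ne_zero]) (by simp)] at h2
  have h3 := (ENNReal.pow_le_pow_left_iff two_ne_zero).1 h2
  have := (ENNReal.ofReal_le_ofReal_iff (norm_nonneg _)).1 h3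
  linarith

/-- **Bonnesen's inequality** for a domain bounded by a loop of length `L`, where `r` is the radius
of a largest inscribed disc: the comparison of `γ` with its parallel loop is integrated over a disc
that contains both loops. -/
theorem area_add_le (h : IsBoundaryLoop D γ T κ L) (hDo : IsOpen D)
    (hD : IsSimplyConnected D) (hb : Bornology.IsBounded D) {r : ℝ} (hr0 : 0 < r)
    (hr : ∀ x ρ, Metric.ball x ρ ⊆ D → ρ ≤ r) (hr' : ∀ ρ < r, ∃ x, Metric.ball x ρ ⊆ D) :
    volume.real D + Real.pi * r ^ 2 ≤ r * L := by
  set c : ℝ → ℂ := fun s => γ s + r * (I * T s) with hc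
  set c' : ℝ → ℂ := fun s => (1 - r * κ s) * T s with hc'
  have hγc := h.continuous
  have hTc := h.continuous_tangent
  have hκc := h.continuous_curvature
  have hcd : ∀ s, HasDerivAt c (c' s) s := h.hasDerivAt_parallel r
  have hcc : Continuous c := by fun_prop
  have hcc' : Continuous c' := by fun_prop
  have hTp := h.periodic_tangent
  have hκp := h.periodic_curvature
  have hcp : Function.Periodic c L := fun s => by simp only [hc, h.periodic s, hTp s]
  have hcp' : Function.Periodic c' L := fun s => by simp only [hc', hκp s, hTp s]
  obtain ⟨R₁, hR₁⟩ := (hb.union (h.isCompact_range.isBounded)).subset_ball 0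
  obtain ⟨R₂, hR₂⟩ := (isCompact_Icc.image hcc : IsCompact (c '' Icc 0 L)).isBounded.subset_ball 0
  set R := max R₁ R₂ with hR
  have hDR : D ⊆ Metric.ball 0 R := subset_union_left.trans
    (hR₁.trans (Metric.ball_subset_ball (le_max_left _ _)))
  have hγR : ∀ s ∈ Icc 0 L, ‖γ s‖ < R := fun s _ => by
    have := hR₁ (Or.inr (mem_range_self s))
    rw [mem_ball_zero_iff] at this
    exact this.trans_le (le_max_left _ _)
  have hcR : ∀ s ∈ Icc 0 L, ‖c s‖ < R := fun s hs => by
    have := hR₂ (mem_image_of_mem c hs)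
    rw [mem_ball_zero_iff] at this
    exact this.trans_le (le_max_right _ _)
  obtain ⟨hi₁, he₁⟩ := integral_ball_integral_div_sub hγc hTc h.pos.le hγR
  obtain ⟨hi₂, he₂⟩ := integral_ball_integral_div_sub hcc hcc' h.pos.le hcR
  have key : ∀ x, x ∉ range γ → x ∉ range c → D.indicator (fun _ => 2 * Real.pi) x ≤
      ((∫ s in (0)..L, T s / (γ s - x)) - ∫ s in (0)..L, c' s / (c s - x)).im := by
    intro x hx1 hx2
    obtain ⟨α, hα⟩ := h.exists_le_norm_sub hDo hD hb hr' x
    have hx1' : ∀ s, γ s ≠ x := fun s hs => hx1 ⟨s, hs⟩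
    have hx2' : ∀ s, c s - x ≠ 0 := fun s hs => hx2 ⟨s, sub_eq_zero.1 hs⟩
    obtain ⟨ζ, hζ⟩ := exists_isArgOn_of_convex (f := fun s => γ s - x) convex_univ
      (by fun_prop) fun s _ => sub_ne_zero.2 (hx1' s)
    obtain ⟨v, hv⟩ := exists_isArgOn_of_convex (f := fun s => c s - x) convex_univ
      (by fun_prop) fun s _ => hx2' s
    have e : ∀ s, γ s - x + r * (I * T s) = c s - x := fun s => by simp only [hc]; ring
    have h1 := h.parallel_turn_le hDo (h.range_eq_frontier hDo hD) (x := x) (r := r) hr0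
      (fun ρ => hr x ρ) hx1' (fun s => by rw [e]; exact hx2' s) hα
      (v := v) (by simpa only [e] using hv) hζ
    rw [hζ.sub_eq_im_integral h.hasDerivAt hTc, hv.sub_eq_im_integral hcd hcc'] at *
    have p1 : Function.Periodic (fun s => T s / (γ s - x)) L := fun s => by
      simp only [h.periodic s, hTp s]
    have p2 : Function.Periodic (fun s => c' s / (c s - x)) L := fun s => by
      simp only [hcp s, hcp' s]
    rw [p1.intervalIntegral_add_eq α 0, p2.intervalIntegral_add_eq α 0, zero_add] at h1
    rw [Complex.sub_im]
    linarith
  -- the comparison holds off the two loops, which have area zero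
  have hae : ∀ᵐ x ∂(volume.restrict (Metric.ball (0 : ℂ) R)),
      D.indicator (fun _ => 2 * Real.pi) x ≤
      ((∫ s in (0)..L, T s / (γ s - x)) - ∫ s in (0)..L, c' s / (c s - x)).im := by
    refine ae_restrict_of_ae ?_
    have n1 := measure_eq_zero_iff_ae_notMem.1 (volume_range_eq_zero_of_hasDerivAt h.hasDerivAt)
    have n2 := measure_eq_zero_iff_ae_notMem.1 (volume_range_eq_zero_of_hasDerivAt hcd)
    filter_upwards [n1, n2] with x using key x
  have hint := (hi₁.sub hi₂)
  have : IsFiniteMeasure (volume.restrict (Metric.ball (0 : ℂ) R)) :=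
    isFiniteMeasure_restrict.2 Metric.isBounded_ball.measure_lt_top.ne
  have hle := integral_mono_ae (μ := volume.restrict (Metric.ball (0 : ℂ) R))
    ((integrable_const (2 * Real.pi)).indicator hDo.measurableSet) hint.im hae
  rw [integral_indicator_const _ hDo.measurableSet, measureReal_restrict_apply hDo.measurableSet,
    inter_eq_left.2 hDR] at hle
  have him : ∫ x in Metric.ball (0 : ℂ) R,
      ((∫ s in (0)..L, T s / (γ s - x)) - ∫ s in (0)..L, c' s / (c s - x)).im =
      Real.pi * (2 * r * L - 2 * Real.pi * r ^ 2) := by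
    have h1 := integral_im (𝕜 := ℂ) hint
    simp only [RCLike.im_to_complex, Pi.sub_apply] at h1
    have hγs : Continuous fun s => (starRingEnd ℂ) (γ s) := Complex.continuous_conj.comp hγc
    have hcs : Continuous fun s => (starRingEnd ℂ) (c s) := Complex.continuous_conj.comp hcc
    have e : ∀ s, (T s * (starRingEnd ℂ) (γ s) - c' s * (starRingEnd ℂ) (c s)).im =
        r * (κ s * (T s * (starRingEnd ℂ) (γ s)).im) + r - r ^ 2 * κ s := fun s => by
      have h3 : T s * (starRingEnd ℂ) (T s) = 1 := by
        rw [Complex.mul_conj, Complex.normSq_eq_norm_sq, h.norm_tangent]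
        simp
      have h4 : T s * (starRingEnd ℂ) (γ s) - c' s * (starRingEnd ℂ) (c s) =
          ((r * κ s : ℝ) : ℂ) * (T s * (starRingEnd ℂ) (γ s)) +
            ((1 - r * κ s) * r : ℝ) * I := by
        simp only [hc, hc', map_add, map_mul, Complex.conj_ofReal, Complex.conj_I]
        push_cast
        linear_combination ((1 - r * κ s) * r * I : ℂ) * h3
      rw [h4, Complex.add_im, Complex.im_ofReal_mul, Complex.im_ofReal_mul, Complex.I_im]
      ring
    have hd₁ : Continuous fun s => T s * (starRingEnd ℂ) (γ s) := hTc.mul hγs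
    have hd₂ : Continuous fun s => c' s * (starRingEnd ℂ) (c s) := hcc'.mul hcs
    have hd₃ : Continuous fun s => T s * (starRingEnd ℂ) (γ s) - c' s * (starRingEnd ℂ) (c s) :=
      hd₁.sub hd₂
    have hi₃ : Continuous fun s => κ s * (T s * (starRingEnd ℂ) (γ s)).im :=
      hκc.mul (Complex.continuous_im.comp hd₁)
    rw [h1, integral_sub hi₁ hi₂, he₁, he₂, ← mul_sub, Complex.im_ofReal_mul,
      ← intervalIntegral.integral_sub (hd₁.intervalIntegrable _ _)
        (hd₂.intervalIntegrable _ _), ← Complex.imCLM_apply,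
      ← Complex.imCLM.intervalIntegral_comp_comm
        (hd₃.intervalIntegrable _ _)]
    simp only [Complex.imCLM_apply, e]
    rw [intervalIntegral.integral_sub (Continuous.intervalIntegrable (by fun_prop) _ _)
        (Continuous.intervalIntegrable (by fun_prop) _ _),
      intervalIntegral.integral_add (Continuous.intervalIntegrable (by fun_prop) _ _)
        (Continuous.intervalIntegrable (by fun_prop) _ _),
      intervalIntegral.integral_const_mul, intervalIntegral.integral_const_mul,
      h.integral_curvature_mul_im, h.integral_curvature hDo hD, intervalIntegral.integral_const,
      smul_eq_mul]
    ring
  simp only [Pi.sub_apply, RCLike.im_to_complex, him, smul_eq_mul] at hle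
  nlinarith [Real.pi_pos]

end IsBoundaryLoop

/-! ### The boundary of a smooth domain as a closed curve -/

/-- A bounded Lipschitz vector field has global integral curves. -/
theorem exists_integralCurve_of_lipschitz {E : Type*} [NormedAddCommGroup E] [NormedSpace ℝ E]
    [CompleteSpace E] {X : E → E} {K : NNReal} (hX : LipschitzWith K X) {M : NNReal}
    (hM : ∀ x, ‖X x‖ ≤ M) (x : E) : ∃ γ : ℝ → E, γ 0 = x ∧ ∀ t, HasDerivAt γ (X (γ t)) t := by
  have h1 : ∀ a : NNReal, ∃ γ : ℝ → E, γ 0 = x ∧ ∀ t ∈ Ioo (-(a : ℝ)) a,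
      HasDerivAt γ (X (γ t)) t := by
    intro a
    have h2 : IsPicardLindelof (fun _ => X) (tmin := -(a : ℝ)) (tmax := a)
        ⟨0, by simp, by simp⟩ x (M * a) 0 M K :=
      IsPicardLindelof.of_time_independent (fun x _ => hM x) hX.lipschitzOnWith (by simp)
    obtain ⟨γ, h3, h4⟩ := h2.exists_eq_forall_mem_Icc_hasDerivWithinAt₀
    exact ⟨γ, h3, fun t ht => (h4 t (Ioo_subset_Icc_self ht)).hasDerivAt (Icc_mem_nhds ht.1 ht.2)⟩
  choose g hg0 hg using h1
  -- the solutions on the intervals `(-a, a)` extend each other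
  have huniq : ∀ a b : NNReal, a ≤ b → EqOn (g a) (g b) (Ioo (-(a : ℝ)) a) := by
    intro a b hab
    rcases a.2.eq_or_lt with ha | ha
    · intro t ht
      have ha : (0 : ℝ) = a := ha
      rw [← ha] at ht
      simp at ht
    refine ODE_solution_unique_of_mem_Ioo (v := fun _ => X) (s := fun _ => univ) (t₀ := 0) (K := K)
      (fun _ _ => hX.lipschitzOnWith) ⟨neg_lt_zero.2 ha, ha⟩
      (fun t ht => ⟨hg a t ht, mem_univ _⟩) (fun t ht => ⟨hg b t ?_, mem_univ _⟩)
      ((hg0 a).trans (hg0 b).symm)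
    exact Ioo_subset_Ioo (neg_le_neg (by exact_mod_cast hab)) (by exact_mod_cast hab) ht
  refine ⟨fun t => g (‖t‖₊ + 1) t, hg0 _, fun t => ?_⟩
  have h3 : ∀ s : ℝ, ∀ b : NNReal, ‖s‖₊ < b → s ∈ Ioo (-(b : ℝ)) b := fun s b hs =>
    abs_lt.1 (by simpa using NNReal.coe_lt_coe.2 hs)
  refine (hg (‖t‖₊ + 1) t (h3 t _ (lt_add_one _))).congr_of_eventuallyEq ?_
  have h4 : ∀ᶠ s : ℝ in 𝓝 t, ‖s‖₊ < ‖t‖₊ + 1 :=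
    continuous_nnnorm.continuousAt.eventually_lt_const (lt_add_one _)
  filter_upwards [h4] with s hs
  rcases le_total (‖s‖₊ + 1) (‖t‖₊ + 1) with h5 | h5
  · exact huniq _ _ h5 (h3 s _ (lt_add_one _))
  · exact (huniq _ _ h5 (h3 s _ hs)).symm


/-- The local form of a global defining function, obtained from a defining function near a boundary
point by multiplication with a bump function. -/
theorem exists_local_definingFunction {D U : Set ℂ} {φ : ℂ → ℝ} {x : ℂ} (hU : IsOpen U)
    (hxU : x ∈ U) (hφ : ContDiffOn ℝ ∞ φ U) (hx : fderiv ℝ φ x ≠ 0)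
    (hD : D ∩ U = {y ∈ U | φ y < 0}) : ∃ (g : ℂ → ℝ) (W : Set ℂ), IsOpen W ∧ x ∈ W ∧
      ContDiff ℝ ∞ g ∧ HasCompactSupport g ∧ (∀ y ∈ D, g y ≤ 0) ∧ (∀ y ∉ D, 0 ≤ g y) ∧
      ∀ y ∈ W, (y ∈ D → g y < 0) ∧ fderiv ℝ g y ≠ 0 := by
  have hneg : ∀ y ∈ U, (y ∈ D ↔ φ y < 0) := fun y hy => by
    have := Set.ext_iff.1 hD y
    simp only [mem_inter_iff, mem_ofPred_eq, hy, and_true, true_and] at this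
    exact this
  obtain ⟨R, hR, hRU⟩ := Metric.isOpen_iff.1 hU x hxU
  let b : ContDiffBump x := ⟨R / 4, R / 2, by positivity, by linarith⟩
  have hbU : tsupport b ⊆ U := by
    rw [b.tsupport_eq]
    exact (Metric.closedBall_subset_ball (by change R / 2 < R; linarith)).trans hRU
  have hfd : ContinuousAt (fderiv ℝ φ) x :=
    ((hφ.continuousOn_fderiv_of_isOpen hU (by norm_num)).continuousAt (hU.mem_nhds hxU))
  have hev : ∀ᶠ y in 𝓝 x, fderiv ℝ φ y ≠ 0 := hfd.eventually_ne hx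
  obtain ⟨V, hV, hVo, hxV⟩ := eventually_nhds_iff.1 hev
  have hballU : Metric.ball x (R / 4) ⊆ U :=
    (Metric.ball_subset_ball (by linarith)).trans hRU
  refine ⟨fun y => b y * φ y, Metric.ball x (R / 4) ∩ V, Metric.isOpen_ball.inter hVo,
    ⟨Metric.mem_ball_self (by positivity), hxV⟩, ?_, ?_, ?_, ?_, ?_⟩
  · refine contDiff_of_contDiffOn_union_of_isOpen (b.contDiff.contDiffOn.mul hφ)
      ((contDiffOn_const (c := (0 : ℝ))).congr fun y hy => ?_) ?_ hU
      (isClosed_tsupport b).isOpen_compl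
    · simp [image_eq_zero_of_notMem_tsupport hy]
    · rw [← compl_subset_iff_union]
      simpa using hbU
  · exact b.hasCompactSupport.mul_right
  · intro y hy
    by_cases hyb : y ∈ tsupport b
    · exact mul_nonpos_of_nonneg_of_nonpos b.nonneg ((hneg y (hbU hyb)).1 hy).le
    · simp [image_eq_zero_of_notMem_tsupport hyb]
  · intro y hy
    by_cases hyb : y ∈ tsupport b
    · exact mul_nonneg b.nonneg (not_lt.1 fun h => hy ((hneg y (hbU hyb)).2 h))
    · simp [image_eq_zero_of_notMem_tsupport hyb]
  · rintro y ⟨hy1, hy2⟩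
    constructor
    · intro hy
      beta_reduce
      rw [b.one_of_mem_closedBall (Metric.ball_subset_closedBall hy1), one_mul]
      exact (hneg y (hballU hy1)).1 hy
    · have : (fun y => b y * φ y) =ᶠ[𝓝 y] φ := by
        filter_upwards [Metric.isOpen_ball.mem_nhds hy1] with z hz
        rw [b.one_of_mem_closedBall (Metric.ball_subset_closedBall hz), one_mul]
      rw [this.fderiv_eq]
      exact hV y hy2

/-- A domain with smooth boundary has a defining function near its whole frontier: the sum of finitely
many local ones. All of these are nonpositive on `D` and nonnegative off `D`, so their differentials
do not cancel on the frontier. -/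
theorem exists_definingFunction {D : Set ℂ} (hDo : IsOpen D) (hb : Bornology.IsBounded D)
    (hs : ∀ x ∈ frontier D, ∃ (U : Set ℂ) (φ : ℂ → ℝ), IsOpen U ∧ x ∈ U ∧ ContDiffOn ℝ ∞ φ U ∧
      fderiv ℝ φ x ≠ 0 ∧ D ∩ U = {y ∈ U | φ y < 0}) :
    ∃ (ψ : ℂ → ℝ) (W : Set ℂ), IsOpen W ∧ frontier D ⊆ W ∧ ContDiff ℝ ∞ ψ ∧ HasCompactSupport ψ ∧
      ∀ y ∈ W, (y ∈ D ↔ ψ y < 0) ∧ fderiv ℝ ψ y ≠ 0 := by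
  have hloc : ∀ x ∈ frontier D, ∃ (g : ℂ → ℝ) (W : Set ℂ), IsOpen W ∧ x ∈ W ∧
      ContDiff ℝ ∞ g ∧ HasCompactSupport g ∧ (∀ y ∈ D, g y ≤ 0) ∧ (∀ y ∉ D, 0 ≤ g y) ∧
      ∀ y ∈ W, (y ∈ D → g y < 0) ∧ fderiv ℝ g y ≠ 0 := by
    intro x hx
    obtain ⟨U, φ, h1, h2, h3, h4, h5⟩ := hs x hx
    exact exists_local_definingFunction h1 h2 h3 h4 h5
  choose! g W hWo hxW hg hgc hgD hgD' hgW using hloc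
  have hfc : IsCompact (frontier D) :=
    hb.isCompact_closure.of_isClosed_subset isClosed_frontier frontier_subset_closure
  obtain ⟨t, htD, ht⟩ := hfc.elim_nhds_subcover W fun x hx => (hWo x hx).mem_nhds (hxW x hx)
  set ψ : ℂ → ℝ := fun y => ∑ x ∈ t, g x y with hψ
  have hψs : ContDiff ℝ ∞ ψ := ContDiff.sum fun x hx => hg x (htD x hx)
  have hle : ∀ x ∈ t, ∀ y ∈ D, ψ y ≤ g x y := by
    intro x hx y hy
    have := Finset.sum_le_sum (s := t) (f := fun z => g z y) (g := fun z => if z = x then g x y else 0)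
      (fun z hz => by
        by_cases h : z = x
        · simp [h]
        · simpa [h] using hgD z (htD z hz) y hy)
    simpa [hx] using this
  have hψD' : ∀ y ∉ D, 0 ≤ ψ y := fun y hy => Finset.sum_nonneg fun x hx => hgD' x (htD x hx) y hy
  have h0 : ∀ f : ℂ → ℝ, Continuous f → (∀ y ∈ D, f y ≤ 0) → (∀ y ∉ D, 0 ≤ f y) →
      ∀ y ∈ frontier D, f y = 0 := by
    intro f hf h1 h2 y hy
    refine le_antisymm ?_ (h2 y ?_)
    · exact closure_minimal (t := {y | f y ≤ 0}) h1 (isClosed_le hf continuous_const) hy.1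
    · rw [hDo.frontier_eq] at hy
      exact hy.2
  have hψD : ∀ y ∈ D, ψ y ≤ 0 := fun y hy => Finset.sum_nonpos fun x hx => hgD x (htD x hx) y hy
  -- in a direction `v` in which one of the summands `g x` decreases, `y + s v` enters `D`, where
  -- `ψ ≤ g x`; so `ψ` decreases as well
  have hd : ∀ y ∈ frontier D, fderiv ℝ ψ y ≠ 0 := by
    intro y hy h
    obtain ⟨x, hx, hyx⟩ := mem_iUnion₂.1 (ht hy)
    have hgx := hg x (htD x hx)
    obtain ⟨v, hv⟩ : ∃ v, fderiv ℝ (g x) y v < 0 := by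
      obtain ⟨v, hv⟩ := DFunLike.ne_iff.1 (hgW x (htD x hx) y hyx).2
      rcases lt_or_gt_of_ne hv with h | h
      · exact ⟨v, h⟩
      · exact ⟨-v, by simpa using h⟩
    have hline : HasDerivAt (fun s : ℝ => y + s * v) v 0 := by
      simpa using ((hasDerivAt_id (0 : ℝ)).ofReal_comp.mul_const v).const_add y
    have hdg : HasDerivAt (fun s : ℝ => g x (y + s * v)) (fderiv ℝ (g x) y v) 0 := by
      have h1 := (hgx.differentiable (by norm_num) (y + (0 : ℝ) * v)).hasFDerivAt
      exact (h1.comp_hasDerivAt 0 hline).congr_deriv (by simp)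
    have hdψ : HasDerivAt (fun s : ℝ => ψ (y + s * v)) (fderiv ℝ ψ y v) 0 := by
      have h1 := (hψs.differentiable (by norm_num) (y + (0 : ℝ) * v)).hasFDerivAt
      have h2 : HasDerivAt (fun s : ℝ => ψ (y + s * v)) (fderiv ℝ ψ (y + (0 : ℝ) * v) v) 0 :=
        HasFDerivAt.comp_hasDerivAt (l := ψ) 0 h1 hline
      exact h2.congr_deriv (by rw [ofReal_zero, zero_mul, add_zero])
    have hg0 := h0 (g x) hgx.continuous (hgD x (htD x hx)) (hgD' x (htD x hx)) y hy
    have hψ0 := h0 ψ hψs.continuous hψD hψD' y hy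
    have t1 := hdg.tendsto_slope_zero_right
    have t2 := hdψ.tendsto_slope_zero_right
    simp only [zero_add, ofReal_zero, zero_mul, add_zero, hg0, hψ0, sub_zero, smul_eq_mul] at t1 t2
    have hev : ∀ᶠ s : ℝ in 𝓝[>] 0, s⁻¹ * ψ (y + s * v) ≤ s⁻¹ * g x (y + s * v) := by
      filter_upwards [t1.eventually_lt_const hv, self_mem_nhdsWithin] with s hs hs0
      have hs0 : 0 < s := hs0
      have h3 : g x (y + s * v) < 0 := by
        by_contra! h4
        exact absurd hs (not_lt.2 (by positivity))
      have h4 : y + s * v ∈ D := by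
        by_contra h5
        exact absurd h3 (not_lt.2 (hgD' x (htD x hx) _ h5))
      exact mul_le_mul_of_nonneg_left (hle x hx _ h4) (by positivity)
    have := le_of_tendsto_of_tendsto t2 t1 hev
    rw [h] at this
    exact absurd hv (not_lt.2 (by simpa using this))
  refine ⟨ψ, (⋃ x ∈ t, W x) ∩ {y | fderiv ℝ ψ y ≠ 0}, ?_, fun y hy => ⟨ht hy, hd y hy⟩, hψs, ?_, ?_⟩
  · refine (isOpen_biUnion fun x hx => hWo x (htD x hx)).inter ?_
    exact isOpen_ne_fun (hψs.continuous_fderiv (by norm_num)) continuous_const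
  · refine HasCompactSupport.intro (t.finite_toSet.isCompact_biUnion fun x hx => hgc x (htD x hx))
      fun y hy => Finset.sum_eq_zero fun x hx => ?_
    simp only [mem_iUnion, not_exists] at hy
    exact image_eq_zero_of_notMem_tsupport (hy x hx)
  · rintro y ⟨hy1, hy2⟩
    refine ⟨⟨fun hy => ?_, fun hy => ?_⟩, hy2⟩
    · obtain ⟨x, hx, hyx⟩ := mem_iUnion₂.1 hy1
      exact (hle x hx y hy).trans_lt ((hgW x (htD x hx) y hyx).1 hy)
    · by_contra h
      exact absurd hy (not_lt.2 (hψD' y h))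

/-- A domain `D` given near its frontier by a defining function `ψ`, together with a vector field
`X` that is tangent to the level sets of `ψ` and on the frontier is the positively oriented unit
tangent. -/
structure IsTangentField (D : Set ℂ) (ψ : ℂ → ℝ) (W : Set ℂ) (X : ℂ → ℂ) : Prop where
  isOpen : IsOpen W
  frontier_subset : frontier D ⊆ W
  contDiff : ContDiff ℝ ∞ ψ
  mem_iff : ∀ y ∈ W, y ∈ D ↔ ψ y < 0
  fderiv_ne_zero : ∀ y ∈ W, fderiv ℝ ψ y ≠ 0
  contDiff_field : ContDiff ℝ ∞ X
  hasCompactSupport : HasCompactSupport X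
  fderiv_field : ∀ y, fderiv ℝ ψ y (X y) = 0
  norm_field : ∀ y ∈ frontier D, ‖X y‖ = 1
  fderiv_normal : ∀ y ∈ frontier D, fderiv ℝ ψ y (I * X y) < 0

theorem ContinuousLinearMap.apply_eq_re_im (A : ℂ →L[ℝ] ℝ) (v : ℂ) : A v = v.re * A 1 + v.im * A I := by
  conv_lhs => rw [show v = v.re • (1 : ℂ) + v.im • I from by
    rw [Complex.real_smul, Complex.real_smul, mul_one, Complex.re_add_im]]
  rw [map_add, map_smul, map_smul, smul_eq_mul, smul_eq_mul]

/-- The tangent field is the rotated gradient of a defining function, divided by the root of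
`‖∇ψ‖² + f`, where `f ≥ 0` is smooth and vanishes exactly on the frontier: this is smooth on the
plane and of unit length on the frontier. -/
theorem exists_isTangentField {D : Set ℂ} (hDo : IsOpen D) (hb : Bornology.IsBounded D)
    (hs : ∀ x ∈ frontier D, ∃ (U : Set ℂ) (φ : ℂ → ℝ), IsOpen U ∧ x ∈ U ∧ ContDiffOn ℝ ∞ φ U ∧
      fderiv ℝ φ x ≠ 0 ∧ D ∩ U = {y ∈ U | φ y < 0}) : ∃ ψ W X, IsTangentField D ψ W X := by
  obtain ⟨ψ, W, hW, hDW, hψ, hψc, hψW⟩ := exists_definingFunction hDo hb hs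
  obtain ⟨f, hf, hfs, hfr⟩ := (isClosed_frontier (s := D)).isOpen_compl.exists_contDiff_support_eq
    (n := ⊤)
  have hf0 : ∀ y, 0 ≤ f y := fun y => (hfr (mem_range_self y)).1
  have hf1 : ∀ y, f y = 0 ↔ y ∈ frontier D := fun y => by
    rw [← Function.notMem_support, hf, notMem_compl_iff]
  have hdψ : ContDiff ℝ ∞ (fderiv ℝ ψ) := hψ.fderiv_right (by simp)
  set p : ℂ → ℝ := fun y => fderiv ℝ ψ y 1 with hp
  set q : ℂ → ℝ := fun y => fderiv ℝ ψ y I with hq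
  have hps : ContDiff ℝ ∞ p := hdψ.clm_apply contDiff_const
  have hqs : ContDiff ℝ ∞ q := hdψ.clm_apply contDiff_const
  have hpq : ∀ y ∈ W, 0 < p y ^ 2 + q y ^ 2 := by
    intro y hy
    by_contra! h
    have h1 : p y = 0 := by nlinarith [sq_nonneg (p y), sq_nonneg (q y)]
    have h2 : q y = 0 := by nlinarith [sq_nonneg (p y), sq_nonneg (q y)]
    refine (hψW y hy).2 (ContinuousLinearMap.ext fun v => ?_)
    rw [ContinuousLinearMap.apply_eq_re_im]
    simp only [hp, hq] at h1 h2
    simp [h1, h2]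
  have hpos : ∀ y, 0 < p y ^ 2 + q y ^ 2 + f y := by
    intro y
    by_cases hy : y ∈ frontier D
    · have := hpq y (hDW hy)
      linarith [hf0 y]
    · have h1 : f y ≠ 0 := fun h => hy ((hf1 y).1 h)
      have h2 := (hf0 y).lt_of_ne h1.symm
      positivity
  set X : ℂ → ℂ := fun y => ((√(p y ^ 2 + q y ^ 2 + f y))⁻¹ : ℝ) • (p y • I - q y • (1 : ℂ))
    with hX
  have hX0 : ∀ y, fderiv ℝ ψ y (X y) = 0 := fun y => by
    simp only [hX, map_smul, map_sub, smul_eq_mul, hp, hq]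
    ring
  have hXI : ∀ y, I * X y =
      ((√(p y ^ 2 + q y ^ 2 + f y))⁻¹ : ℝ) • (-(p y • (1 : ℂ)) - q y • I) := fun y => by
    simp only [hX, Complex.real_smul]
    linear_combination (((√(p y ^ 2 + q y ^ 2 + f y))⁻¹ : ℝ) * p y : ℂ) * Complex.I_mul_I
  refine ⟨ψ, W, X, hW, hDW, hψ, fun y hy => (hψW y hy).1, fun y hy => (hψW y hy).2, ?_, ?_,
    hX0, ?_, ?_⟩
  · refine ContDiff.smul (ContDiff.inv (ContDiff.sqrt ?_ fun y => (hpos y).ne')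
      fun y => (Real.sqrt_pos.2 (hpos y)).ne') ?_
    · exact ((hps.pow 2).add (hqs.pow 2)).add hfs
    · exact (hps.smul contDiff_const).sub (hqs.smul contDiff_const)
  · refine HasCompactSupport.intro (hψc.fderiv (𝕜 := ℝ)) fun y hy => ?_
    have : fderiv ℝ ψ y = 0 := image_eq_zero_of_notMem_tsupport hy
    simp [hX, hp, hq, this]
  · intro y hy
    have h1 : (f y) = 0 := (hf1 y).2 hy
    have h2 := hpq y (hDW hy)
    have h3 : ‖p y • I - q y • (1 : ℂ)‖ = √(p y ^ 2 + q y ^ 2) := by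
      rw [← Real.sqrt_sq (norm_nonneg _), ← Complex.normSq_eq_norm_sq, Complex.normSq_apply]
      congr 1
      simp
      ring
    simp only [hX]
    rw [norm_smul, h3, h1, add_zero, norm_inv, Real.norm_of_nonneg (Real.sqrt_nonneg _),
      inv_mul_cancel₀ (Real.sqrt_pos.2 h2).ne']
  · intro y hy
    have h2 := hpq y (hDW hy)
    have h3 := inv_pos.2 (Real.sqrt_pos.2 (hpos y))
    rw [hXI, map_smul, map_sub, map_neg, map_smul, map_smul, smul_eq_mul, smul_eq_mul, smul_eq_mul]
    refine mul_neg_of_pos_of_neg h3 ?_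
    simp only [hp, hq] at h2
    nlinarith

namespace IsTangentField

variable {D W : Set ℂ} {ψ : ℂ → ℝ} {X : ℂ → ℂ} (h : IsTangentField D ψ W X)
include h

theorem mem_frontier_iff (hDo : IsOpen D) {y : ℂ} (hy : y ∈ W) : y ∈ frontier D ↔ ψ y = 0 := by
  have hc := h.contDiff.continuous
  constructor
  · intro hyD
    refine le_antisymm ?_ (not_lt.1 fun h0 => ?_)
    · by_contra! h0
      have h1 : W ∩ {y | 0 < ψ y} ∈ 𝓝 y :=
        (h.isOpen.inter (isOpen_lt continuous_const hc)).mem_nhds ⟨hy, h0⟩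
      obtain ⟨z, ⟨hzW, hz⟩, hzD⟩ := mem_closure_iff_nhds.1 hyD.1 _ h1
      exact absurd ((h.mem_iff z hzW).1 hzD) (not_lt.2 (le_of_lt hz))
    · rw [hDo.frontier_eq] at hyD
      exact hyD.2 ((h.mem_iff y hy).2 h0)
  · intro h0
    rw [hDo.frontier_eq]
    refine ⟨?_, fun hyD => ((h.mem_iff y hy).1 hyD).ne h0⟩
    by_contra hcl
    have hmin : IsLocalMin ψ y := by
      filter_upwards [h.isOpen.mem_nhds hy, isClosed_closure.isOpen_compl.mem_nhds hcl] with z hz1 hz2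
      rw [h0]
      exact not_lt.1 fun hz => hz2 (subset_closure ((h.mem_iff z hz1).2 hz))
    exact h.fderiv_ne_zero y hy hmin.fderiv_eq_zero

theorem exists_lipschitz : ∃ K, LipschitzWith K X :=
  h.contDiff_field.lipschitzWith_of_hasCompactSupport h.hasCompactSupport (by simp)

theorem exists_integralCurve (x : ℂ) : ∃ γ : ℝ → ℂ, γ 0 = x ∧ ∀ t, HasDerivAt γ (X (γ t)) t := by
  obtain ⟨K, hK⟩ := h.exists_lipschitz
  obtain ⟨M, hM⟩ := h.hasCompactSupport.exists_bound_of_continuous h.contDiff_field.continuous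
  exact exists_integralCurve_of_lipschitz hK (M := ⟨max M 0, le_max_right _ _⟩)
    (fun x => (hM x).trans (le_max_left _ _)) x

/-- Integral curves of the tangent field do not leave the frontier. -/
theorem mem_frontier_of_integralCurve (hDo : IsOpen D) {γ : ℝ → ℂ}
    (hγ : ∀ t, HasDerivAt γ (X (γ t)) t) (h0 : γ 0 ∈ frontier D) (t : ℝ) : γ t ∈ frontier D := by
  have hγc : Continuous γ := continuous_iff_continuousAt.2 fun t => (hγ t).continuousAt
  have hψ : ∀ t, ψ (γ t) = 0 := by
    intro t
    have hd : ∀ t, HasDerivAt (fun t => ψ (γ t)) 0 t := fun t => by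
      have h1 := (h.contDiff.differentiable (by norm_num) (γ t)).hasFDerivAt
      exact (HasFDerivAt.comp_hasDerivAt (l := ψ) t h1 (hγ t)).congr_deriv (h.fderiv_field _)
    rw [is_const_of_deriv_eq_zero (fun t => (hd t).differentiableAt) (fun t => (hd t).deriv) t 0]
    exact (h.mem_frontier_iff hDo (h.frontier_subset h0)).1 h0
  have hcl : IsClopen (γ ⁻¹' frontier D) := by
    refine ⟨isClosed_frontier.preimage hγc, ?_⟩
    have : γ ⁻¹' frontier D = γ ⁻¹' W := by
      ext t
      exact ⟨fun ht => h.frontier_subset ht, fun ht => (h.mem_frontier_iff hDo ht).2 (hψ t)⟩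
    rw [this]
    exact h.isOpen.preimage hγc
  have := hcl.eq_univ ⟨0, h0⟩
  exact this.symm.subset (mem_univ t)

/-- An integral curve that passes twice through a point is periodic, by uniqueness. -/
theorem integralCurve_shift {γ : ℝ → ℂ} (hγ : ∀ t, HasDerivAt γ (X (γ t)) t) {s t : ℝ}
    (hst : γ s = γ t) : Function.Periodic γ (t - s) := by
  obtain ⟨K, hK⟩ := h.exists_lipschitz
  have h1 : ∀ a t, HasDerivAt (fun t => γ (t + a)) (X (γ (t + a))) t := fun a t =>
    (hγ (t + a)).comp_add_const t a
  have h2 := ODE_solution_unique_univ (v := fun _ => X) (s := fun _ => univ) (K := K) (t₀ := 0)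
    (fun _ => hK.lipschitzOnWith) (fun u => ⟨h1 t u, mem_univ _⟩) (fun u => ⟨h1 s u, mem_univ _⟩)
    (by simpa using hst.symm)
  intro u
  have := congrFun h2 (u - s)
  simp only [sub_add_cancel] at this
  rw [← this]
  congr 1
  ring

/-- The inner normals to the frontier form a collar. -/
theorem exists_collar (hDo : IsOpen D) (hb : Bornology.IsBounded D) :
    ∃ δ > 0, ∀ y ∈ frontier D, ∀ ε ∈ Ioc (0 : ℝ) δ,
      y + ε * (I * X y) ∈ D ∧ y - ε * (I * X y) ∉ D := by
  have hfc : IsCompact (frontier D) :=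
    hb.isCompact_closure.of_isClosed_subset isClosed_frontier frontier_subset_closure
  have hX := h.contDiff_field.continuous
  have hdψ := h.contDiff.continuous_fderiv (by norm_num)
  have hev : ∀ᶠ ε : ℝ in 𝓝 0, ∀ y ∈ frontier D,
      y + ε * (I * X y) ∈ W ∧ fderiv ℝ ψ (y + ε * (I * X y)) (I * X y) < 0 := by
    refine hfc.eventually_forall_of_forall_eventually
      (P := fun (ε : ℝ) y => y + ε * (I * X y) ∈ W ∧
        fderiv ℝ ψ (y + ε * (I * X y)) (I * X y) < 0) fun y hy => ?_
    have hc : Continuous fun z : ℝ × ℂ => z.2 + z.1 * (I * X z.2) := by fun_prop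
    refine Eventually.and ?_ ?_
    · refine hc.continuousAt.eventually_mem (h.isOpen.mem_nhds ?_)
      simpa using h.frontier_subset hy
    · have hc2 : Continuous fun z : ℝ × ℂ =>
          fderiv ℝ ψ (z.2 + z.1 * (I * X z.2)) (I * X z.2) :=
        (hdψ.comp hc).clm_apply (by fun_prop)
      refine hc2.continuousAt.eventually_lt_const ?_
      simpa using h.fderiv_normal y hy
  obtain ⟨δ, hδ, hδ'⟩ := Metric.eventually_nhds_iff_ball.1 hev
  refine ⟨δ / 2, by positivity, fun y hy ε hε => ?_⟩
  have hin : ∀ u ∈ Ioo (-δ) δ, u ∈ Metric.ball (0 : ℝ) δ := fun u hu => by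
    rw [mem_ball_zero_iff]
    exact abs_lt.2 hu
  have hd : ∀ u : ℝ, HasDerivAt (fun u : ℝ => ψ (y + u * (I * X y)))
      (fderiv ℝ ψ (y + u * (I * X y)) (I * X y)) u := fun u => by
    have h1 := (h.contDiff.differentiable (by norm_num) (y + u * (I * X y))).hasFDerivAt
    have h2 : HasDerivAt (fun u : ℝ => y + u * (I * X y)) (I * X y) u := by
      simpa using ((hasDerivAt_id u).ofReal_comp.mul_const (I * X y)).const_add y
    exact HasFDerivAt.comp_hasDerivAt (l := ψ) u h1 h2
  have hanti : StrictAntiOn (fun u : ℝ => ψ (y + u * (I * X y))) (Ioo (-δ) δ) := by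
    refine strictAntiOn_of_deriv_neg (convex_Ioo _ _)
      (continuousOn_of_forall_continuousAt fun u _ => (hd u).continuousAt) fun u hu => ?_
    rw [interior_Ioo] at hu
    rw [(hd u).deriv]
    exact (hδ' u (hin u hu) y hy).2
  have hz := (h.mem_frontier_iff hDo (h.frontier_subset hy)).1 hy
  have m0 : (0 : ℝ) ∈ Ioo (-δ) δ := ⟨by linarith, hδ⟩
  have m1 : ε ∈ Ioo (-δ) δ := ⟨by linarith [hε.1], by linarith [hε.2]⟩
  have m2 : -ε ∈ Ioo (-δ) δ := ⟨by linarith [hε.2], by linarith [hε.1]⟩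
  have a1 := hanti m0 m1 hε.1
  have a2 := hanti m2 m0 (neg_lt_zero.2 hε.1)
  simp only [ofReal_zero, zero_mul, add_zero, hz, ofReal_neg, neg_mul] at a1 a2
  rw [← sub_eq_add_neg] at a2
  have w2 := (hδ' _ (hin _ m2) y hy).1
  rw [ofReal_neg, neg_mul, ← sub_eq_add_neg] at w2
  exact ⟨(h.mem_iff _ (hδ' ε (hin ε m1) y hy).1).2 a1,
    fun hmem => absurd ((h.mem_iff _ w2).1 hmem) (not_lt.2 a2.le)⟩

end IsTangentField

namespace IsTangentField

variable {D W : Set ℂ} {ψ : ℂ → ℝ} {X : ℂ → ℂ} (h : IsTangentField D ψ W X)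
include h

/-- Near a frontier point `Q`, frontier points are determined by their coordinate along the tangent
at `Q`, and integral curves advance in this coordinate. -/
theorem exists_ball_eq_of_re_eq (hDo : IsOpen D) {Q : ℂ} (hQ : Q ∈ frontier D) : ∃ δ > 0,
    (∀ w ∈ Metric.ball Q δ, 1 / 2 < ((starRingEnd ℂ) (X Q) * X w).re) ∧
    ∀ y ∈ frontier D ∩ Metric.ball Q δ, ∀ z ∈ frontier D ∩ Metric.ball Q δ,
      ((starRingEnd ℂ) (X Q) * y).re = ((starRingEnd ℂ) (X Q) * z).re → y = z := by
  have hX := h.contDiff_field.continuous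
  have hdψ := h.contDiff.continuous_fderiv (by norm_num)
  set τ := X Q with hτ
  have hττ : (starRingEnd ℂ) τ * τ = 1 := by
    rw [mul_comm, Complex.mul_conj, Complex.normSq_eq_norm_sq, h.norm_field Q hQ]
    simp
  have e1 : ∀ᶠ w in 𝓝 Q, w ∈ W ∧ fderiv ℝ ψ w (I * τ) < 0 :=
    Eventually.and (h.isOpen.mem_nhds (h.frontier_subset hQ))
      ((hdψ.clm_apply continuous_const).continuousAt.eventually_lt_const (h.fderiv_normal Q hQ))
  have e2 : ∀ᶠ w in 𝓝 Q, 1 / 2 < ((starRingEnd ℂ) τ * X w).re := by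
    have hc : Continuous fun w => ((starRingEnd ℂ) τ * X w).re := by fun_prop
    refine hc.continuousAt.eventually_const_lt ?_
    beta_reduce
    rw [← hτ, hττ]
    norm_num
  obtain ⟨δ, hδ, hδ'⟩ := Metric.eventually_nhds_iff_ball.1 (e1.and e2)
  -- the defining function decreases along the normal at `Q`
  have hlt : ∀ z, ∀ c : ℝ, 0 < c → z ∈ Metric.ball Q δ → z + c * (I * τ) ∈ Metric.ball Q δ →
      ψ (z + c * (I * τ)) < ψ z := by
    intro z c hc hz hzc
    have hmem : ∀ u ∈ Icc 0 c, z + u * (I * τ) ∈ Metric.ball Q δ := by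
      intro u hu
      have := (convex_ball Q δ).add_smul_sub_mem hz hzc (t := u / c)
        ⟨div_nonneg hu.1 hc.le, div_le_one_of_le₀ hu.2 hc.le⟩
      rw [add_sub_cancel_left, Complex.real_smul, ← mul_assoc, ← ofReal_mul,
        div_mul_cancel₀ _ hc.ne'] at this
      exact this
    have hd : ∀ u : ℝ, HasDerivAt (fun u : ℝ => ψ (z + u * (I * τ)))
        (fderiv ℝ ψ (z + u * (I * τ)) (I * τ)) u := fun u => by
      have h1 := (h.contDiff.differentiable (by norm_num) (z + u * (I * τ))).hasFDerivAt
      have h2 : HasDerivAt (fun u : ℝ => z + u * (I * τ)) (I * τ) u := by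
        simpa using ((hasDerivAt_id u).ofReal_comp.mul_const (I * τ)).const_add z
      exact HasFDerivAt.comp_hasDerivAt (l := ψ) u h1 h2
    have hanti : StrictAntiOn (fun u : ℝ => ψ (z + u * (I * τ))) (Icc 0 c) := by
      refine strictAntiOn_of_deriv_neg (convex_Icc _ _)
        (continuousOn_of_forall_continuousAt fun u _ => (hd u).continuousAt) fun u hu => ?_
      rw [(hd u).deriv]
      exact (hδ' _ (hmem u (interior_subset hu))).1.2
    simpa using hanti (left_mem_Icc.2 hc.le) (right_mem_Icc.2 hc.le) hc
  refine ⟨δ, hδ, fun w hw => (hδ' w hw).2, fun y hy z hz hyz => ?_⟩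
  have hy0 := (h.mem_frontier_iff hDo (h.frontier_subset hy.1)).1 hy.1
  have hz0 := (h.mem_frontier_iff hDo (h.frontier_subset hz.1)).1 hz.1
  set c := ((starRingEnd ℂ) τ * (y - z)).im with hc
  have hyzc : y = z + c * (I * τ) := by
    have h1 : (starRingEnd ℂ) τ * (y - z) = c * I := by
      refine Complex.ext ?_ ?_
      · simp only [mul_sub, sub_re, hyz, sub_self]
        simp
      · simp [hc]
    linear_combination τ * h1 - (y - z) * hττ
  have hzyc : z = y + (-c : ℝ) * (I * τ) := by
    rw [hyzc]
    push_cast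
    ring
  rcases lt_trichotomy c 0 with h0 | h0 | h0
  · have := hlt y (-c) (neg_pos.2 h0) hy.2 (hzyc ▸ hz.2)
    rw [← hzyc, hy0, hz0] at this
    exact absurd this (lt_irrefl _)
  · rw [hyzc, h0]
    simp
  · have := hlt z c h0 hz.2 (hyzc ▸ hy.2)
    rw [← hyzc, hy0, hz0] at this
    exact absurd this (lt_irrefl _)

/-- Integral curves in the compact frontier return: two of the points `γ n` are close to each other
and to some point `Q`. Near the first of them, the curve takes all tangential coordinates close to
its own, among them that of the second. -/
theorem exists_return (hDo : IsOpen D) (hb : Bornology.IsBounded D) {γ : ℝ → ℂ}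
    (hγ : ∀ t, HasDerivAt γ (X (γ t)) t) (hmem : ∀ t, γ t ∈ frontier D) :
    ∃ s t, s < t ∧ γ s = γ t := by
  have hfc : IsCompact (frontier D) :=
    hb.isCompact_closure.of_isClosed_subset isClosed_frontier frontier_subset_closure
  obtain ⟨Q, hQ, φ, hφ, hlim⟩ := hfc.tendsto_subseq (x := fun n : ℕ => γ n) fun n => hmem n
  obtain ⟨δ, hδ, h1, h2⟩ := h.exists_ball_eq_of_re_eq hDo hQ
  set τ := X Q with hτ
  have hlip : ∀ s t, ‖γ t - γ s‖ ≤ |t - s| := by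
    intro s t
    have := convex_univ.norm_image_sub_le_of_norm_hasDerivWithin_le (f := γ) (C := 1)
      (fun t _ => (hγ t).hasDerivWithinAt) (fun t _ => (h.norm_field _ (hmem t)).le)
      (mem_univ s) (mem_univ t)
    simpa using this
  set η := min (δ / 2) (1 / 2) with hη
  have hη0 : 0 < η := by positivity
  have hη1 : η ≤ δ / 2 := min_le_left _ _
  have hη2 : η ≤ 1 / 2 := min_le_right _ _
  obtain ⟨N, hN⟩ := Metric.tendsto_atTop.1 hlim (η / 4) (by positivity)
  set n : ℝ := ((φ N : ℕ) : ℝ) with hn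
  set m : ℝ := ((φ (N + 1) : ℕ) : ℝ) with hm
  have hnm : n + 1 ≤ m := by
    have : φ N + 1 ≤ φ (N + 1) := hφ (Nat.lt_succ_self N)
    rw [hn, hm]
    exact_mod_cast this
  have dn : ‖γ n - Q‖ < η / 4 := by simpa [dist_eq_norm] using hN N le_rfl
  have dm : ‖γ m - Q‖ < η / 4 := by simpa [dist_eq_norm] using hN (N + 1) (Nat.le_succ N)
  have hball : ∀ s ∈ Icc (n - η) (n + η), γ s ∈ Metric.ball Q δ := by
    intro s hs
    rw [mem_ball_iff_norm]
    have a1 := hlip n s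
    have a2 : |s - n| ≤ η := abs_le.2 ⟨by linarith [hs.1], by linarith [hs.2]⟩
    have a3 := norm_add_le (γ s - γ n) (γ n - Q)
    rw [sub_add_sub_cancel] at a3
    linarith
  set u : ℝ → ℝ := fun s => ((starRingEnd ℂ) τ * γ s).re with hu
  have hud : ∀ s, HasDerivAt u (((starRingEnd ℂ) τ * X (γ s)).re) s := fun s =>
    HasFDerivAt.comp_hasDerivAt (l := Complex.reCLM) s (Complex.reCLM.hasFDerivAt)
      ((hγ s).const_mul ((starRingEnd ℂ) τ))
  have huc : Continuous u := continuous_iff_continuousAt.2 fun s => (hud s).continuousAt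
  have hmono : ∀ s ∈ Icc (n - η) (n + η), ∀ t ∈ Icc (n - η) (n + η), s ≤ t →
      1 / 2 * (t - s) ≤ u t - u s := by
    refine (convex_Icc _ _).mul_sub_le_image_sub_of_le_deriv huc.continuousOn
      (fun s _ => (hud s).differentiableAt.differentiableWithinAt) fun s hs => ?_
    rw [(hud s).deriv]
    exact (h1 _ (hball s (interior_subset hs))).le
  have i0 : n ∈ Icc (n - η) (n + η) := ⟨by linarith, by linarith⟩
  have il : n - η ∈ Icc (n - η) (n + η) := ⟨by linarith, by linarith⟩
  have ir : n + η ∈ Icc (n - η) (n + η) := ⟨by linarith, by linarith⟩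
  have m1 := hmono _ il _ i0 (by linarith)
  have m2 := hmono _ i0 _ ir (by linarith)
  have hτ1 : ‖(starRingEnd ℂ) τ‖ = 1 := by rw [Complex.norm_conj]; exact h.norm_field Q hQ
  have m3 : |u m - u n| < η / 2 := by
    have a1 : u m - u n = ((starRingEnd ℂ) τ * (γ m - γ n)).re := by
      simp only [hu]
      rw [mul_sub, sub_re]
    have a2 := Complex.abs_re_le_norm ((starRingEnd ℂ) τ * (γ m - γ n))
    rw [← a1, norm_mul, hτ1, one_mul] at a2
    have a3 := norm_sub_le (γ m - Q) (γ n - Q)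
    rw [sub_sub_sub_cancel_right] at a3
    linarith
  obtain ⟨m4, m5⟩ := abs_lt.1 m3
  obtain ⟨s, hs, hsm⟩ := intermediate_value_Icc (by linarith : n - η ≤ n + η) huc.continuousOn
    (show u m ∈ Icc (u (n - η)) (u (n + η)) from ⟨by linarith, by linarith⟩)
  refine ⟨s, m, by linarith [hs.2], h2 _ ⟨hmem s, hball s hs⟩ _ ⟨hmem m, ?_⟩ hsm⟩
  rw [mem_ball_iff_norm]
  linarith

/-- The integral curves in the frontier of a bounded domain are closed boundary curves. -/
theorem exists_isBoundaryLoop (hDo : IsOpen D) (hb : Bornology.IsBounded D)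
    (hne : (frontier D).Nonempty) : ∃ γ T κ L, IsBoundaryLoop D γ T κ L := by
  obtain ⟨P, hP⟩ := hne
  obtain ⟨γ, hγ0, hγ⟩ := h.exists_integralCurve P
  have hmem := h.mem_frontier_of_integralCurve hDo hγ (hγ0.symm ▸ hP)
  have hγc : Continuous γ := continuous_iff_continuousAt.2 fun t => (hγ t).continuousAt
  have hXc := h.contDiff_field.continuous
  -- the group of periods
  let H : AddSubgroup ℝ :=
    { carrier := {p | Function.Periodic γ p}
      add_mem' := fun ha hb => Function.Periodic.add_period ha hb
      zero_mem' := fun t => by simp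
      neg_mem' := fun ha => Function.Periodic.neg ha }
  have hH : ∀ s t, γ s = γ t → t - s ∈ H := fun s t hst => h.integralCurve_shift hγ hst
  obtain ⟨s₀, t₀, hst, hret⟩ := h.exists_return hDo hb hγ hmem
  have hbot : H ≠ ⊥ := fun hbot => by
    have := hH s₀ t₀ hret
    rw [hbot, AddSubgroup.mem_bot] at this
    linarith
  -- the tangent does not turn by a right angle in a short time, which excludes short periods
  obtain ⟨a, ha, hdisj⟩ : ∃ a > 0, Disjoint (H : Set ℝ) (Ioo 0 a) := by
    have hc : Continuous fun t => ((starRingEnd ℂ) (X (γ 0)) * X (γ t)).re := by fun_prop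
    have h1 : ∀ᶠ t in 𝓝 (0 : ℝ), 0 < ((starRingEnd ℂ) (X (γ 0)) * X (γ t)).re := by
      refine hc.continuousAt.eventually_const_lt ?_
      beta_reduce
      rw [mul_comm, Complex.mul_conj, Complex.normSq_eq_norm_sq, h.norm_field _ (hmem 0)]
      simp
    obtain ⟨a, ha, ha'⟩ := Metric.eventually_nhds_iff_ball.1 h1
    refine ⟨a, ha, disjoint_left.2 fun p hp hpa => ?_⟩
    have hd : ∀ s, HasDerivAt (fun s => ((starRingEnd ℂ) (X (γ 0)) * γ s).re)
        (((starRingEnd ℂ) (X (γ 0)) * X (γ s)).re) s := fun s =>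
      HasFDerivAt.comp_hasDerivAt (l := Complex.reCLM) s (Complex.reCLM.hasFDerivAt)
        ((hγ s).const_mul ((starRingEnd ℂ) (X (γ 0))))
    have hp0 : γ p = γ 0 := by simpa using (show Function.Periodic γ p from hp) 0
    obtain ⟨ξ, hξ, hξ0⟩ := exists_hasDerivAt_eq_zero hpa.1
      (continuousOn_of_forall_continuousAt fun s _ => (hd s).continuousAt) (by rw [hp0])
      fun s _ => hd s
    have := ha' ξ (by
      rw [mem_ball_zero_iff, Real.norm_of_nonneg hξ.1.le]
      exact hξ.2.trans hpa.2)
    linarith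
  obtain ⟨L, ⟨hLH, hL0⟩, hLmin⟩ := AddSubgroup.exists_isLeast_pos hbot ha hdisj
  have hXs : ∀ s, HasDerivAt (fun s => X (γ s)) (fderiv ℝ X (γ s) (X (γ s))) s := fun s =>
    HasFDerivAt.comp_hasDerivAt (l := X) s
      (h.contDiff_field.differentiable (by norm_num) (γ s)).hasFDerivAt (hγ s)
  have hn : ∀ s, X (γ s) * (starRingEnd ℂ) (X (γ s)) = 1 := fun s => by
    rw [Complex.mul_conj, Complex.normSq_eq_norm_sq, h.norm_field _ (hmem s)]
    simp
  have hdX := h.contDiff_field.continuous_fderiv (by norm_num)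
  obtain ⟨δ, hδ, hcol⟩ := h.exists_collar hDo hb
  refine ⟨γ, fun s => X (γ s),
    fun s => ((starRingEnd ℂ) (X (γ s)) * fderiv ℝ X (γ s) (X (γ s))).im, L,
    { pos := hL0
      hasDerivAt := hγ
      hasDerivAt_tangent := fun s => ?_
      continuous_curvature := ?_
      norm_tangent := fun s => h.norm_field _ (hmem s)
      periodic := hLH
      injective := fun s t h1 h2 h3 => ?_
      mem_frontier := hmem
      exists_collar := ⟨δ, hδ, fun s => hcol _ (hmem s)⟩ }⟩
  · refine (hXs s).congr_deriv ?_
    have h1 : HasDerivAt (fun s => X (γ s) * (starRingEnd ℂ) (X (γ s))) _ s :=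
      (hXs s).mul (hXs s).star
    have h2 : HasDerivAt (fun s => X (γ s) * (starRingEnd ℂ) (X (γ s))) 0 s := by
      simp only [hn]
      exact hasDerivAt_const _ _
    have h3 := h1.unique h2
    set A := fderiv ℝ X (γ s) (X (γ s))
    set T := X (γ s)
    have h4 : (starRingEnd ℂ) T * A = (((starRingEnd ℂ) T * A).im : ℂ) * I := by
      refine Complex.ext ?_ ?_
      · have := congrArg Complex.re h3
        simp at this ⊢
        linarith
      · simp
    have h5 : T * (starRingEnd ℂ) T = 1 := hn s
    rw [← h4]
    linear_combination -A * h5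
  · have : Continuous fun s => fderiv ℝ X (γ s) (X (γ s)) :=
      (hdX.comp hγc).clm_apply (hXc.comp hγc)
    fun_prop
  · have := hLmin ⟨hH s t h3, by linarith⟩
    linarith

end IsTangentField

theorem exists_isBoundaryLoop {D : Set ℂ} (hDo : IsOpen D) (hb : Bornology.IsBounded D)
    (hne : (frontier D).Nonempty)
    (hs : ∀ x ∈ frontier D, ∃ (U : Set ℂ) (φ : ℂ → ℝ), IsOpen U ∧ x ∈ U ∧ ContDiffOn ℝ ∞ φ U ∧
      fderiv ℝ φ x ≠ 0 ∧ D ∩ U = {y ∈ U | φ y < 0}) :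
    ∃ γ T κ L, IsBoundaryLoop D γ T κ L := by
  obtain ⟨ψ, W, X, h⟩ := exists_isTangentField hDo hb hs
  exact h.exists_isBoundaryLoop hDo hb hne

/-! ### The length of a simple closed curve -/

/-- The chord is a lower bound for the one-dimensional measure of a curve, since the distance from
one end point is a contraction to the line. -/
theorem ofReal_norm_sub_le_hausdorffMeasure {γ : ℝ → ℂ} (hγ : Continuous γ) {a b : ℝ}
    (hab : a ≤ b) : ENNReal.ofReal ‖γ b - γ a‖ ≤ μH[1] (γ '' Ico a b) := by
  have hf : LipschitzWith 1 fun z => ‖z - γ a‖ := LipschitzWith.of_dist_le_mul fun z w => by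
    rw [NNReal.coe_one, one_mul, Real.dist_eq, dist_eq_norm]
    simpa using abs_norm_sub_norm_le (z - γ a) (w - γ a)
  have h1 : Ico 0 ‖γ b - γ a‖ ⊆ (fun z => ‖z - γ a‖) '' (γ '' Ico a b) := by
    rw [image_image]
    have := intermediate_value_Ico hab (f := fun s => ‖γ s - γ a‖) (by fun_prop)
    simpa using this
  have h2 := hf.hausdorffMeasure_image_le zero_le_one (γ '' Ico a b)
  have h3 := measure_mono (μ := μH[1]) h1
  rw [hausdorffMeasure_real] at h2 h3
  rw [Real.volume_Ico, sub_zero] at h3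
  simpa using h3.trans h2

namespace IsUnitSpeedLoop

variable {γ T : ℝ → ℂ} {κ : ℝ → ℝ} {L : ℝ} (h : IsUnitSpeedLoop γ T κ L)
include h

/-- The chord is shorter than the arc by a quantity of second order at most. -/
theorem exists_chord_lower_bound : ∃ C : ℝ, ∀ a b, 0 ≤ a → a ≤ b → b ≤ L →
    (b - a) - C * (b - a) ^ 2 ≤ ‖γ b - γ a‖ := by
  obtain ⟨C, hC⟩ := (isCompact_Icc (a := 0) (b := L)).exists_bound_of_continuousOn
    h.continuous_curvature.continuousOn
  refine ⟨C, fun a b ha hab hb => ?_⟩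
  have h1 : ∀ s ∈ Icc a b, ‖T s - T a‖ ≤ C * (b - a) := by
    intro s hs
    have := (convex_Icc a b).norm_image_sub_le_of_norm_hasDerivWithin_le (f := T) (C := C)
      (fun s _ => (h.hasDerivAt_tangent s).hasDerivWithinAt) (fun s hs => by
        rw [norm_mul, norm_mul, Complex.norm_I, h.norm_tangent, mul_one, mul_one,
          Complex.norm_real]
        exact hC s ⟨ha.trans hs.1, hs.2.trans hb⟩) (left_mem_Icc.2 hab) hs
    have hC0 : 0 ≤ C := (norm_nonneg _).trans (hC a ⟨ha, hab.trans hb⟩)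
    refine this.trans (mul_le_mul_of_nonneg_left ?_ hC0)
    rw [Real.norm_of_nonneg (sub_nonneg.2 hs.1)]
    linarith [hs.2]
  have h2 := (convex_Icc a b).norm_image_sub_le_of_norm_hasDerivWithin_le
    (f := fun s : ℝ => γ s - s * T a) (C := C * (b - a))
    (fun s _ => ((h.hasDerivAt s).sub
      ((hasDerivAt_id s).ofReal_comp.mul_const (T a))).hasDerivWithinAt)
    (fun s hs => by simpa using h1 s hs) (left_mem_Icc.2 hab) (right_mem_Icc.2 hab)
  rw [Real.norm_of_nonneg (sub_nonneg.2 hab)] at h2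
  have h3 : ‖((b - a : ℝ) : ℂ) * T a‖ = b - a := by
    rw [norm_mul, h.norm_tangent, mul_one, Complex.norm_real,
      Real.norm_of_nonneg (sub_nonneg.2 hab)]
  have h4 := norm_sub_norm_le (((b - a : ℝ) : ℂ) * T a) (γ b - γ a)
  rw [h3, ← norm_neg (((b - a : ℝ) : ℂ) * T a - (γ b - γ a))] at h4
  have h5 : -(((b - a : ℝ) : ℂ) * T a - (γ b - γ a)) = γ b - b * T a - (γ a - a * T a) := by
    push_cast
    ring
  rw [h5] at h4
  nlinarith

/-- The parameter length of a simple closed curve of unit speed is at most its one-dimensional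
measure. -/
theorem ofReal_le_hausdorffMeasure : ENNReal.ofReal L ≤ μH[1] (range γ) := by
  obtain ⟨C, hC⟩ := h.exists_chord_lower_bound
  have hL := h.pos
  have key : ∀ n : ℕ, ENNReal.ofReal (L - C * L ^ 2 * (1 / ((n : ℝ) + 1))) ≤ μH[1] (range γ) := by
    intro n
    set N : ℝ := (n : ℝ) + 1 with hN
    have hN0 : 0 < N := by positivity
    set t : ℕ → ℝ := fun k => k * (L / N) with ht
    have htm : ∀ j k : ℕ, j ≤ k → t j ≤ t k := fun j k hjk =>
      mul_le_mul_of_nonneg_right (by exact_mod_cast hjk) (by positivity)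
    have ht0 : ∀ k, 0 ≤ t k := fun k => by positivity
    have htL : t (n + 1) = L := by
      simp only [ht, Nat.cast_add, Nat.cast_one, ← hN]
      field_simp
    have hts : ∀ k, t (k + 1) - t k = L / N := fun k => by
      simp only [ht, Nat.cast_add, Nat.cast_one]
      ring
    have hinj : InjOn γ (Ico 0 L) := by
      intro s hs u hu hsu
      rcases lt_trichotomy s u with h1 | h1 | h1
      · exact absurd hsu (h.injective s u h1 (by linarith [hs.1, hu.2]))
      · exact h1
      · exact absurd hsu.symm (h.injective u s h1 (by linarith [hu.1, hs.2]))
    have hsub : ∀ k ∈ Finset.range (n + 1), Ico (t k) (t (k + 1)) ⊆ Ico 0 L := by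
      intro k hk s hs
      have := htm (k + 1) (n + 1) (Finset.mem_range.1 hk)
      exact ⟨(ht0 k).trans hs.1, hs.2.trans_le (htL ▸ this)⟩
    have hdisj : (Finset.range (n + 1) : Set ℕ).PairwiseDisjoint
        fun k => γ '' Ico (t k) (t (k + 1)) := by
      have hlt : ∀ j ∈ Finset.range (n + 1), ∀ k ∈ Finset.range (n + 1), j < k →
          Disjoint (γ '' Ico (t j) (t (j + 1))) (γ '' Ico (t k) (t (k + 1))) := by
        intro j hj k hk hjk
        refine disjoint_left.2 ?_
        rintro _ ⟨s, hs, rfl⟩ ⟨u, hu, hus⟩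
        have := hinj (hsub k hk hu) (hsub j hj hs) hus
        have h2 := htm (j + 1) k hjk
        linarith [hs.2, hu.1]
      intro j hj k hk hjk
      rcases lt_or_gt_of_ne hjk with h1 | h1
      · exact hlt j hj k hk h1
      · exact (hlt k hk j hj h1).symm
    have hmeas : ∀ k ∈ Finset.range (n + 1), MeasurableSet (γ '' Ico (t k) (t (k + 1))) :=
      fun k hk => measurableSet_Ico.image_of_continuousOn_injOn h.continuous.continuousOn
        (hinj.mono (hsub k hk))
    -- the chords of a partition into `n + 1` equal parts
    calc ENNReal.ofReal (L - C * L ^ 2 * (1 / N))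
        = ENNReal.ofReal (∑ k ∈ Finset.range (n + 1), (L / N - C * (L / N) ^ 2)) := by
          rw [Finset.sum_const, Finset.card_range, nsmul_eq_mul, Nat.cast_add, Nat.cast_one, ← hN]
          congr 1
          field_simp
      _ ≤ ENNReal.ofReal (∑ k ∈ Finset.range (n + 1), ‖γ (t (k + 1)) - γ (t k)‖) := by
          refine ENNReal.ofReal_le_ofReal (Finset.sum_le_sum fun k hk => ?_)
          have h1 := htm k (k + 1) (Nat.le_succ k)
          have h2 := htm (k + 1) (n + 1) (Finset.mem_range.1 hk)
          have := hC _ _ (ht0 k) h1 (htL ▸ h2)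
          rwa [hts] at this
      _ = ∑ k ∈ Finset.range (n + 1), ENNReal.ofReal ‖γ (t (k + 1)) - γ (t k)‖ :=
          ENNReal.ofReal_sum_of_nonneg fun k _ => norm_nonneg _
      _ ≤ ∑ k ∈ Finset.range (n + 1), μH[1] (γ '' Ico (t k) (t (k + 1))) :=
          Finset.sum_le_sum fun k _ => ofReal_norm_sub_le_hausdorffMeasure h.continuous
            (htm k (k + 1) (Nat.le_succ k))
      _ = μH[1] (⋃ k ∈ Finset.range (n + 1), γ '' Ico (t k) (t (k + 1))) :=
          (measure_biUnion_finset hdisj hmeas).symm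
      _ ≤ μH[1] (range γ) :=
          measure_mono (iUnion₂_subset fun k _ => image_subset_range _ _)
  have hlim : Tendsto (fun n : ℕ => ENNReal.ofReal (L - C * L ^ 2 * (1 / ((n : ℝ) + 1)))) atTop
      (𝓝 (ENNReal.ofReal (L - C * L ^ 2 * 0))) :=
    (ENNReal.continuous_ofReal.tendsto _).comp
      (tendsto_const_nhds.sub (tendsto_one_div_add_atTop_nhds_zero_nat.const_mul _))
  rw [mul_zero, sub_zero] at hlim
  exact le_of_tendsto' hlim key

end IsUnitSpeedLoop

/-! ### Cheeger quotients in the plane -/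

theorem ofReal_le_inradius {D : Set Plane} {x : Plane} {ρ : ℝ}
    (h : Metric.ball x ρ ⊆ D) : ENNReal.ofReal ρ ≤ inradius D := by
  rcases le_total ρ 0 with h0 | h0
  · simp [ENNReal.ofReal_of_nonpos h0]
  · exact le_iSup₂_of_le (f := fun (r : ℝ≥0) (_ : ∃ x : Plane, Metric.ball x r ⊆ D) => (r : ℝ≥0∞))
      ρ.toNNReal ⟨x, by rwa [Real.coe_toNNReal _ h0]⟩ le_rfl

theorem exists_ball_subset_of_lt_inradius {D : Set Plane} {ρ : ℝ}
    (h : ENNReal.ofReal ρ < inradius D) : ∃ x, Metric.ball x ρ ⊆ D := by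
  obtain ⟨r, hr⟩ := lt_iSup_iff.1 h
  obtain ⟨⟨x, hx⟩, hr⟩ := lt_iSup_iff.1 hr
  refine ⟨x, (Metric.ball_subset_ball ?_).trans hx⟩
  have : ρ.toNNReal < r := ENNReal.coe_lt_coe.1 hr
  exact (Real.le_coe_toNNReal ρ).trans (by exact_mod_cast this.le)

theorem inradius_mono {D Ω : Set Plane} (h : D ⊆ Ω) : inradius D ≤ inradius Ω :=
  iSup_mono fun _ => iSup_mono' fun ⟨x, hx⟩ => ⟨⟨x, hx.trans h⟩, le_rfl⟩

theorem inradius_pos {D : Set Plane} (hD : IsOpen D) (hne : D.Nonempty) : 0 < inradius D := by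
  obtain ⟨x, hx⟩ := hne
  obtain ⟨r, hr, hrD⟩ := Metric.isOpen_iff.1 hD x hx
  exact (ENNReal.ofReal_pos.2 hr).trans_le (ofReal_le_inradius hrD)

/-- An inscribed disc of the largest radius has at most the area of the domain. -/
theorem pi_mul_inradius_sq_le (D : Set Plane) :
    ENNReal.ofReal Real.pi * inradius D ^ 2 ≤ area D := by
  by_contra! hlt
  have hc : Continuous fun t : ℝ≥0∞ => ENNReal.ofReal Real.pi * t ^ 2 :=
    (ENNReal.continuous_const_mul ENNReal.ofReal_ne_top).comp (ENNReal.continuous_pow 2)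
  have h0 : inradius D ≠ 0 := fun h => by simp [h] at hlt
  have h1 : ∀ᶠ t in 𝓝[<] inradius D, area D < ENNReal.ofReal Real.pi * t ^ 2 :=
    (hc.continuousAt.eventually_const_lt hlt).filter_mono nhdsWithin_le_nhds
  have : (𝓝[<] inradius D).NeBot := nhdsLT_neBot_of_exists_lt ⟨0, pos_iff_ne_zero.2 h0⟩
  obtain ⟨t, ht, htD⟩ := (h1.and self_mem_nhdsWithin).exists
  have htD : t < inradius D := htD
  obtain ⟨x, hx⟩ := exists_ball_subset_of_lt_inradius (ρ := t.toReal)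
    (by rwa [ENNReal.ofReal_toReal htD.ne_top])
  have h2 := measure_mono (μ := volume) hx
  rw [EuclideanSpace.volume_ball_fin_two, ENNReal.ofReal_toReal htD.ne_top, mul_comm] at h2
  exact absurd ht (not_lt.2 h2)

/-- Bonnesen's inequality for domains in the Euclidean plane, with the Hausdorff measure of the
frontier as length. -/
theorem exists_bonnesen {D : Set Plane} (hb : Bornology.IsBounded D)
    (hD : IsSimplyConnectedDomain D) (hs : HasSmoothBoundary D) {r : ℝ} (hr0 : 0 < r)
    (hr : ∀ x ρ, Metric.ball x ρ ⊆ D → ρ ≤ r) (hr' : ∀ ρ < r, ∃ x, Metric.ball x ρ ⊆ D) :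
    ∃ L : ℝ, 0 < L ∧ ENNReal.ofReal L ≤ boundaryLength D ∧
      (area D).toReal + Real.pi * r ^ 2 ≤ r * L := by
  let e : Plane ≃ₗᵢ[ℝ] ℂ := Complex.orthonormalBasisOneI.repr.symm
  set D' : Set ℂ := e '' D with hD'
  have hpre : D' = e.symm ⁻¹' D := e.toEquiv.image_eq_preimage_symm D
  have hDo : IsOpen D' := e.toHomeomorph.isOpenMap _ hD.isOpen
  have hDs : IsSimplyConnected D' := e.toHomeomorph.isSimplyConnected_image.2 hD.simplyConnected
  have hDb : Bornology.IsBounded D' := e.lipschitz.isBounded_image hb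
  have hfr : frontier D' = e '' frontier D := (e.toHomeomorph.image_frontier D).symm
  have hne : (frontier D').Nonempty := by
    refine nonempty_frontier_iff.2 ⟨hDs.nonempty, fun h => ?_⟩
    rw [h] at hDb
    exact NormedSpace.unbounded_univ ℝ ℂ hDb
  have hvol : volume.real D' = (area D).toReal := by
    rw [measureReal_def, hpre, area,
      e.symm.measurePreserving.measure_preimage hD.isOpen.measurableSet.nullMeasurableSet]
  have hball : ∀ x ρ, Metric.ball x ρ ⊆ D' ↔ Metric.ball (e.symm x) ρ ⊆ D := fun x ρ => by
    rw [← image_subset_image_iff e.injective, LinearIsometryEquiv.image_ball,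
      LinearIsometryEquiv.apply_symm_apply]
  obtain ⟨γ, T, κ, L, hγ⟩ := exists_isBoundaryLoop hDo hDb hne (by
    rw [hfr]
    rintro _ ⟨x, hx, rfl⟩
    obtain ⟨U, φ, hU, hxU, hφ, hdφ, hDU⟩ := hs x hx
    refine ⟨e.symm ⁻¹' U, φ ∘ e.symm, hU.preimage e.symm.continuous, by simpa using hxU,
      hφ.comp e.symm.contDiff.contDiffOn fun y hy => hy, ?_, ?_⟩
    · intro h0
      refine hdφ (ContinuousLinearMap.ext fun v => ?_)
      have h1 := e.symm.toContinuousLinearEquiv.comp_right_fderiv (f := φ) (x := e x)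
      have h2 := DFunLike.congr_fun (h1.symm.trans h0) (e v)
      simpa using h2
    · rw [hpre, ← preimage_inter, hDU]
      rfl)
  refine ⟨L, hγ.pos, ?_, ?_⟩
  · refine hγ.ofReal_le_hausdorffMeasure.trans (le_of_eq ?_)
    rw [hγ.range_eq_frontier hDo hDs, hfr, boundaryLength]
    exact e.toIsometryEquiv.hausdorffMeasure_image 1 _
  · rw [← hvol]
    refine hγ.area_add_le hDo hDs hDb hr0 (fun x ρ h => hr _ _ ((hball x ρ).1 h)) fun ρ hρ => ?_
    obtain ⟨x, hx⟩ := hr' ρ hρ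
    exact ⟨e x, (hball _ _).2 (by simpa using hx)⟩

/-- The elementary estimate behind the passage from a subdomain to the domain. The number `w` is the
inverse of the area of the domain, which may be zero. -/
theorem one_add_div_le_of_bonnesen {r ρ A L w : ℝ} (hr : 0 < r) (hrρ : r ≤ ρ) (hA : 0 < A)
    (hw : w * A ≤ 1) (hwρ : Real.pi * ρ ^ 2 * w ≤ 1) (hL : A + Real.pi * r ^ 2 ≤ r * L) :
    (1 + Real.pi * ρ ^ 2 * w) / ρ ≤ L / A := by
  have hπ := Real.pi_pos
  have hρ := hr.trans_le hrρ
  have h1 : (A + Real.pi * r ^ 2) / (r * A) ≤ L / A := by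
    rw [div_le_div_iff₀ (by positivity) hA]
    nlinarith
  refine le_trans ?_ h1
  rw [div_le_div_iff₀ hρ (by positivity)]
  rcases le_total (Real.pi * ρ ^ 2) A with h2 | h2
  · have h3 : Real.pi * ρ ^ 2 * r * (w * A) ≤ Real.pi * ρ ^ 2 * r * 1 :=
      mul_le_mul_of_nonneg_left hw (by positivity)
    have h4 : 0 ≤ (ρ - r) * (A - Real.pi * r * ρ) := by
      refine mul_nonneg (sub_nonneg.2 hrρ) ?_
      nlinarith [mul_le_mul_of_nonneg_left hrρ (mul_pos hπ hρ).le]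
    nlinarith
  · have h3 : r * A * (Real.pi * ρ ^ 2 * w) ≤ r * A * 1 :=
      mul_le_mul_of_nonneg_left hwρ (by positivity)
    -- what remains is `2 * r * A ≤ A * ρ + π * r ^ 2 * ρ`, where the area alone suffices if
    -- `2 * r ≤ ρ`
    rcases le_total (2 * r) ρ with h4 | h4
    · nlinarith [mul_nonneg hA.le (sub_nonneg.2 h4), mul_pos hπ (pow_pos hr 2)]
    · have h5 : A * (2 * r - ρ) ≤ Real.pi * ρ ^ 2 * (2 * r - ρ) :=
        mul_le_mul_of_nonneg_right h2 (sub_nonneg.2 h4)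
      have h6 : 0 ≤ Real.pi * ρ * (ρ - r) ^ 2 := by positivity
      nlinarith

theorem mainTheorem6 (Ω : Set Plane) (hΩ : IsSimplyConnectedDomain Ω) :
    1 / reducedInradius Ω ≤ lambdaOneOne Ω := by
  refine le_iInf₂ fun D hD => ?_
  obtain ⟨hDΩ, hb, hDs, hsm⟩ := hD
  have hDne := hDs.simplyConnected.nonempty
  have hA0 : 0 < area D := hDs.isOpen.measure_pos _ hDne
  have hAt : area D ≠ ⊤ := hb.measure_lt_top.ne
  have hV0 : area Ω ≠ 0 := (hA0.trans_le (measure_mono hDΩ)).ne'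
  have hπ0 : ENNReal.ofReal Real.pi ≠ 0 := (ENNReal.ofReal_pos.2 Real.pi_pos).ne'
  have hsqD := pi_mul_inradius_sq_le D
  have hsqΩ := pi_mul_inradius_sq_le Ω
  have hrt : inradius D ≠ ⊤ := fun h => by
    rw [h, ENNReal.top_pow two_ne_zero, ENNReal.mul_top hπ0, top_le_iff] at hsqD
    exact hAt hsqD
  have hr0 := inradius_pos hDs.isOpen hDne
  set r := (inradius D).toReal with hr
  have hr0' : 0 < r := ENNReal.toReal_pos hr0.ne' hrt
  have hrr : ENNReal.ofReal r = inradius D := ENNReal.ofReal_toReal hrt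
  obtain ⟨L, hL0, hL, hbon⟩ := exists_bonnesen hb hDs hsm hr0'
    (fun x ρ h => by
      have := ofReal_le_inradius h
      rw [← hrr] at this
      exact (ENNReal.ofReal_le_ofReal_iff hr0'.le).1 this)
    (fun ρ hρ => exists_ball_subset_of_lt_inradius (by
      rw [← hrr]
      exact (ENNReal.ofReal_lt_ofReal_iff hr0').2 hρ))
  set A := (area D).toReal with hA
  have hA0' : 0 < A := ENNReal.toReal_pos hA0.ne' hAt
  have hAA : ENNReal.ofReal A = area D := ENNReal.ofReal_toReal hAt
  rcases eq_or_ne (inradius Ω) ⊤ with hρt | hρt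
  · have hVt : area Ω = ⊤ := by
      rw [hρt, ENNReal.top_pow two_ne_zero, ENNReal.mul_top hπ0, top_le_iff] at hsqΩ
      exact hsqΩ
    -- here `reducedInradius Ω = ⊤`, since the quotient `⊤ / ⊤` in its denominator is zero
    simp [reducedInradius, hρt, hVt]
  set ρ := (inradius Ω).toReal with hρ
  have hρρ : ENNReal.ofReal ρ = inradius Ω := ENNReal.ofReal_toReal hρt
  have hrρ : r ≤ ρ := ENNReal.toReal_mono hρt (inradius_mono hDΩ)
  have hρ0 : 0 < ρ := hr0'.trans_le hrρ
  -- zero if the area of `Ω` is infinite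
  set w := ((area Ω)⁻¹).toReal with hw
  have hww : ENNReal.ofReal w = (area Ω)⁻¹ := ENNReal.ofReal_toReal (ENNReal.inv_ne_top.2 hV0)
  have hw0 : 0 ≤ w := ENNReal.toReal_nonneg
  have hwA : w * A ≤ 1 := by
    have h1 : (area Ω)⁻¹ * area D ≤ 1 :=
      (mul_le_mul_right (measure_mono hDΩ) _).trans (ENNReal.inv_mul_le_one _)
    rw [← hww, ← hAA, ← ENNReal.ofReal_mul hw0, ← ENNReal.ofReal_one] at h1
    exact (ENNReal.ofReal_le_ofReal_iff zero_le_one).1 h1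
  have hred : ENNReal.ofReal Real.pi * inradius Ω ^ 2 / area Ω =
      ENNReal.ofReal (Real.pi * ρ ^ 2 * w) := by
    rw [div_eq_mul_inv, ← hρρ, ← hww, ← ENNReal.ofReal_pow hρ0.le,
      ← ENNReal.ofReal_mul Real.pi_pos.le, ← ENNReal.ofReal_mul (by positivity)]
  have hwρ : Real.pi * ρ ^ 2 * w ≤ 1 := by
    have h1 : ENNReal.ofReal Real.pi * inradius Ω ^ 2 / area Ω ≤ 1 :=
      ENNReal.div_le_of_le_mul (by rwa [one_mul])
    rw [hred, ← ENNReal.ofReal_one] at h1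
    exact (ENNReal.ofReal_le_ofReal_iff zero_le_one).1 h1
  have hmain := one_add_div_le_of_bonnesen hr0' hrρ hA0' hwA hwρ hbon
  rw [reducedInradius, hred, ← hρρ, ← ENNReal.ofReal_one,
    ← ENNReal.ofReal_add zero_le_one (by positivity), ← ENNReal.ofReal_div_of_pos (by positivity),
    ← ENNReal.ofReal_div_of_pos (by positivity), one_div_div, ← hAA]
  calc ENNReal.ofReal ((1 + Real.pi * ρ ^ 2 * w) / ρ)
      ≤ ENNReal.ofReal (L / A) := ENNReal.ofReal_le_ofReal hmain
    _ = ENNReal.ofReal L / ENNReal.ofReal A := ENNReal.ofReal_div_of_pos hA0'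
    _ ≤ boundaryLength D / ENNReal.ofReal A := ENNReal.div_le_div_right hL _
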